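/- **Model.** A task graph is a finite directed acyclic graph $G=(V,E)$ without parallel edges, with nonnegative real edge costs $c(u,v)$, a start $s$ and an end $t$ reachable from $s$; write $c(v\to t)\in[0,\infty]$ for the cost of a cheapest path from $v$ to $t$. An agent with bias $b>1$ standing at a vertex $u\ne t$ moves along an edge $(u,v)$ that minimizes the perceived cost $p(u,v)=b\,c(u,v)+c(v\to t)$, and stops at $t$. Splitting an edge $(u,v)$ into $\ell$ chunks replaces it by a path $u=u_1,u_2,\dots,u_\ell,v$ with edge costs $x_1,\dots,x_\ell\ge 0$, $\sum_i x_i=c(u,v)$, where every intermediate vertex $u_i$ ($i\ge2$) also gets the original edges $(u_i,w)$ of cost $c(u,w)$ for all out-neighbours $w\neq v$ of $u$. If several edges have minimal perceived cost, the agent takes the one lying on a chunked path (an edge split into at least two chunks) if there is exactly one such edge among them, and otherwise the first in a fixed ordering of the vertices (where an edge counts as leading to the original vertex towards which it is directed). A chunking of $G$ with local constraint $k\ge1$ splits each edge into at least one and at most $k$ chunks; it is optimal if the total cost that the agent really incurs from $s$ to $t$ is minimal among all such chunkings. The bottleneck of a chunking of a single edge is the maximum of the perceived costs of starting with one of its chunks,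 and an optimal $k$-chunking of an edge is a chunking into exactly $k$ (possibly zero-cost) chunks with the smallest bottleneck. Call an edge $(u,v)$ persuadable if some splitting of this edge alone into at most $k$ chunks makes the agent at $u$ complete all its chunks. **Theorem.** Consider a real random access machine (unit-cost arithmetic and comparisons on reals). There is an edge-chunking algorithm $P$ that, given $k\ge 1$, $b>1$, $c(u,v)$, $c(u\to t)$ and $c(v\to t)<\infty$ for an edge $(u,v)$ of a task graph, computes an optimal $k$-chunking of $(u,v)$ and its bottleneck in time $O(k)$, and there is an algorithm that, given any task graph $G=(V,E)$ (as a list of edges), bias $b>1$ and local constraint $k\ge1$, computes an optimal chunking of $G$ with local constraint $k$, using at most $|E|$ calls of $P$ (each on an edge of $G$), $O(|E|+|V|)$ further steps, and hence total time $O(|E|k+|V|)$; the implied constants are absolute. Moreover, the chunking it returns is of the following form: for a cheapest $s$-$t$ path $Q$ in the graph obtained from $G$ by removing all edges that are not persuadable, every edge of $Q$ is split by an optimal $k$-chunking, no other edge is split, and the agent follows $Q$. -/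

import Mathlib

open scoped NNReal ENNReal

namespace Chunking

/-! ## Weighted directed graphs and the present-biased agent -/

/-- A directed graph with vertices `V`, arcs `E` and nonnegative real arc costs. -/
structure WGraph (V E : Type*) where
  src : E → V
  tgt : E → V
  cost : E → ℝ≥0

namespace WGraph

variable {V E : Type*}

/-- `p` is the list of arcs of a walk from the first to the last argument. -/
def IsWalk (G : WGraph V E) : V → List E → V → Prop
  | u, [], v => u = v
  | u, e :: p, v => G.src e = u ∧ G.IsWalk (G.tgt e) p v

/-- The cost of a list of arcs. -/
def walkCost (G : WGraph V E) (p : List E) : ℝ≥0 := (p.map G.cost).sum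

/-- The cost `c(u → t)` of a cheapest walk from `u` to `t`; it is `⊤` if there is no walk. -/
noncomputable def dist (G : WGraph V E) (u t : V) : ℝ≥0∞ :=
  ⨅ (p : List E) (_ : G.IsWalk u p t), (G.walkCost p : ℝ≥0∞)

/-- The cost perceived by an agent of bias `b` of starting with the arc `a` and then following a
shortest path to `t`. -/
noncomputable def perceived (G : WGraph V E) (b : ℝ≥0) (t : V) (a : E) : ℝ≥0∞ :=
  (b : ℝ≥0∞) * (G.cost a : ℝ≥0∞) + G.dist (G.tgt a) t

/-- The arc `a` has the least perceived cost among the arcs that leave its source. -/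
def IsBest (G : WGraph V E) (b : ℝ≥0) (t : V) (a : E) : Prop :=
  ∀ a', G.src a' = G.src a → G.perceived b t a ≤ G.perceived b t a'

/-- The arc `a` is the one that the agent takes at its source. The arc has the least perceived
cost; ties are broken in favour of an arc satisfying `pref` if exactly one of the tied arcs does,
and by the least `rank` otherwise. -/
def Chooses {R : Type*} [LinearOrder R] (G : WGraph V E) (b : ℝ≥0) (t : V)
    (pref : E → Prop) (rank : E → R) (a : E) : Prop :=
  G.IsBest b t a ∧
  ((∃! a', G.src a' = G.src a ∧ G.IsBest b t a' ∧ pref a') → pref a) ∧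
  (¬ (∃! a', G.src a' = G.src a ∧ G.IsBest b t a' ∧ pref a') →
    ∀ a', G.src a' = G.src a → G.IsBest b t a' → rank a ≤ rank a')

/-- `p` is the list of arcs along which the agent, placed at the given vertex, travels until it
reaches `t`, where it stops. -/
def IsRun {R : Type*} [LinearOrder R] (G : WGraph V E) (b : ℝ≥0) (t : V)
    (pref : E → Prop) (rank : E → R) : V → List E → Prop
  | v, [] => v = t
  | v, a :: p => v ≠ t ∧ G.src a = v ∧ G.Chooses b t pref rank a ∧
      G.IsRun b t pref rank (G.tgt a) p

end WGraph

/-- A task graph: a directed acyclic graph without parallel edges, with nonnegative costs, a start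
`s` and an end `t` that can be reached from `s`. -/
structure TaskGraph (V E : Type*) extends WGraph V E where
  s : V
  t : V
  simple : ∀ e f : E, src e = src f → tgt e = tgt f → e = f
  acyclic : ∀ (v : V) (p : List E), toWGraph.IsWalk v p v → p = []
  reach : ∃ p : List E, toWGraph.IsWalk s p t

/-! ## Chunking -/

/-- The vertices of a chunked graph: the task vertices, and for each edge `e` the vertex `mid e i`
at which exactly the first `i` chunks of `e` are completed. -/
inductive ChunkVertex (V E : Type*) where
  | task (v : V)
  | mid (e : E) (i : ℕ)

/-- The arcs of the graph obtained from `G` by splitting each edge `e` into chunks of costs `C e`.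
The arc `chunk e i` is the chunk number `i` (counted from 0) of `e`. The arc `leave e i f` goes,
after `i` chunks of `e`, along another edge `f` out of the source of `e`: the intermediate vertices
keep the edges to the other out-neighbours of that source. -/
inductive ChunkArc {V E : Type*} (G : WGraph V E) (C : E → List ℝ≥0) where
  | chunk (e : E) (i : Fin (C e).length)
  | leave (e : E) (i : ℕ) (f : E) (hpos : 0 < i) (hlt : i < (C e).length)
      (hne : f ≠ e) (hsrc : G.src f = G.src e)

section

variable {V E : Type*}

/-- The vertex reached after `i` chunks of the edge `e`. -/
def chunkNode (G : WGraph V E) (C : E → List ℝ≥0) (e : E) (i : ℕ) : ChunkVertex V E :=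
  if i = 0 then .task (G.src e) else if i < (C e).length then .mid e i else .task (G.tgt e)

/-- The graph in which each edge `e` of `G` is replaced by a path with arc costs `C e`. -/
def chunked (G : WGraph V E) (C : E → List ℝ≥0) : WGraph (ChunkVertex V E) (ChunkArc G C) where
  src
    | .chunk e i => chunkNode G C e i
    | .leave e i _ _ _ _ _ => .mid e i
  tgt
    | .chunk e i => chunkNode G C e (i + 1)
    | .leave _ _ f _ _ _ _ => .task (G.tgt f)
  cost
    | .chunk e i => (C e).get i
    | .leave _ _ f _ _ _ _ => G.cost f

/-- The arcs that belong to a chunked path, that is, to an edge split into at least two chunks. -/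
def onChunkedPath (G : WGraph V E) (C : E → List ℝ≥0) : ChunkArc G C → Prop
  | .chunk e _ => 2 ≤ (C e).length
  | .leave _ _ _ _ _ _ _ => False

/-- The task vertex towards which an arc leads; it orders the arcs out of one vertex. -/
def heading (G : WGraph V E) (C : E → List ℝ≥0) : ChunkArc G C → V
  | .chunk e _ => G.tgt e
  | .leave _ _ f _ _ _ _ => G.tgt f

namespace TaskGraph

/-- The list `l` splits the edge `e` into at least one chunk and at most `k` chunks; the total cost
does not change. -/
def IsEdgeChunking (G : TaskGraph V E) (k : ℕ) (e : E) (l : List ℝ≥0) : Prop :=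
  l ≠ [] ∧ l.length ≤ k ∧ l.sum = G.cost e

/-- A chunking of the whole graph with local constraint `k`. -/
def IsChunking (G : TaskGraph V E) (k : ℕ) (C : E → List ℝ≥0) : Prop :=
  ∀ e, G.IsEdgeChunking k e (C e)

variable [LinearOrder V]

/-- `a` is the choice of the agent of bias `b` in the graph chunked by `C`. -/
def AgentChooses (G : TaskGraph V E) (b : ℝ≥0) (C : E → List ℝ≥0)
    (a : ChunkArc G.toWGraph C) : Prop :=
  (chunked G.toWGraph C).Chooses b (.task G.t)
    (onChunkedPath G.toWGraph C) (heading G.toWGraph C) a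

/-- `p` is the way of the agent of bias `b` from `s` to `t` in the graph chunked by `C`. -/
def AgentRun (G : TaskGraph V E) (b : ℝ≥0) (C : E → List ℝ≥0)
    (p : List (ChunkArc G.toWGraph C)) : Prop :=
  (chunked G.toWGraph C).IsRun b (.task G.t)
    (onChunkedPath G.toWGraph C) (heading G.toWGraph C) (.task G.s) p

/-- `C` is an optimal chunking with local constraint `k`: the cost that the agent actually incurs
is as low as possible. -/
def IsOptimalChunking (G : TaskGraph V E) (b : ℝ≥0) (k : ℕ) (C : E → List ℝ≥0) : Prop :=
  G.IsChunking k C ∧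
  ∃ p, G.AgentRun b C p ∧
    ∀ C', G.IsChunking k C' → ∀ p', G.AgentRun b C' p' →
      (chunked G.toWGraph C).walkCost p ≤ (chunked G.toWGraph C').walkCost p'

/-- The arcs of the chunked graph that make up the edges of `q`, in order. -/
def expand (G : TaskGraph V E) (C : E → List ℝ≥0) (q : List E) :
    List (ChunkArc G.toWGraph C) :=
  q.flatMap fun e => (List.finRange (C e).length).map (ChunkArc.chunk e)

variable [DecidableEq E]

/-- Only the edge `e` is split, into chunks of costs `l`. -/
def single (G : TaskGraph V E) (e : E) (l : List ℝ≥0) : E → List ℝ≥0 :=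
  Function.update (fun f => [G.cost f]) e l

/-- The bottleneck of the chunking `l` of the edge `e`: the highest perceived cost of starting
with one of its chunks, when only `e` is split. -/
noncomputable def bottleneck (G : TaskGraph V E) (b : ℝ≥0) (e : E) (l : List ℝ≥0) : ℝ≥0∞ :=
  ⨆ i : Fin (G.single e l e).length,
    (chunked G.toWGraph (G.single e l)).perceived b (.task G.t) (.chunk e i)

/-- `l` splits `e` into exactly `k` chunks, with the least possible bottleneck. -/
def IsOptimalEdgeChunking (G : TaskGraph V E) (b : ℝ≥0) (k : ℕ) (e : E) (l : List ℝ≥0) : Prop :=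
  (l.length = k ∧ l.sum = G.cost e) ∧
  ∀ l' : List ℝ≥0, l'.length = k → l'.sum = G.cost e → G.bottleneck b e l ≤ G.bottleneck b e l'

/-- By splitting `e` into at most `k` chunks, the agent at the source of `e` can be made to take
`e`, that is, to complete all its chunks. -/
def Persuadable (G : TaskGraph V E) (b : ℝ≥0) (k : ℕ) (e : E) : Prop :=
  ∃ l, G.IsEdgeChunking k e l ∧
    ∀ i : Fin (G.single e l e).length, G.AgentChooses b (G.single e l) (.chunk e i)

/-- `q` is a cheapest path from `s` to `t` among those that use persuadable edges only. -/
def IsCheapestPersuadable (G : TaskGraph V E) (b : ℝ≥0) (k : ℕ) (q : List E) : Prop :=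
  (G.IsWalk G.s q G.t ∧ ∀ e ∈ q, G.Persuadable b k e) ∧
  ∀ q', G.IsWalk G.s q' G.t → (∀ e ∈ q', G.Persuadable b k e) → G.walkCost q ≤ G.walkCost q'

end TaskGraph

end

/-! ## A real random access machine with a subroutine -/

/-- The memory: registers and arrays, holding natural numbers (addresses, counters) or real
numbers. The first argument of each field is the name of a register or of an array. -/
structure Store where
  natReg : ℕ → ℕ
  realReg : ℕ → ℝ
  natArr : ℕ → ℕ → ℕ
  realArr : ℕ → ℕ → ℝ

/-- Expressions for natural numbers; `sub` is truncated. -/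
inductive NExp where
  | lit (n : ℕ)
  | reg (x : ℕ)
  | arr (a : ℕ) (i : NExp)
  | add (p q : NExp)
  | sub (p q : NExp)

/-- Expressions for real numbers. -/
inductive RExp where
  | lit (n : ℕ)
  | reg (x : ℕ)
  | arr (a : ℕ) (i : NExp)
  | add (p q : RExp)
  | sub (p q : RExp)
  | mul (p q : RExp)
  | div (p q : RExp)

/-- Tests. -/
inductive BExp where
  | nle (p q : NExp)
  | rle (p q : RExp)
  | not (p : BExp)
  | and (p q : BExp)

def NExp.eval (σ : Store) : NExp → ℕ
  | lit n => n
  | reg x => σ.natReg x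
  | arr a i => σ.natArr a (i.eval σ)
  | add p q => p.eval σ + q.eval σ
  | sub p q => p.eval σ - q.eval σ

/-- The number of operations needed to evaluate an expression. -/
def NExp.ops : NExp → ℕ
  | lit _ => 1
  | reg _ => 1
  | arr _ i => i.ops + 1
  | add p q => p.ops + q.ops + 1
  | sub p q => p.ops + q.ops + 1

noncomputable def RExp.eval (σ : Store) : RExp → ℝ
  | lit n => n
  | reg x => σ.realReg x
  | arr a i => σ.realArr a (i.eval σ)
  | add p q => p.eval σ + q.eval σ
  | sub p q => p.eval σ - q.eval σ
  | mul p q => p.eval σ * q.eval σ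
  | div p q => p.eval σ / q.eval σ

/-- The number of operations needed to evaluate an expression. -/
def RExp.ops : RExp → ℕ
  | lit _ => 1
  | reg _ => 1
  | arr _ i => i.ops + 1
  | add p q => p.ops + q.ops + 1
  | sub p q => p.ops + q.ops + 1
  | mul p q => p.ops + q.ops + 1
  | div p q => p.ops + q.ops + 1

def BExp.holds (σ : Store) : BExp → Prop
  | nle p q => p.eval σ ≤ q.eval σ
  | rle p q => p.eval σ ≤ q.eval σ
  | not p => ¬ p.holds σ
  | and p q => p.holds σ ∧ q.holds σ

/-- The number of operations needed to evaluate a test. -/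
def BExp.ops : BExp → ℕ
  | nle p q => p.ops + q.ops + 1
  | rle p q => p.ops + q.ops + 1
  | not p => p.ops + 1
  | and p q => p.ops + q.ops + 1

/-- Programs. The instruction `call` runs the subroutine, on the same memory. -/
inductive Prog where
  | skip
  | setNat (x : ℕ) (p : NExp)
  | setReal (x : ℕ) (p : RExp)
  | putNat (a : ℕ) (i p : NExp)
  | putReal (a : ℕ) (i : NExp) (p : RExp)
  | seq (c d : Prog)
  | cond (q : BExp) (c d : Prog)
  | loop (q : BExp) (c : Prog)
  | call

def Store.setNat (σ : Store) (x v : ℕ) : Store :=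
  { σ with natReg := Function.update σ.natReg x v }

noncomputable def Store.setReal (σ : Store) (x : ℕ) (v : ℝ) : Store :=
  { σ with realReg := Function.update σ.realReg x v }

def Store.putNat (σ : Store) (a i v : ℕ) : Store :=
  { σ with natArr := Function.update σ.natArr a (Function.update (σ.natArr a) i v) }

noncomputable def Store.putReal (σ : Store) (a i : ℕ) (v : ℝ) : Store :=
  { σ with realArr := Function.update σ.realArr a (Function.update (σ.realArr a) i v) }

/-- What an execution costs: the number of steps outside the subroutine, the number of steps inside
it, and the list of the memories with which the subroutine was called. -/
structure Cost where
  own : ℕ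
  inner : ℕ
  calls : List Store

/-- Terminating executions. In `Exec sub c σ σ' κ` the program `c` turns the memory `σ` into `σ'` at
cost `κ`, with the subroutine `sub` if there is one. Without one, `call` cannot be executed; in
particular the subroutine itself contains no executed `call`. -/
inductive Exec : Option Prog → Prog → Store → Store → Cost → Prop
  | skip (sub σ) : Exec sub .skip σ σ ⟨1, 0, []⟩
  | setNat (sub σ x p) :
      Exec sub (.setNat x p) σ (σ.setNat x (p.eval σ)) ⟨p.ops + 1, 0, []⟩
  | setReal (sub σ x p) :
      Exec sub (.setReal x p) σ (σ.setReal x (p.eval σ)) ⟨p.ops + 1, 0, []⟩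
  | putNat (sub σ a i p) :
      Exec sub (.putNat a i p) σ (σ.putNat a (i.eval σ) (p.eval σ)) ⟨i.ops + p.ops + 1, 0, []⟩
  | putReal (sub σ a i p) :
      Exec sub (.putReal a i p) σ (σ.putReal a (i.eval σ) (p.eval σ)) ⟨i.ops + p.ops + 1, 0, []⟩
  | seq {sub c d σ σ' σ'' κ κ'} : Exec sub c σ σ' κ → Exec sub d σ' σ'' κ' →
      Exec sub (.seq c d) σ σ'' ⟨κ.own + κ'.own, κ.inner + κ'.inner, κ.calls ++ κ'.calls⟩
  | condTrue {sub q c d σ σ' κ} : q.holds σ → Exec sub c σ σ' κ →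
      Exec sub (.cond q c d) σ σ' ⟨q.ops + 1 + κ.own, κ.inner, κ.calls⟩
  | condFalse {sub q c d σ σ' κ} : ¬ q.holds σ → Exec sub d σ σ' κ →
      Exec sub (.cond q c d) σ σ' ⟨q.ops + 1 + κ.own, κ.inner, κ.calls⟩
  | loopDone {sub q c σ} : ¬ q.holds σ →
      Exec sub (.loop q c) σ σ ⟨q.ops + 1, 0, []⟩
  | loopStep {sub q c σ σ' σ'' κ κ'} : q.holds σ → Exec sub c σ σ' κ →
      Exec sub (.loop q c) σ' σ'' κ' →
      Exec sub (.loop q c) σ σ''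
        ⟨q.ops + 1 + κ.own + κ'.own, κ.inner + κ'.inner, κ.calls ++ κ'.calls⟩
  | call {body σ σ' κ} : Exec none body σ σ' κ →
      Exec (some body) .call σ σ' ⟨1, κ.own, [σ]⟩

/-! ## Input and output conventions -/

/-- The input of the subroutine for the edge `e = (u, v)`: natural register 2 holds `k`; the real
registers 0, 1, 2, 3 hold `b`, `c(u, v)`, `c(u → t)` and `c(v → t)`. The vertex `t` must be
reachable from `v`. Nothing is assumed about the rest of the memory. -/
def EdgeInput {V E : Type*} (G : TaskGraph V E) (b : ℝ≥0) (k : ℕ) (e : E) (σ : Store) : Prop :=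
  G.dist (G.tgt e) G.t ≠ ⊤ ∧
  σ.natReg 2 = k ∧
  σ.realReg 0 = b ∧
  σ.realReg 1 = G.cost e ∧
  σ.realReg 2 = (G.dist (G.src e) G.t).toReal ∧
  σ.realReg 3 = (G.dist (G.tgt e) G.t).toReal

/-- The entries `p, p + 1, …` of the real array 1 hold the list `l`. -/
def HoldsAt (σ : Store) (p : ℕ) (l : List ℝ≥0) : Prop :=
  ∀ i : Fin l.length, σ.realArr 1 (p + i) = l.get i

/-- The output of the subroutine called with memory `σ`: the real array 1 holds an optimal
`k`-chunking of `e`, from the position that was given in the natural register 5; the real register 4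
holds its bottleneck. -/
def EdgeOutput {V E : Type*} [LinearOrder V] [DecidableEq E] (G : TaskGraph V E) (b : ℝ≥0) (k : ℕ)
    (e : E) (σ σ' : Store) : Prop :=
  ∃ l, G.IsOptimalEdgeChunking b k e l ∧ HoldsAt σ' (σ.natReg 5) l ∧
    0 ≤ σ'.realReg 4 ∧ G.bottleneck b e l = ENNReal.ofReal (σ'.realReg 4)

/-- `P` is an optimal edge-chunking algorithm, running in at most `A * k` steps once the distances
to `t` are known. -/
def IsEdgeChunkingAlgorithm (A : ℕ) (P : Prog) : Prop :=
  ∀ (n m : ℕ) (G : TaskGraph (Fin n) (Fin m)) (b : ℝ≥0) (k : ℕ) (e : Fin m) (σ : Store),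
    1 < b → 1 ≤ k → EdgeInput G b k e σ →
      ∃ σ' κ, Exec none P σ σ' κ ∧ κ.own ≤ A * k ∧ EdgeOutput G b k e σ σ'

/-- The initial memory for a task graph, given by an unsorted list of edges. The natural registers
0, 1, 2, 3, 4 hold `|V|`, `|E|`, `k`, `s`, `t`, the real register 0 holds `b`, the natural arrays 0
and 1 hold the sources and targets of the edges, and the real array 0 their costs. Everything else
is zero. -/
noncomputable def graphInput {n m : ℕ} (G : TaskGraph (Fin n) (Fin m)) (b : ℝ≥0) (k : ℕ) :
    Store where
  natReg x := if x = 0 then n else if x = 1 then m else if x = 2 then k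
    else if x = 3 then (G.s : ℕ) else if x = 4 then (G.t : ℕ) else 0
  realReg x := if x = 0 then (b : ℝ) else 0
  natArr a i := if h : i < m then
      (if a = 0 then (G.src ⟨i, h⟩ : ℕ) else if a = 1 then (G.tgt ⟨i, h⟩ : ℕ) else 0)
    else 0
  realArr a i := if h : i < m then (if a = 0 then (G.cost ⟨i, h⟩ : ℝ) else 0) else 0

/-- The memory describes the chunking `C`: the natural array 2 holds the number of chunks of each
edge, and their costs stand in the real array 1, from the position given in the natural array 3. -/
def GraphOutput {m : ℕ} (C : Fin m → List ℝ≥0) (σ : Store) : Prop :=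
  ∀ e : Fin m, σ.natArr 2 e = (C e).length ∧ HoldsAt σ (σ.natArr 3 e) (C e)

end Chunking

open Chunking

/-! Splitting edges leaves the distances between task vertices and `t` unchanged, and after some
chunks of `e` the remaining distance is the smaller of two costs: finishing `e`, or leaving along an
edge out of its source (`chunked_dist_task`). Hence the perceived cost of a chunk depends only on
the chunks of its own edge and on distances in `G`, and leaving along `f` is perceived like the
unsplit `f`. Splitting a competing edge can only make its start look cheaper. So an edge whose
chunks are all taken in some chunking of the whole graph is persuadable on its own
(`persuadable_of_chooses`). For `k ≥ 2` an edge is persuadable exactly if the bottleneck of an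
optimal `k`-chunking is at most the perceived cost of every edge out of its source
(`persuadable_iff_of_two_le`). Ties do no harm here: the chunked path wins them, and an unsplit edge
can be given an extra chunk of cost zero. For `k = 1` only the first of the best edges is
persuadable (`persuadable_one_iff`).

Lower bound for the agent's cost: from any run, delete the chunks of edges that were abandoned. What
remains is a walk in `G` that costs no more. Its completed edges are persuadable. An edge along
which the agent leaves another one is a best edge of `G`, and since `k ≥ 2` in that case, it is
persuadable too (`exists_walk_le_of_isRun`). Conversely, a walk in an acyclic graph leaves each
vertex at most once, so optimal chunkings of its edges do not compete with each other, and the agent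
follows a walk of persuadable edges split in this way (`isOptimalChunking_of_path`). Such a walk
exists because the first best edge out of each vertex is persuadable (`exists_persuadable_walk`).

For one edge, fix a bound `β` on the perceived costs. Choosing chunks from the last to the first,
each as large as `β` permits, covers the largest total cost. This `capacity` obeys `F ↦ F + (β - min
(F + Dv) Du) / b` after its first step, with `Du` and `Dv` the distances from the two ends of the
edge. If `Du ≤ β`, the minimum switches branches at most once. So the capacity of `k` chunks equals
one of `k` increasing affine functions of `β` (`exists_capacity_eq`), and it is at least each of
them (`le_capacity`). Therefore the least feasible `β` is the maximum of `Du`, `Dv` and the least of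
the `k` values at which these functions reach the cost of the edge. These values are scanned in
linear time, and the greedy choice then yields the chunks.

For the whole graph, the edges are ordered backwards from the sinks. One relaxation per edge gives
the distances to `t`, and one scan the best edge out of each vertex. Persuadability of an edge is
then decided by comparing its bottleneck with the perceived cost of that best edge. A second round
of relaxations, restricted to persuadable edges, yields the path. Correctness and running time are
proved together by `Spec`, a Hoare triple that also bounds steps and calls, with `Encodes` and
`Keeps` as frame conditions. -/

namespace Chunking

/-! ## Reasoning about programs -/

section Store

variable (σ : Store)

@[simp] theorem Store.setNat_natReg (x v y : ℕ) :
    (σ.setNat x v).natReg y = if y = x then v else σ.natReg y := by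
  simp [Store.setNat, Function.update_apply]
@[simp] theorem Store.setNat_realReg (x v : ℕ) : (σ.setNat x v).realReg = σ.realReg := rfl
@[simp] theorem Store.setNat_natArr (x v : ℕ) : (σ.setNat x v).natArr = σ.natArr := rfl
@[simp] theorem Store.setNat_realArr (x v : ℕ) : (σ.setNat x v).realArr = σ.realArr := rfl

@[simp] theorem Store.setReal_realReg (x : ℕ) (v : ℝ) (y : ℕ) :
    (σ.setReal x v).realReg y = if y = x then v else σ.realReg y := by
  simp [Store.setReal, Function.update_apply]
@[simp] theorem Store.setReal_natReg (x : ℕ) (v : ℝ) : (σ.setReal x v).natReg = σ.natReg := rfl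
@[simp] theorem Store.setReal_natArr (x : ℕ) (v : ℝ) : (σ.setReal x v).natArr = σ.natArr := rfl
@[simp] theorem Store.setReal_realArr (x : ℕ) (v : ℝ) : (σ.setReal x v).realArr = σ.realArr := rfl

@[simp] theorem Store.putNat_natReg (a i v : ℕ) : (σ.putNat a i v).natReg = σ.natReg := rfl
@[simp] theorem Store.putNat_realReg (a i v : ℕ) : (σ.putNat a i v).realReg = σ.realReg := rfl
@[simp] theorem Store.putNat_natArr (a i v a' : ℕ) :
    (σ.putNat a i v).natArr a' =
      if a' = a then Function.update (σ.natArr a) i v else σ.natArr a' := by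
  simp [Store.putNat, Function.update_apply]
@[simp] theorem Store.putNat_realArr (a i v : ℕ) : (σ.putNat a i v).realArr = σ.realArr := rfl

@[simp] theorem Store.putReal_natReg (a i : ℕ) (v : ℝ) :
    (σ.putReal a i v).natReg = σ.natReg := rfl
@[simp] theorem Store.putReal_realReg (a i : ℕ) (v : ℝ) :
    (σ.putReal a i v).realReg = σ.realReg := rfl
@[simp] theorem Store.putReal_natArr (a i : ℕ) (v : ℝ) :
    (σ.putReal a i v).natArr = σ.natArr := rfl
@[simp] theorem Store.putReal_realArr (a i : ℕ) (v : ℝ) (a' : ℕ) :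
    (σ.putReal a i v).realArr a' =
      if a' = a then Function.update (σ.realArr a) i v else σ.realArr a' := by
  simp [Store.putReal, Function.update_apply]

end Store

attribute [simp] NExp.eval RExp.eval BExp.holds

/-- Sequential composition of a list of programs. -/
def Prog.block : List Prog → Prog
  | [] => .skip
  | c :: l => .seq c (Prog.block l)

open Classical in
/-- The memory after running a program without loops and calls. -/
noncomputable def Prog.run : Prog → Store → Store
  | .skip, σ => σ
  | .setNat x p, σ => σ.setNat x (p.eval σ)
  | .setReal x p, σ => σ.setReal x (p.eval σ)
  | .putNat a i p, σ => σ.putNat a (i.eval σ) (p.eval σ)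
  | .putReal a i p, σ => σ.putReal a (i.eval σ) (p.eval σ)
  | .seq c d, σ => d.run (c.run σ)
  | .cond q c d, σ => if q.holds σ then c.run σ else d.run σ
  | .loop _ _, σ => σ
  | .call, σ => σ

/-- The program contains no loops and no calls. -/
def Prog.Straight : Prog → Prop
  | .seq c d => c.Straight ∧ d.Straight
  | .cond _ c d => c.Straight ∧ d.Straight
  | .loop _ _ => False
  | .call => False
  | _ => True

/-- A bound for the running time of a program without loops and calls. -/
def Prog.size : Prog → ℕ
  | .skip => 1
  | .setNat _ p => p.ops + 1
  | .setReal _ p => p.ops + 1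
  | .putNat _ i p => i.ops + p.ops + 1
  | .putReal _ i p => i.ops + p.ops + 1
  | .seq c d => c.size + d.size
  | .cond q c d => q.ops + 1 + (c.size + d.size)
  | .loop _ _ => 0
  | .call => 0

/-- Without loops and calls, execution is a function of the memory. Claims about such programs thus
reduce to simplifying `Prog.run`, and their cost to evaluating `Prog.size`. -/
theorem Prog.Straight.exec {sub : Option Prog} {c : Prog} (hc : c.Straight) (σ : Store) :
    ∃ κ, Exec sub c σ (c.run σ) κ ∧ κ.own ≤ c.size ∧ κ.inner = 0 ∧ κ.calls = [] := by
  induction c generalizing σ with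
  | skip => exact ⟨_, .skip _ _, le_rfl, rfl, rfl⟩
  | setNat x p => exact ⟨_, .setNat _ _ _ _, le_rfl, rfl, rfl⟩
  | setReal x p => exact ⟨_, .setReal _ _ _ _, le_rfl, rfl, rfl⟩
  | putNat a i p => exact ⟨_, .putNat _ _ _ _ _, le_rfl, rfl, rfl⟩
  | putReal a i p => exact ⟨_, .putReal _ _ _ _ _, le_rfl, rfl, rfl⟩
  | seq c d ihc ihd =>
    obtain ⟨κ, h, h1, h2, h3⟩ := ihc hc.1 σ
    obtain ⟨κ', h', h1', h2', h3'⟩ := ihd hc.2 (c.run σ)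
    exact ⟨_, .seq h h', Nat.add_le_add h1 h1', by simp [h2, h2'], by simp [h3, h3']⟩
  | cond q c d ihc ihd =>
    by_cases hq : q.holds σ
    · obtain ⟨κ, h, h1, h2, h3⟩ := ihc hc.1 σ
      refine ⟨⟨q.ops + 1 + κ.own, κ.inner, κ.calls⟩, ?_, ?_, h2, h3⟩
      · rw [Prog.run, if_pos hq]; exact .condTrue hq h
      · simp only [Prog.size]; omega
    · obtain ⟨κ, h, h1, h2, h3⟩ := ihd hc.2 σ
      refine ⟨⟨q.ops + 1 + κ.own, κ.inner, κ.calls⟩, ?_, ?_, h2, h3⟩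
      · rw [Prog.run, if_neg hq]; exact .condFalse hq h
      · simp only [Prog.size]; omega
  | loop q c => exact hc.elim
  | call => exact hc.elim

/-- Started with memory `σ`, the program terminates with a memory satisfying `Q`, after at most `N`
steps of its own, `L` steps of the subroutine, and `M` calls, all with memories satisfying `S`. -/
def Spec (sub : Option Prog) (S : Store → Prop) (c : Prog) (σ : Store) (N L M : ℕ)
    (Q : Store → Prop) : Prop :=
  ∃ σ' κ, Exec sub c σ σ' κ ∧ κ.own ≤ N ∧ κ.inner ≤ L ∧ κ.calls.length ≤ M ∧
    (∀ τ ∈ κ.calls, S τ) ∧ Q σ'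

section Spec

variable {sub : Option Prog} {S Q R : Store → Prop} {c d : Prog} {σ : Store}
  {N L M N' L' M' : ℕ}

theorem Spec.mono (h : Spec sub S c σ N L M R) (hN : N ≤ N') (hL : L ≤ L') (hM : M ≤ M')
    (hQ : ∀ σ', R σ' → Q σ') : Spec sub S c σ N' L' M' Q := by
  obtain ⟨σ', κ, h, h1, h2, h3, h4, h5⟩ := h
  exact ⟨σ', κ, h, h1.trans hN, h2.trans hL, h3.trans hM, h4, hQ _ h5⟩

theorem Spec.imp (h : Spec sub S c σ N L M R) (hQ : ∀ σ', R σ' → Q σ') :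
    Spec sub S c σ N L M Q :=
  h.mono le_rfl le_rfl le_rfl hQ

theorem Spec.of_run (hc : c.Straight) (hQ : Q (c.run σ)) : Spec sub S c σ c.size 0 0 Q := by
  obtain ⟨κ, h, h1, h2, h3⟩ := hc.exec (sub := sub) σ
  exact ⟨_, κ, h, h1, h2.le, by simp [h3], by simp [h3], hQ⟩

theorem Spec.seq (hc : Spec sub S c σ N L M R)
    (hd : ∀ σ', R σ' → Spec sub S d σ' N' L' M' Q) :
    Spec sub S (.seq c d) σ (N + N') (L + L') (M + M') Q := by
  obtain ⟨σ', κ, h, h1, h2, h3, h4, h5⟩ := hc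
  obtain ⟨σ'', κ', h', h1', h2', h3', h4', h5'⟩ := hd σ' h5
  refine ⟨σ'', _, .seq h h', Nat.add_le_add h1 h1', Nat.add_le_add h2 h2', ?_, ?_, h5'⟩
  · simpa using Nat.add_le_add h3 h3'
  · intro τ hτ
    rcases List.mem_append.1 hτ with hτ | hτ
    exacts [h4 τ hτ, h4' τ hτ]

theorem Spec.cond {q : BExp} (hc : q.holds σ → Spec sub S c σ N L M Q)
    (hd : ¬ q.holds σ → Spec sub S d σ N L M Q) :
    Spec sub S (.cond q c d) σ (q.ops + 1 + N) L M Q := by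
  by_cases hq : q.holds σ
  · obtain ⟨σ', κ, h, h1, h2, h3, h4, h5⟩ := hc hq
    exact ⟨σ', _, .condTrue hq h, Nat.add_le_add_left h1 _, h2, h3, h4, h5⟩
  · obtain ⟨σ', κ, h, h1, h2, h3, h4, h5⟩ := hd hq
    exact ⟨σ', _, .condFalse hq h, Nat.add_le_add_left h1 _, h2, h3, h4, h5⟩

/-- A loop with invariant `I`, whose first argument decreases with each iteration. -/
theorem Spec.loop {q : BExp} (I : ℕ → Store → Prop)
    (hstep : ∀ j σ, I j σ → q.holds σ → Spec sub S c σ N L M fun σ' => ∃ j' < j, I j' σ')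
    (j : ℕ) (hI : I j σ) :
    Spec sub S (.loop q c) σ ((q.ops + 1 + N) * j + (q.ops + 1)) (L * j) (M * j)
      fun σ' => ¬ q.holds σ' ∧ ∃ j', I j' σ' := by
  induction j using Nat.strong_induction_on generalizing σ with
  | _ j ih =>
    by_cases hq : q.holds σ
    · obtain ⟨σ', κ, h, h1, h2, h3, h4, j', hj, h5⟩ := hstep j σ hI hq
      obtain ⟨σ'', κ', h', h1', h2', h3', h4', h5'⟩ := ih j' hj h5
      -- The decrease from `j` to `j'` pays for one iteration. This is used for own steps, inner
      -- steps and calls alike.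
      have e : ∀ x : ℕ, x * j' + x ≤ x * j := fun x => by
        calc x * j' + x = x * (j' + 1) := by ring
          _ ≤ x * j := Nat.mul_le_mul_left _ hj
      refine ⟨σ'', _, .loopStep hq h h', ?_, ?_, ?_, ?_, h5'⟩
      · have := e (q.ops + 1 + N)
        simp only; omega
      · have := e L
        simp only; omega
      · have := e M
        simp only [List.length_append]; omega
      · intro τ hτ
        rcases List.mem_append.1 hτ with hτ | hτ
        exacts [h4 τ hτ, h4' τ hτ]
    · exact ⟨σ, _, .loopDone hq, by simp, by simp, by simp, by simp, hq, j, hI⟩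

/-- Register `r` counts from its present value up to the value of register `z`. -/
def Prog.countUp (r z : ℕ) (c : Prog) : Prog :=
  .loop (.not (.nle (.reg z) (.reg r))) (.seq c (.setNat r (.add (.reg r) (.lit 1))))

/-- The body must preserve counter and bound, and has to establish the next invariant for the memory
after the increment. In `N + 9`, the increment accounts for 4 steps and the test for 5; the final
failing test gives the additional 5. -/
theorem Spec.countUp {r z n i : ℕ} (I : ℕ → Store → Prop)
    (hstep : ∀ i σ, i < n → I i σ → σ.natReg r = i → σ.natReg z = n →
      Spec sub S c σ N L M fun σ' => σ'.natReg r = i ∧ σ'.natReg z = n ∧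
        I (i + 1) (σ'.setNat r (i + 1)))
    (hrz : z ≠ r) (hin : i ≤ n) (hr : σ.natReg r = i) (hz : σ.natReg z = n) (hI : I i σ) :
    Spec sub S (.countUp r z c) σ ((N + 9) * (n - i) + 5) (L * (n - i)) (M * (n - i))
      fun σ' => σ'.natReg z = n ∧ I n σ' := by
  have key := Spec.loop (sub := sub) (S := S) (N := N + 4) (L := L) (M := M) (σ := σ)
    (q := .not (.nle (.reg z) (.reg r)))
    (c := .seq c (.setNat r (.add (.reg r) (.lit 1))))
    (fun j σ => ∃ i, i ≤ n ∧ j = n - i ∧ σ.natReg r = i ∧ σ.natReg z = n ∧ I i σ) ?_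
    (n - i) ⟨i, hin, rfl, hr, hz, hI⟩
  · refine key.mono ?_ le_rfl le_rfl ?_
    · simp only [BExp.ops, NExp.ops]
      apply Nat.add_le_add
      · apply Nat.mul_le_mul_right; omega
      · omega
    · rintro σ' ⟨hq, j', i', hi', -, h1, h2, h3⟩
      simp only [BExp.holds, NExp.eval, not_not] at hq
      obtain rfl : i' = n := by omega
      exact ⟨h2, h3⟩
  · rintro j σ ⟨i, hi, rfl, h1, h2, h3⟩ hq
    simp only [BExp.holds, NExp.eval] at hq
    have hlt : i < n := by omega
    refine ((hstep i σ hlt h3 h1 h2).seq (d := .setNat r (.add (.reg r) (.lit 1)))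
      (N' := 4) (L' := 0) (M' := 0) ?_)
    rintro σ' ⟨h4, h5, h6⟩
    refine Spec.of_run trivial ⟨n - (i + 1), by omega, i + 1, hlt, rfl, ?_⟩
    simp [Prog.run, h4, h5, h6, hrz]

end Spec

end Chunking

namespace Chunking

/-! ## Distances -/

namespace WGraph

variable {V E : Type*} (G : WGraph V E)

@[simp] theorem walkCost_nil : G.walkCost [] = 0 := rfl

@[simp] theorem walkCost_cons (e : E) (p : List E) :
    G.walkCost (e :: p) = G.cost e + G.walkCost p := by
  simp [walkCost]

@[simp] theorem walkCost_append (p q : List E) :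
    G.walkCost (p ++ q) = G.walkCost p + G.walkCost q := by
  simp [walkCost]

theorem isWalk_append {u w : V} {p q : List E} :
    G.IsWalk u (p ++ q) w ↔ ∃ v, G.IsWalk u p v ∧ G.IsWalk v q w := by
  induction p generalizing u with
  | nil => simp [IsWalk]
  | cons e p ih => simp [IsWalk, ih, and_assoc]

/-- The cost of a cheapest walk from `u` to `t` that uses only arcs in `S`. -/
noncomputable def distOn (S : E → Prop) (u t : V) : ℝ≥0∞ :=
  ⨅ (p : List E) (_ : G.IsWalk u p t ∧ ∀ e ∈ p, S e), (G.walkCost p : ℝ≥0∞)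

theorem distOn_true (u t : V) : G.distOn (fun _ => True) u t = G.dist u t := by
  simp [distOn, dist]

variable {G} {S : E → Prop} {t : V}

theorem distOn_le {u : V} {p : List E} (h : G.IsWalk u p t) (hS : ∀ e ∈ p, S e) :
    G.distOn S u t ≤ G.walkCost p :=
  iInf₂_le p ⟨h, hS⟩

theorem distOn_self : G.distOn S t t = 0 :=
  le_antisymm ((distOn_le (p := []) rfl (by simp)).trans (by simp)) bot_le

/-- Together with `le_distOn` this is the Bellman equation at a vertex other than `t`. -/
theorem distOn_src_le {e : E} (he : S e) :
    G.distOn S (G.src e) t ≤ G.cost e + G.distOn S (G.tgt e) t := by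
  conv_rhs => rw [distOn, ENNReal.add_iInf]
  refine le_iInf fun p => ?_
  rw [ENNReal.add_iInf]
  refine le_iInf fun hp => ?_
  refine (distOn_le (p := e :: p) ⟨rfl, hp.1⟩ ?_).trans (by simp)
  simpa [he] using hp.2

/-- The inequalities for the arcs telescope along any walk. This is the source of the lower bounds
for distances in chunked graphs. -/
theorem le_distOn_of_potential (φ : V → ℝ≥0∞) (ht : φ t ≤ 0)
    (h : ∀ e, S e → φ (G.src e) ≤ G.cost e + φ (G.tgt e)) (u : V) : φ u ≤ G.distOn S u t := by
  refine le_iInf₂ fun p hp => ?_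
  induction p generalizing u with
  | nil =>
    obtain rfl : u = t := hp.1
    exact ht.trans bot_le
  | cons e p ih =>
    obtain ⟨⟨rfl, h1⟩, h2⟩ := hp
    have := ih (G.tgt e) ⟨h1, fun f hf => h2 f (List.mem_cons_of_mem _ hf)⟩
    refine (h e (h2 e List.mem_cons_self)).trans ?_
    rw [walkCost_cons, ENNReal.coe_add]
    exact add_le_add_right this _

theorem le_distOn {u : V} (hu : u ≠ t) {x : ℝ≥0∞}
    (h : ∀ e, S e → G.src e = u → x ≤ G.cost e + G.distOn S (G.tgt e) t) :
    x ≤ G.distOn S u t := by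
  refine le_iInf₂ fun p hp => ?_
  cases p with
  | nil => exact (hu hp.1).elim
  | cons e p =>
    obtain ⟨⟨rfl, h1⟩, h2⟩ := hp
    refine (h e (h2 e List.mem_cons_self) rfl).trans ?_
    simpa using add_le_add_right
      (distOn_le h1 fun f hf => h2 f (List.mem_cons_of_mem _ hf)) (G.cost e : ℝ≥0∞)

theorem distOn_ne_top_iff {u : V} :
    G.distOn S u t ≠ ⊤ ↔ ∃ p, G.IsWalk u p t ∧ ∀ e ∈ p, S e := by
  constructor
  · intro h
    by_contra hn
    push Not at hn
    apply h
    simp only [distOn, iInf_eq_top]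
    rintro p ⟨h1, h2⟩
    obtain ⟨e, h3, h4⟩ := hn p h1
    exact (h4 (h2 e h3)).elim
  · rintro ⟨p, h1, h2⟩
    exact ((distOn_le h1 h2).trans_lt ENNReal.coe_lt_top).ne

theorem dist_self : G.dist t t = 0 := by
  rw [← distOn_true]; exact distOn_self

theorem dist_src_le (e : E) : G.dist (G.src e) t ≤ G.cost e + G.dist (G.tgt e) t := by
  simp only [← distOn_true]; exact distOn_src_le trivial

theorem le_dist_of_potential (φ : V → ℝ≥0∞) (ht : φ t ≤ 0)
    (h : ∀ e, φ (G.src e) ≤ G.cost e + φ (G.tgt e)) (u : V) : φ u ≤ G.dist u t := by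
  rw [← distOn_true]; exact le_distOn_of_potential φ ht (fun e _ => h e) u

theorem dist_ne_top_iff {u : V} : G.dist u t ≠ ⊤ ↔ ∃ p, G.IsWalk u p t := by
  rw [← distOn_true, distOn_ne_top_iff]; simp

/-! ### Distances and perceived costs within a partly completed edge -/

variable (G)

/-- The cost of a cheapest walk from `u` to `t` with at least one arc. -/
noncomputable def exitDist (u t : V) : ℝ≥0∞ :=
  ⨅ (e : E) (_ : G.src e = u), ((G.cost e : ℝ≥0∞) + G.dist (G.tgt e) t)

variable {G}

theorem exitDist_le (e : E) : G.exitDist (G.src e) t ≤ G.cost e + G.dist (G.tgt e) t :=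
  iInf₂_le (f := fun (f : E) (_ : G.src f = G.src e) =>
    (G.cost f : ℝ≥0∞) + G.dist (G.tgt f) t) e rfl

theorem dist_le_exitDist (u : V) : G.dist u t ≤ G.exitDist u t :=
  le_iInf₂ fun e he => he ▸ dist_src_le e

/-- A walk to `t` from another vertex has a first arc. -/
theorem exitDist_eq_dist {u : V} (hu : u ≠ t) : G.exitDist u t = G.dist u t := by
  refine le_antisymm ?_ (dist_le_exitDist u)
  rw [← distOn_true]
  refine le_distOn hu fun e _ he => ?_
  subst he
  rw [distOn_true]
  exact exitDist_le e

variable (G)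

/-- The distance to `t` from the vertex at which the chunks `l` of the edge `e` are still to be
done, and some of its chunks have been done. -/
noncomputable def restDist (t : V) (e : E) (l : List ℝ≥0) : ℝ≥0∞ :=
  if l = [] then G.dist (G.tgt e) t
  else min ((l.sum : ℝ≥0) + G.dist (G.tgt e) t) (G.exitDist (G.src e) t)

/-- The highest perceived cost of starting with one of the last chunks `l` of the edge `e`. -/
noncomputable def maxPerceived (b : ℝ≥0) (t : V) (e : E) : List ℝ≥0 → ℝ≥0∞
  | [] => 0
  | x :: l => max (b * x + G.restDist t e l) (maxPerceived b t e l)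

variable {G} {b : ℝ≥0} {e : E}

@[simp] theorem restDist_nil : G.restDist t e [] = G.dist (G.tgt e) t := by simp [restDist]

@[simp] theorem restDist_cons (x : ℝ≥0) (l : List ℝ≥0) : G.restDist t e (x :: l) =
    min (((x :: l).sum : ℝ≥0) + G.dist (G.tgt e) t) (G.exitDist (G.src e) t) := by
  simp [restDist]

theorem restDist_le (l : List ℝ≥0) :
    G.restDist t e l ≤ (l.sum : ℝ≥0) + G.dist (G.tgt e) t := by
  cases l with
  | nil => simp
  | cons x l => rw [restDist_cons]; exact min_le_left _ _

/-- Makes `restDist` a potential along the chunks of an edge: finishing the edge becomes cheaper by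
exactly `x`, and the cost of leaving does not change until the edge is complete. -/
theorem restDist_le_add (x : ℝ≥0) (l : List ℝ≥0) :
    G.restDist t e (x :: l) ≤ x + G.restDist t e l := by
  cases l with
  | nil => rw [restDist_nil]; exact (restDist_le _).trans (by simp)
  | cons y l =>
    rw [restDist_cons, restDist_cons, ← min_add_add_left]
    refine min_le_min ?_ le_add_self
    simp [add_assoc]

/-- The potential inequality for the first chunk, which starts at a task vertex. -/
theorem dist_src_le_restDist {x : ℝ≥0} {l : List ℝ≥0} (h : (x :: l).sum = G.cost e) :
    G.dist (G.src e) t ≤ x + G.restDist t e l := by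
  refine le_trans (le_min ?_ ?_) ((restDist_cons x l).symm.trans_le (restDist_le_add x l))
  · rw [h]; exact dist_src_le e
  · exact dist_le_exitDist _

/-- Only the chunk `x` is magnified by the bias; what follows counts once. Allowing a sum below the
cost of `e` covers the remaining chunks of a partly completed edge. -/
theorem perceived_first_le (hb : 1 ≤ b) {x : ℝ≥0} {l : List ℝ≥0}
    (h : (x :: l).sum ≤ G.cost e) : b * x + G.restDist t e l ≤ G.perceived b t e := by
  refine (add_le_add_right (restDist_le l) _).trans ?_
  rw [perceived, ← add_assoc]
  refine add_le_add_left ?_ _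
  norm_cast
  calc b * x + l.sum ≤ b * x + b * l.sum := by gcongr; exact le_mul_of_one_le_left bot_le hb
    _ = b * (x :: l).sum := by simp [mul_add]
    _ ≤ b * G.cost e := by gcongr

theorem maxPerceived_le_iff {l : List ℝ≥0} {B : ℝ≥0∞} : G.maxPerceived b t e l ≤ B ↔
    ∀ i : Fin l.length, b * (l.get i : ℝ≥0∞) + G.restDist t e (l.drop (i + 1)) ≤ B := by
  induction l with
  | nil => simp [maxPerceived]
  | cons x l ih => simp [maxPerceived, ih, Fin.forall_fin_succ]

/-- A free chunk at the end leaves all remaining sums unchanged. Its own perceived cost is the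
distance from the target, which the preceding chunk already pays, and the new intermediate vertex
only adds the option of leaving. -/
theorem maxPerceived_append_zero {l : List ℝ≥0} (hl : l ≠ []) :
    G.maxPerceived b t e (l ++ [0]) ≤ G.maxPerceived b t e l := by
  induction l with
  | nil => exact (hl rfl).elim
  | cons x l ih =>
    cases l with
    | nil =>
      simp only [List.cons_append, List.nil_append, maxPerceived]
      refine max_le (le_max_of_le_left ?_) (le_max_of_le_left ?_)
      · refine add_le_add_right ((restDist_le _).trans ?_) _
        simp
      · simp
    | cons y l =>
      have h : G.restDist t e (y :: l ++ [0]) = G.restDist t e (y :: l) := by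
        rw [List.cons_append, restDist_cons, restDist_cons]; simp
      rw [List.cons_append, maxPerceived, maxPerceived, h]
      exact max_le_max le_rfl (ih (by simp))

theorem maxPerceived_append_replicate {l : List ℝ≥0} (hl : l ≠ []) (j : ℕ) :
    G.maxPerceived b t e (l ++ List.replicate j 0) ≤ G.maxPerceived b t e l := by
  induction j with
  | zero => simp
  | succ j ih =>
    rw [List.replicate_succ', ← List.append_assoc]
    exact (maxPerceived_append_zero (by simp [hl])).trans ih

theorem maxPerceived_singleton : G.maxPerceived b t e [G.cost e] = G.perceived b t e := by
  simp [maxPerceived, perceived]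

end WGraph

/-! ## The chunked graph -/

section chunked

variable {V E : Type*} {G : WGraph V E} {C : E → List ℝ≥0} {t : V} {b : ℝ≥0} {e f : E}

/-- The lists `C e` split the edges without changing their total costs. -/
def Splits (G : WGraph V E) (C : E → List ℝ≥0) : Prop :=
  ∀ e, C e ≠ [] ∧ (C e).sum = G.cost e

theorem chunkNode_zero : chunkNode G C e 0 = .task (G.src e) := by simp [chunkNode]

theorem chunkNode_of_lt {i : ℕ} (h0 : 0 < i) (hi : i < (C e).length) :
    chunkNode G C e i = .mid e i := by
  simp [chunkNode, h0.ne', hi]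

theorem chunkNode_of_le {i : ℕ} (h0 : 0 < i) (hi : (C e).length ≤ i) :
    chunkNode G C e i = .task (G.tgt e) := by
  simp [chunkNode, h0.ne', hi]

theorem Splits.length_pos (hC : Splits G C) (e : E) : 0 < (C e).length :=
  List.length_pos_iff.2 (hC e).1

theorem drop_eq_cons {l : List ℝ≥0} {i : ℕ} (h : i < l.length) :
    l.drop i = l.get ⟨i, h⟩ :: l.drop (i + 1) := List.drop_eq_getElem_cons h

theorem chunked_dist_node_le (i : ℕ) (hi : i ≤ (C e).length) (hpos : 0 < (C e).length) :
    (chunked G C).dist (chunkNode G C e i) (.task t) ≤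
      ((C e).drop i).sum + (chunked G C).dist (.task (G.tgt e)) (.task t) := by
  induction hi using Nat.decreasingInduction with
  | self => rw [chunkNode_of_le hpos le_rfl]; simp
  | of_succ i hi ih =>
    refine (WGraph.dist_src_le (G := chunked G C) (.chunk e ⟨i, hi⟩)).trans ?_
    rw [drop_eq_cons hi, List.sum_cons, ENNReal.coe_add, add_assoc]
    exact add_le_add_right ih _

/-- The upper bounds come from explicit walks, the lower bounds from using the claimed values as a
potential. The second part is indexed by `chunkNode`, so that it includes the arrival at the target,
where `restDist` of the empty list applies. -/
theorem chunked_dist_task (hC : Splits G C) (u : V) :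
    (chunked G C).dist (.task u) (.task t) = G.dist u t ∧
      ∀ e i, 0 < i → (chunked G C).dist (chunkNode G C e i) (.task t) =
        G.restDist t e ((C e).drop i) := by
  have up : ∀ u, (chunked G C).dist (.task u) (.task t) ≤ G.dist u t := by
    refine WGraph.le_dist_of_potential (fun u => (chunked G C).dist (.task u) (.task t))
      WGraph.dist_self.le fun e => ?_
    have := chunked_dist_node_le (G := G) (t := t) 0 (Nat.zero_le _) (hC.length_pos e)
    rwa [chunkNode_zero, List.drop_zero, (hC e).2] at this
  have up' : ∀ e i, 0 < i → (chunked G C).dist (chunkNode G C e i) (.task t) ≤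
        G.restDist t e ((C e).drop i) := by
    intro e i h0
    by_cases hi : i < (C e).length
    · have h1 := (chunked_dist_node_le (G := G) (t := t) i hi.le (hC.length_pos e)).trans
        (add_le_add_right (up (G.tgt e)) _)
      have hsum : ((C e).drop i).sum ≤ G.cost e := by
        rw [← (hC e).2]
        conv_rhs => rw [← List.take_append_drop i (C e), List.sum_append]
        exact le_add_self
      rw [drop_eq_cons hi] at h1 hsum ⊢
      rw [WGraph.restDist_cons]
      refine le_min h1 (le_iInf₂ fun f hf => ?_)
      -- `exitDist` also ranges over `e` itself, for which there is no leaving arc; but starting `e`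
      -- afresh costs at least as much as finishing it.
      by_cases hfe : f = e
      · subst hfe
        exact h1.trans (add_le_add_left (by exact_mod_cast hsum) _)
      · rw [chunkNode_of_lt h0 hi]
        refine (WGraph.dist_src_le (G := chunked G C) (.leave e i f h0 hi hfe hf)).trans ?_
        exact add_le_add_right (up (G.tgt f)) _
    · rw [chunkNode_of_le h0 (not_lt.1 hi), List.drop_eq_nil_of_le (not_lt.1 hi),
        WGraph.restDist_nil]
      exact up _
  let φ : ChunkVertex V E → ℝ≥0∞ := fun v => match v with
    | .task v => G.dist v t
    | .mid e i => G.restDist t e ((C e).drop i)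
  have hφ : ∀ e i, 0 < i → φ (chunkNode G C e i) = G.restDist t e ((C e).drop i) := by
    intro e i h0
    by_cases hi : i < (C e).length
    · rw [chunkNode_of_lt h0 hi]
    · rw [chunkNode_of_le h0 (not_lt.1 hi), List.drop_eq_nil_of_le (not_lt.1 hi),
        WGraph.restDist_nil]
  have low : ∀ v, φ v ≤ (chunked G C).dist v (.task t) := by
    refine WGraph.le_dist_of_potential φ WGraph.dist_self.le ?_
    rintro (⟨e, i, hi⟩ | ⟨e, i, f, h0, hi, hfe, hf⟩)
    · change φ (chunkNode G C e i) ≤ ((C e).get ⟨i, hi⟩ : ℝ≥0) + φ (chunkNode G C e (i + 1))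
      rw [hφ e (i + 1) (Nat.succ_pos i)]
      rcases Nat.eq_zero_or_pos i with rfl | h0
      · rw [chunkNode_zero]
        refine WGraph.dist_src_le_restDist ?_
        rw [← drop_eq_cons hi, List.drop_zero, (hC e).2]
      · rw [hφ e i h0, drop_eq_cons hi]
        exact WGraph.restDist_le_add _ _
    · change G.restDist t e ((C e).drop i) ≤ G.cost f + G.dist (G.tgt f) t
      rw [drop_eq_cons hi, WGraph.restDist_cons, ← hf]
      exact (min_le_right _ _).trans (WGraph.exitDist_le f)
  refine ⟨le_antisymm (up u) (low _), fun e i h0 => le_antisymm (up' e i h0) ?_⟩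
  rw [← hφ e i h0]
  exact low _

theorem perceived_chunk (hC : Splits G C) (e : E) (i : Fin (C e).length) :
    (chunked G C).perceived b (.task t) (.chunk e i) =
      b * ((C e).get i : ℝ≥0∞) + G.restDist t e ((C e).drop (i + 1)) := by
  rw [← (chunked_dist_task hC (G.src e)).2 e (i + 1) (Nat.succ_pos _)]
  rfl

theorem perceived_leave (hC : Splits G C) {i : ℕ} (h0 : 0 < i) (hi : i < (C e).length)
    (hfe : f ≠ e) (hf : G.src f = G.src e) :
    (chunked G C).perceived b (.task t) (.leave e i f h0 hi hfe hf) = G.perceived b t f := by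
  rw [WGraph.perceived, WGraph.perceived, ← (chunked_dist_task hC (G.tgt f)).1]
  rfl

theorem eq_chunk_of_src_task {u : V} {a : ChunkArc G C} (ha : (chunked G C).src a = .task u) :
    ∃ f, ∃ h : 0 < (C f).length, a = .chunk f ⟨0, h⟩ ∧ G.src f = u := by
  rcases a with ⟨f, i, hi⟩ | ⟨f, i, g, h0, hi, hfe, hf⟩
  · change chunkNode G C f i = _ at ha
    rcases Nat.eq_zero_or_pos i with rfl | h0
    · rw [chunkNode_zero] at ha
      exact ⟨f, hi, rfl, by injection ha⟩
    · rw [chunkNode_of_lt h0 hi] at ha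
      cases ha
  · cases ha

theorem eq_of_src_mid {i : ℕ} {a : ChunkArc G C} (ha : (chunked G C).src a = .mid e i) :
    0 < i ∧ ∃ hi : i < (C e).length, a = .chunk e ⟨i, hi⟩ ∨
      ∃ h0 f hfe hf, a = .leave e i f h0 hi hfe hf := by
  rcases a with ⟨f, j, hj⟩ | ⟨f, j, g, h0, hj, hfe, hf⟩
  · change chunkNode G C f j = _ at ha
    rcases Nat.eq_zero_or_pos j with rfl | h0
    · rw [chunkNode_zero] at ha
      cases ha
    · rw [chunkNode_of_lt h0 hj] at ha
      cases ha
      exact ⟨h0, hj, .inl rfl⟩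
  · cases ha
    exact ⟨h0, hj, .inr ⟨h0, g, hfe, hf, rfl⟩⟩

theorem perceived_first_chunk_le (hb : 1 ≤ b) (hC : Splits G C) (h : 0 < (C e).length) :
    (chunked G C).perceived b (.task t) (.chunk e ⟨0, h⟩) ≤ G.perceived b t e := by
  rw [perceived_chunk hC]
  refine WGraph.perceived_first_le hb ?_
  rw [← drop_eq_cons h, List.drop_zero, (hC e).2]

/-- The agent prefers a chunk that it takes to the other edges out of the same vertex. -/
theorem perceived_le_of_isBest_chunk (hb : 1 ≤ b) (hC : Splits G C) {i : Fin (C e).length}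
    (h : (chunked G C).IsBest b (.task t) (.chunk e i)) (hfe : f ≠ e) (hf : G.src f = G.src e) :
    (chunked G C).perceived b (.task t) (.chunk e i) ≤ G.perceived b t f := by
  obtain ⟨i, hi⟩ := i
  rcases Nat.eq_zero_or_pos i with rfl | h0
  · refine (h (.chunk f ⟨0, hC.length_pos f⟩) ?_).trans (perceived_first_chunk_le hb hC _)
    change chunkNode G C f 0 = chunkNode G C e 0
    rw [chunkNode_zero, chunkNode_zero, hf]
  · rw [← perceived_leave (b := b) (t := t) hC h0 hi hfe hf]
    refine h _ ?_
    change _ = chunkNode G C e i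
    rw [chunkNode_of_lt h0 hi]
    rfl

/-- At an intermediate vertex the other edges are perceived as in `G`, and the next chunk of `e`
looks at most as expensive as the whole `e`. So an edge that beats all of these also beats all edges
in `G`. -/
theorem isBest_of_isBest_leave (hb : 1 ≤ b) (hC : Splits G C) {i : ℕ} (h0 : 0 < i)
    (hi : i < (C e).length) (hfe : f ≠ e) (hf : G.src f = G.src e)
    (h : (chunked G C).IsBest b (.task t) (.leave e i f h0 hi hfe hf)) :
    G.IsBest b t f := by
  intro g hg
  rw [← perceived_leave (b := b) (t := t) hC h0 hi hfe hf]
  by_cases hge : g = e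
  · subst hge
    refine (h (.chunk g ⟨i, hi⟩) (chunkNode_of_lt h0 hi)).trans ?_
    rw [perceived_chunk hC]
    refine WGraph.perceived_first_le hb ?_
    rw [← drop_eq_cons hi, ← (hC g).2]
    conv_rhs => rw [← List.take_append_drop i (C g), List.sum_append]
    exact le_add_self
  · rw [← perceived_leave (b := b) (t := t) hC h0 hi hge (hg.trans hf)]
    exact h _ rfl

/-- If `e` is the only split edge out of its source, then the agent takes each chunk that it does
not perceive as worse than the other edges. -/
theorem chooses_chunk {R : Type*} [LinearOrder R] (rank : ChunkArc G C → R) (hC : Splits G C)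
    (he : 2 ≤ (C e).length) (hother : ∀ f ≠ e, G.src f = G.src e → (C f).length = 1)
    (hle : ∀ f ≠ e, G.src f = G.src e → G.maxPerceived b t e (C e) ≤ G.perceived b t f)
    (i : Fin (C e).length) :
    (chunked G C).Chooses b (.task t) (onChunkedPath G C) rank (.chunk e i) := by
  have best : (chunked G C).IsBest b (.task t) (.chunk e i) := by
    intro a ha
    have hle' : ∀ f ≠ e, G.src f = G.src e →
        (chunked G C).perceived b (.task t) (.chunk e i) ≤ G.perceived b t f := by
      intro f hfe hf
      rw [perceived_chunk hC]
      exact WGraph.maxPerceived_le_iff.1 (hle f hfe hf) i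
    obtain ⟨i, hi⟩ := i
    change _ = chunkNode G C e i at ha
    rcases Nat.eq_zero_or_pos i with rfl | h0
    · rw [chunkNode_zero] at ha
      obtain ⟨f, h, rfl, hf⟩ := eq_chunk_of_src_task ha
      by_cases hfe : f = e
      · subst hfe; exact le_rfl
      · refine (hle' f hfe hf).trans ?_
        rw [perceived_chunk hC]
        obtain ⟨x, hx⟩ := List.length_eq_one_iff.1 (hother f hfe hf)
        have hs := (hC f).2
        simp only [hx, List.sum_singleton] at hs
        subst hs
        simp [hx, WGraph.perceived]
    · rw [chunkNode_of_lt h0 hi] at ha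
      obtain ⟨-, -, rfl | ⟨-, f, hfe, hf, rfl⟩⟩ := eq_of_src_mid ha
      · exact le_rfl
      · rw [perceived_leave hC]
        exact hle' f hfe hf
  -- No other arc out of this vertex lies on a chunked path, so the tie rule selects this chunk
  -- irrespective of `rank`.
  have uniq : ∃! a', (chunked G C).src a' = (chunked G C).src (.chunk e i) ∧
      (chunked G C).IsBest b (.task t) a' ∧ onChunkedPath G C a' := by
    refine ⟨.chunk e i, ⟨rfl, best, he⟩, ?_⟩
    rintro a ⟨ha, -, hp⟩
    obtain ⟨i, hi⟩ := i
    change _ = chunkNode G C e i at ha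
    rcases Nat.eq_zero_or_pos i with rfl | h0
    · rw [chunkNode_zero] at ha
      obtain ⟨f, h, rfl, hf⟩ := eq_chunk_of_src_task ha
      by_cases hfe : f = e
      · subst hfe; rfl
      · have h1 := hother f hfe hf
        have h2 : 2 ≤ (C f).length := hp
        omega
    · rw [chunkNode_of_lt h0 hi] at ha
      obtain ⟨_, _, rfl | ⟨_, f, hfe, hf, rfl⟩⟩ := eq_of_src_mid ha
      · rfl
      · exact (hp : False).elim
  exact ⟨best, fun _ => he, fun h => (h uniq).elim⟩

end chunked

end Chunking

namespace Chunking

/-! ## Chunkings of task graphs -/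

namespace TaskGraph

variable {V E : Type*} {G : TaskGraph V E} {b : ℝ≥0} {k : ℕ} {C : E → List ℝ≥0} {e : E}

theorem IsChunking.splits (hC : G.IsChunking k C) : Splits G.toWGraph C :=
  fun e => ⟨(hC e).1, (hC e).2.2⟩

theorem IsChunking.eq_unsplit (hC : G.IsChunking 1 C) : C = fun e => [G.cost e] := by
  funext e
  obtain ⟨h1, h2, h3⟩ := hC e
  have h4 := List.length_pos_iff.2 h1
  obtain ⟨x, hx⟩ := List.length_eq_one_iff.1 (le_antisymm h2 h4)
  rw [hx] at h3 ⊢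
  simpa using h3

theorem isEdgeChunking_unsplit (hk : 1 ≤ k) (e : E) : G.IsEdgeChunking k e [G.cost e] :=
  ⟨by simp, by simpa using hk, by simp⟩

/-- The walks of a task graph do not visit a vertex twice. -/
theorem eq_of_mem_walk {u w : V} {q : List E} (hq : G.IsWalk u q w) {e f : E} (he : e ∈ q)
    (hf : f ∈ q) (h : G.src e = G.src f) : e = f := by
  have key : ∀ (q₁ q₂ : List E) (e f : E), G.IsWalk u (q₁ ++ e :: q₂) w → f ∈ q₂ →
      G.src e = G.src f → False := by
    intro q₁ q₂ e f hq hf h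
    obtain ⟨v, -, rfl, h2⟩ := WGraph.isWalk_append G.toWGraph |>.1 hq
    obtain ⟨a, c, rfl⟩ := List.append_of_mem hf
    obtain ⟨v, h3, rfl, -⟩ := WGraph.isWalk_append G.toWGraph |>.1 h2
    have := G.acyclic (G.src e) (e :: a) ⟨rfl, by rw [h]; exact h3⟩
    simp at this
  obtain ⟨q₁, q₂, rfl⟩ := List.append_of_mem he
  rcases List.mem_append.1 hf with hf' | hf'
  · obtain ⟨a, c, rfl⟩ := List.append_of_mem hf'
    refine (key a (c ++ e :: q₂) f e (by simpa using hq) (by simp) h.symm).elim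
  · rcases List.mem_cons.1 hf' with rfl | hf'
    · rfl
    · exact (key q₁ q₂ e f hq hf' h).elim

theorem src_ne_of_mem_walk {u w : V} {q : List E} (hq : G.IsWalk u q w) (he : e ∈ q) :
    G.src e ≠ w := by
  rintro rfl
  obtain ⟨q₁, q₂, rfl⟩ := List.append_of_mem he
  obtain ⟨v, -, h1, h2⟩ := WGraph.isWalk_append G.toWGraph |>.1 hq
  simpa using G.acyclic (G.src e) (e :: q₂) ⟨rfl, h2⟩

theorem nodup_of_walk {u w : V} {q : List E} (hq : G.IsWalk u q w) : q.Nodup := by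
  induction q generalizing u with
  | nil => simp
  | cons e q ih =>
    refine List.nodup_cons.2 ⟨fun he => ?_, ih hq.2⟩
    obtain ⟨q₁, q₂, rfl⟩ := List.append_of_mem he
    obtain ⟨v, h1, h2, -⟩ := WGraph.isWalk_append G.toWGraph |>.1 hq.2
    subst h2
    simpa using G.acyclic (G.src e) (e :: q₁) ⟨rfl, h1⟩

theorem src_ne_of_dist_ne_top (h : G.dist (G.tgt e) G.t ≠ ⊤) : G.src e ≠ G.t := by
  obtain ⟨p, hp⟩ := WGraph.dist_ne_top_iff.1 h
  exact src_ne_of_mem_walk (q := e :: p) ⟨rfl, hp⟩ List.mem_cons_self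

theorem dist_s_ne_top : G.dist G.s G.t ≠ ⊤ := WGraph.dist_ne_top_iff.2 G.reach

theorem walkCost_expand (hC : Splits G.toWGraph C) (q : List E) :
    (chunked G.toWGraph C).walkCost (G.expand C q) = G.walkCost q := by
  induction q with
  | nil => rfl
  | cons e q ih =>
    rw [expand, List.flatMap_cons, WGraph.walkCost_append, WGraph.walkCost_cons]
    refine congrArg₂ (· + ·) ?_ ih
    rw [WGraph.walkCost, List.map_map]
    have : (chunked G.toWGraph C).cost ∘ ChunkArc.chunk e = (C e).get := rfl
    rw [this, List.map_get_finRange, (hC e).2]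

/-! ### Splitting a single edge -/

section single

variable [DecidableEq E] {l : List ℝ≥0}

theorem single_self : G.single e l e = l := Function.update_self ..

theorem single_of_ne {f : E} (h : f ≠ e) : G.single e l f = [G.cost f] :=
  Function.update_of_ne h ..

theorem isChunking_single (hk : 1 ≤ k) (hl : G.IsEdgeChunking k e l) :
    G.IsChunking k (G.single e l) := by
  intro f
  by_cases h : f = e
  · subst h; rwa [single_self]
  · rw [single_of_ne h]; exact isEdgeChunking_unsplit hk f

/-- Distances after the chunks of `e` are known by `chunked_dist_task`, which turns the supremum
over the chunked graph into a recursion on the list. -/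
theorem bottleneck_eq (hl : l ≠ []) (hs : l.sum = G.cost e) :
    G.bottleneck b e l = G.maxPerceived b G.t e l := by
  have hC := (isChunking_single (G := G) (k := max 1 l.length) (le_max_left _ _)
    ⟨hl, le_max_right _ _, hs⟩).splits
  have : G.bottleneck b e l = G.maxPerceived b G.t e (G.single e l e) := by
    refine eq_of_forall_ge_iff fun B => ?_
    simp only [bottleneck, iSup_le_iff, perceived_chunk hC, WGraph.maxPerceived_le_iff]
  rw [this, single_self]

theorem IsOptimalEdgeChunking.isEdgeChunking (hk : 1 ≤ k)
    (h : G.IsOptimalEdgeChunking b k e l) : G.IsEdgeChunking k e l :=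
  have := h.1.1
  ⟨List.ne_nil_of_length_pos (by omega), by omega, h.1.2⟩

/-- Optimality is defined among chunkings into exactly `k` chunks; padding with zeros extends it to
shorter ones. -/
theorem IsOptimalEdgeChunking.maxPerceived_le (h : G.IsOptimalEdgeChunking b k e l)
    {l' : List ℝ≥0} (hl' : G.IsEdgeChunking k e l') :
    G.maxPerceived b G.t e l ≤ G.maxPerceived b G.t e l' := by
  obtain ⟨h1, h2, h3⟩ := hl'
  have hpos := List.length_pos_iff.2 h1
  have hlen := h.1.1
  have hpad := h.2 (l' ++ List.replicate (k - l'.length) 0) (by simp; omega) (by simp [h3])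
  rw [bottleneck_eq (List.ne_nil_of_length_pos (by omega)) h.1.2,
    bottleneck_eq (by simp [h1]) (by simp [h3])] at hpad
  exact hpad.trans (WGraph.maxPerceived_append_replicate h1 _)

end single

/-! ### Runs along edges whose chunks are all taken -/

variable [LinearOrder V]

theorem isRun_chunks {r : List (ChunkArc G.toWGraph C)} (hne : G.src e ≠ G.t)
    (hpos : 0 < (C e).length) (hch : ∀ i, G.AgentChooses b C (.chunk e i))
    (hr : (chunked G.toWGraph C).IsRun b (.task G.t) (onChunkedPath G.toWGraph C)
      (heading G.toWGraph C) (.task (G.tgt e)) r) :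
    (chunked G.toWGraph C).IsRun b (.task G.t) (onChunkedPath G.toWGraph C)
      (heading G.toWGraph C) (.task (G.src e))
      ((List.finRange (C e).length).map (ChunkArc.chunk e) ++ r) := by
  -- Downward induction on the number of completed chunks, starting from the given run at the
  -- target.
  have key : ∀ i, i ≤ (C e).length → (chunked G.toWGraph C).IsRun b (.task G.t)
      (onChunkedPath G.toWGraph C) (heading G.toWGraph C) (chunkNode G.toWGraph C e i)
      (((List.finRange (C e).length).drop i).map (ChunkArc.chunk e) ++ r) := by
    intro i hi
    induction hi using Nat.decreasingInduction with
    | self =>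
      rw [chunkNode_of_le hpos le_rfl, List.drop_eq_nil_of_le (by simp)]
      exact hr
    | of_succ i hi ih =>
      rw [List.drop_eq_getElem_cons (by simpa using hi), List.getElem_finRange]
      refine ⟨?_, rfl, hch _, ih⟩
      rcases Nat.eq_zero_or_pos i with rfl | h0
      · rw [chunkNode_zero]
        intro h
        exact hne (by injection h)
      · rw [chunkNode_of_lt h0 hi]
        simp
  have := key 0 (Nat.zero_le _)
  rwa [chunkNode_zero, List.drop_zero] at this

theorem isRun_expand {u : V} {q : List E} (hC : Splits G.toWGraph C) (hq : G.IsWalk u q G.t)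
    (hch : ∀ e ∈ q, ∀ i, G.AgentChooses b C (.chunk e i)) :
    (chunked G.toWGraph C).IsRun b (.task G.t) (onChunkedPath G.toWGraph C)
      (heading G.toWGraph C) (.task u) (G.expand C q) := by
  induction q generalizing u with
  | nil =>
    obtain rfl : u = G.t := hq
    rfl
  | cons e q ih =>
    have hne := src_ne_of_mem_walk hq List.mem_cons_self
    obtain ⟨rfl, h1⟩ := hq
    exact isRun_chunks hne (hC.length_pos e) (hch e List.mem_cons_self)
      (ih h1 fun f hf => hch f (List.mem_cons_of_mem _ hf))

/-- Although `C` may split `f` as well, this only lowers what the agent perceives for starting `f`;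
so the bound by the unsplit `f` holds in any chunking. -/
theorem maxPerceived_le_of_chooses (hb : 1 ≤ b) (hC : G.IsChunking k C)
    (h : ∀ i, G.AgentChooses b C (.chunk e i)) {f : E} (hf : f ≠ e) (hs : G.src f = G.src e) :
    G.maxPerceived b G.t e (C e) ≤ G.perceived b G.t f := by
  rw [WGraph.maxPerceived_le_iff]
  intro i
  rw [← perceived_chunk hC.splits]
  exact perceived_le_of_isBest_chunk hb hC.splits (h i).1 hf hs

/-! ### Persuadable edges -/

variable [DecidableEq E] {l : List ℝ≥0}

/-- The condition for persuading the agent with at least two chunks. -/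
theorem persuadable_of_maxPerceived_le (hk : 2 ≤ k) (hl : G.IsEdgeChunking k e l)
    (h : ∀ f ≠ e, G.src f = G.src e → G.maxPerceived b G.t e l ≤ G.perceived b G.t f) :
    G.Persuadable b k e := by
  -- A single chunk is followed by one of cost zero, so that the edge counts as a chunked path when
  -- ties are broken.
  obtain ⟨l', hl', h2, hle⟩ : ∃ l', G.IsEdgeChunking k e l' ∧ 2 ≤ l'.length ∧
      G.maxPerceived b G.t e l' ≤ G.maxPerceived b G.t e l := by
    by_cases h2 : 2 ≤ l.length
    · exact ⟨l, hl, h2, le_rfl⟩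
    · have hpos := List.length_pos_iff.2 hl.1
      exact ⟨l ++ [0], ⟨by simp, by simp; omega, by simpa using hl.2.2⟩, by simp; omega,
        WGraph.maxPerceived_append_zero hl.1⟩
  refine ⟨l', hl', fun i => ?_⟩
  refine chooses_chunk _ (isChunking_single (by omega) hl').splits (by rwa [single_self])
    (fun f hf _ => by rw [single_of_ne hf]; rfl) (fun f hf hs => ?_) i
  rw [single_self]
  exact hle.trans (h f hf hs)

/-- An edge which the agent completes in some chunking of the whole graph is persuadable. -/
theorem persuadable_of_chooses (hb : 1 ≤ b) (hk : 1 ≤ k) (hC : G.IsChunking k C)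
    (h : ∀ i, G.AgentChooses b C (.chunk e i)) : G.Persuadable b k e := by
  rcases hk.lt_or_eq with hk2 | rfl
  · exact persuadable_of_maxPerceived_le hk2 (hC e)
      fun f hf hs => maxPerceived_le_of_chooses hb hC h hf hs
  · have hl : G.IsEdgeChunking 1 e [G.cost e] := isEdgeChunking_unsplit le_rfl e
    have : C = G.single e [G.cost e] := by
      rw [hC.eq_unsplit, (isChunking_single le_rfl hl).eq_unsplit]
    subst this
    exact ⟨_, hl, h⟩

/-- The case `f = e` is included, because not splitting `e` is itself a competing chunking. Hence a
comparison with the best edge out of the source suffices, even if that edge is `e`. -/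
theorem Persuadable.maxPerceived_le (hb : 1 ≤ b) (hk : 1 ≤ k) (h : G.Persuadable b k e)
    (hl : G.IsOptimalEdgeChunking b k e l) {f : E} (hs : G.src f = G.src e) :
    G.maxPerceived b G.t e l ≤ G.perceived b G.t f := by
  by_cases hf : f = e
  · subst hf
    refine (hl.maxPerceived_le (isEdgeChunking_unsplit hk f)).trans_eq ?_
    exact WGraph.maxPerceived_singleton
  · obtain ⟨l', hl', h⟩ := h
    refine (hl.maxPerceived_le hl').trans ?_
    have := maxPerceived_le_of_chooses hb (isChunking_single hk hl') h hf hs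
    rwa [single_self] at this

theorem persuadable_iff_of_two_le (hb : 1 ≤ b) (hk : 2 ≤ k)
    (hl : G.IsOptimalEdgeChunking b k e l) : G.Persuadable b k e ↔
      ∀ f, G.src f = G.src e → G.maxPerceived b G.t e l ≤ G.perceived b G.t f :=
  ⟨fun h _ hs => h.maxPerceived_le hb (by omega) hl hs,
    fun h => persuadable_of_maxPerceived_le hk (hl.isEdgeChunking (by omega)) fun f _ hs => h f hs⟩

/-- The edge `e` is the first among the best edges out of its source. -/
def IsFirstBest (G : TaskGraph V E) (b : ℝ≥0) (e : E) : Prop :=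
  ∀ f, G.src f = G.src e → G.perceived b G.t e < G.perceived b G.t f ∨
    G.perceived b G.t e = G.perceived b G.t f ∧ G.tgt e ≤ G.tgt f

/-- With `k = 1` nothing is split and no arc is preferred, so ties are decided by the order of the
targets. -/
theorem persuadable_one_iff : G.Persuadable b 1 e ↔ G.IsFirstBest b e := by
  have hC : G.IsChunking 1 fun e => [G.cost e] := fun e => isEdgeChunking_unsplit le_rfl e
  have h1 : G.Persuadable b 1 e ↔ G.AgentChooses b (fun e => [G.cost e]) (.chunk e 0) := by
    constructor
    · rintro ⟨l, hl, h⟩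
      have h2 := (isChunking_single le_rfl hl).eq_unsplit
      rw [h2] at h
      exact h 0
    · intro h
      refine ⟨[G.cost e], isEdgeChunking_unsplit le_rfl e, ?_⟩
      rw [(isChunking_single le_rfl (isEdgeChunking_unsplit le_rfl e)).eq_unsplit]
      intro i
      rw [Subsingleton.elim (α := Fin 1) i 0]
      exact h
  rw [h1]
  have hp : ∀ f : E, (chunked G.toWGraph fun e => [G.cost e]).perceived b (.task G.t)
      (.chunk f (0 : Fin 1)) = G.perceived b G.t f := by
    intro f
    rw [perceived_chunk hC.splits]
    simp [WGraph.perceived]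
  have hsrc : ∀ f : E, (chunked G.toWGraph fun e => [G.cost e]).src (.chunk f (0 : Fin 1)) =
      .task (G.src f) := fun f => rfl
  have hbest : ∀ e : E, (chunked G.toWGraph fun e => [G.cost e]).IsBest b (.task G.t)
      (.chunk e (0 : Fin 1)) ↔ G.IsBest b G.t e := by
    intro e
    constructor
    · intro h f hf
      rw [← hp, ← hp f]
      refine h _ ?_
      rw [hsrc, hsrc, hf]
    · intro h a ha
      rw [hsrc] at ha
      obtain ⟨f, h0, rfl, hf⟩ := eq_chunk_of_src_task ha
      have := h f hf
      rwa [← hp, ← hp f] at this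
  have hno : ¬ ∃! a', (chunked G.toWGraph fun e => [G.cost e]).src a' =
      (chunked G.toWGraph fun e => [G.cost e]).src (.chunk e (0 : Fin 1)) ∧
      (chunked G.toWGraph fun e => [G.cost e]).IsBest b (.task G.t) a' ∧
        onChunkedPath G.toWGraph (fun e => [G.cost e]) a' := by
    rintro ⟨a | a, ⟨-, -, h⟩, -⟩
    · have h : 2 ≤ 1 := h
      omega
    · exact h
  constructor
  · rintro ⟨h2, -, h3⟩ f hf
    rw [hbest] at h2
    rcases (h2 f hf).lt_or_eq with h4 | h4
    · exact .inl h4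
    · refine .inr ⟨h4, h3 hno (.chunk f (0 : Fin 1)) (by rw [hsrc, hsrc, hf]) ?_⟩
      rw [hbest]
      intro g hg
      rw [← h4]
      exact h2 g (hg.trans hf)
  · intro h
    refine ⟨(hbest e).2 fun f hf => ?_, fun h => (hno h).elim, fun _ a ha ha' => ?_⟩
    · rcases h f hf with h | h
      exacts [h.le, h.1.le]
    · rw [hsrc] at ha
      obtain ⟨f, h0, rfl, hf⟩ := eq_chunk_of_src_task ha
      rcases h f hf with h | h
      · exact absurd h (not_lt.2 ((hbest f).1 ha' e hf.symm))
      · exact h.2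

/-- Guarantees a persuadable edge at each vertex with an outgoing edge, without any knowledge of
optimal chunkings. -/
theorem persuadable_of_isFirstBest (hk : 1 ≤ k) (h : G.IsFirstBest b e) :
    G.Persuadable b k e := by
  rcases hk.lt_or_eq with hk2 | rfl
  · refine persuadable_of_maxPerceived_le hk2 (isEdgeChunking_unsplit hk e) fun f _ hs => ?_
    rw [WGraph.maxPerceived_singleton]
    rcases h f hs with h | h
    exacts [h.le, h.1.le]
  · exact persuadable_one_iff.2 h

/-- An intermediate vertex exists only if `k ≥ 2`; then an edge that is best in `G` is persuadable,
whatever its place in the order. -/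
theorem isFirstBest_of_isBest_leave (hb : 1 ≤ b) (hk : 1 ≤ k) (hC : G.IsChunking k C) {i : ℕ}
    {f : E} (h0 : 0 < i) (hi : i < (C e).length) (hfe : f ≠ e) (hf : G.src f = G.src e)
    (h : (chunked G.toWGraph C).IsBest b (.task G.t) (.leave e i f h0 hi hfe hf)) :
    G.Persuadable b k f := by
  have h2 : 2 ≤ k := by have := (hC e).2.1; omega
  refine persuadable_of_maxPerceived_le h2 (isEdgeChunking_unsplit hk f) fun g _ hs => ?_
  rw [WGraph.maxPerceived_singleton]
  exact isBest_of_isBest_leave hb hC.splits h0 hi hfe hf h g hs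

/-- Whatever the chunking, the agent pays at least the cost of some walk of persuadable edges. -/
theorem exists_walk_le_of_isRun (hb : 1 ≤ b) (hk : 1 ≤ k) (hC : G.IsChunking k C)
    (p : List (ChunkArc G.toWGraph C)) :
    (∀ u, (chunked G.toWGraph C).IsRun b (.task G.t) (onChunkedPath G.toWGraph C)
        (heading G.toWGraph C) (.task u) p →
      ∃ q, G.IsWalk u q G.t ∧ (∀ e ∈ q, G.Persuadable b k e) ∧
        G.walkCost q ≤ (chunked G.toWGraph C).walkCost p) ∧
    (∀ e i, 0 < i → i ≤ (C e).length →
      (∀ j : Fin (C e).length, (j : ℕ) < i → G.AgentChooses b C (.chunk e j)) →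
      (chunked G.toWGraph C).IsRun b (.task G.t) (onChunkedPath G.toWGraph C)
        (heading G.toWGraph C) (chunkNode G.toWGraph C e i) p →
      ∃ q, G.IsWalk (G.src e) q G.t ∧ (∀ e ∈ q, G.Persuadable b k e) ∧
        G.walkCost q ≤ ((C e).take i).sum + (chunked G.toWGraph C).walkCost p) := by
  -- Both claims go by simultaneous induction: a run from a task vertex starts some edge, and a run
  -- from inside an edge returns to a task vertex. The chunks already paid appear as the sum over
  -- `take i`.
  induction p with
  | nil =>
    have h1 : ∀ u, (chunked G.toWGraph C).IsRun b (.task G.t) (onChunkedPath G.toWGraph C)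
        (heading G.toWGraph C) (.task u) [] →
      ∃ q, G.IsWalk u q G.t ∧ (∀ e ∈ q, G.Persuadable b k e) ∧
        G.walkCost q ≤ (chunked G.toWGraph C).walkCost [] := by
      intro u h
      have : u = G.t := by injection (h : ChunkVertex.task u = .task G.t)
      exact ⟨[], this, by simp, by simp⟩
    refine ⟨h1, fun e i h0 hi hj h => ?_⟩
    rcases hi.lt_or_eq with hi' | rfl
    · rw [chunkNode_of_lt h0 hi'] at h
      cases (h : ChunkVertex.mid e i = .task G.t)
    · rw [chunkNode_of_le h0 le_rfl] at h
      obtain ⟨q, h2, h3, h4⟩ := h1 _ h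
      refine ⟨e :: q, ⟨rfl, h2⟩, ?_, ?_⟩
      · rintro f (_ | ⟨_, hf⟩)
        exacts [persuadable_of_chooses hb hk hC fun j => hj j j.2, h3 f hf]
      · rw [WGraph.walkCost_cons, List.take_length, (hC e).2.2]
        exact add_le_add_right h4 _
  | cons a p ih =>
    obtain ⟨ih1, ih2⟩ := ih
    have h1 : ∀ u, (chunked G.toWGraph C).IsRun b (.task G.t) (onChunkedPath G.toWGraph C)
        (heading G.toWGraph C) (.task u) (a :: p) →
      ∃ q, G.IsWalk u q G.t ∧ (∀ e ∈ q, G.Persuadable b k e) ∧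
        G.walkCost q ≤ (chunked G.toWGraph C).walkCost (a :: p) := by
      rintro u ⟨-, ha, hch, h⟩
      obtain ⟨f, h0, rfl, rfl⟩ := eq_chunk_of_src_task ha
      obtain ⟨q, h2, h3, h4⟩ := ih2 f 1 one_pos h0
        (fun j hj => by rwa [show j = ⟨0, h0⟩ from Fin.ext (by simpa using hj)]) h
      refine ⟨q, h2, h3, h4.trans_eq ?_⟩
      rw [WGraph.walkCost_cons, ← List.take_concat_get' (C f) 0 h0]
      simp [chunked]
    refine ⟨h1, fun e i h0 hi hj h => ?_⟩
    rcases hi.lt_or_eq with hi' | rfl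
    · rw [chunkNode_of_lt h0 hi'] at h
      obtain ⟨-, ha, hch, h⟩ := h
      obtain ⟨_, _, rfl | ⟨_, f, hfe, hf, rfl⟩⟩ := eq_of_src_mid ha
      · obtain ⟨q, h2, h3, h4⟩ := ih2 e (i + 1) (Nat.succ_pos _) hi' (fun j hj' => by
          rcases Nat.lt_succ_iff_lt_or_eq.1 hj' with hj' | hj'
          · exact hj j hj'
          · rwa [show j = ⟨i, hi'⟩ from Fin.ext hj']) h
        refine ⟨q, h2, h3, h4.trans_eq ?_⟩
        rw [WGraph.walkCost_cons, ← List.take_concat_get' (C e) i hi', List.sum_append, add_assoc]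
        simp [chunked]
      -- The agent abandons `e`. The walk then starts with `f`, and the chunks paid for `e` are
      -- dropped from the bound.
      · obtain ⟨q, h2, h3, h4⟩ := ih1 _ h
        refine ⟨f :: q, ⟨hf, h2⟩, ?_, ?_⟩
        · rintro g (_ | ⟨_, hg⟩)
          exacts [isFirstBest_of_isBest_leave hb hk hC _ _ hfe hf hch.1, h3 g hg]
        · rw [WGraph.walkCost_cons, WGraph.walkCost_cons]
          exact (add_le_add_right h4 _).trans le_add_self
    · rw [chunkNode_of_le h0 le_rfl] at h
      obtain ⟨q, h2, h3, h4⟩ := h1 _ h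
      refine ⟨e :: q, ⟨rfl, h2⟩, ?_, ?_⟩
      · rintro f (_ | ⟨_, hf⟩)
        exacts [persuadable_of_chooses hb hk hC fun j => hj j j.2, h3 f hf]
      · rw [WGraph.walkCost_cons, List.take_length, (hC e).2.2]
        exact add_le_add_right h4 _

/-- Splitting the edges of a cheapest path of persuadable edges optimally makes the agent follow
this path, and no chunking is better. -/
theorem isOptimalChunking_of_path (hb : 1 ≤ b) (hk : 1 ≤ k) {q : List E}
    (hq : G.IsCheapestPersuadable b k q) (hopt : ∀ e ∈ q, G.IsOptimalEdgeChunking b k e (C e))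
    (hno : ∀ e, e ∉ q → C e = [G.cost e]) :
    G.IsOptimalChunking b k C ∧ G.AgentRun b C (G.expand C q) := by
  have hC : G.IsChunking k C := by
    intro e
    by_cases he : e ∈ q
    · exact (hopt e he).isEdgeChunking hk
    · rw [hno e he]; exact isEdgeChunking_unsplit hk e
  have hch : ∀ e ∈ q, ∀ i, G.AgentChooses b C (.chunk e i) := by
    intro e he
    have hper := hq.1.2 e he
    rcases hk.lt_or_eq with hk2 | rfl
    · refine chooses_chunk _ hC.splits ((hopt e he).1.1.symm ▸ hk2) (fun f hf hs => ?_)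
        (fun f hf hs => hper.maxPerceived_le hb hk (hopt e he) hs)
      -- A competing edge is not split, since the path leaves each vertex at most once.
      rw [hno f fun hfq => hf (eq_of_mem_walk hq.1.1 hfq he hs)]
      rfl
    · obtain ⟨l, hl, h⟩ := hper
      -- For `k = 1` both chunkings leave every edge unsplit.
      have : C = G.single e l := by
        rw [hC.eq_unsplit, (isChunking_single le_rfl hl).eq_unsplit]
      subst this
      exact h
  have hrun : G.AgentRun b C (G.expand C q) := isRun_expand hC.splits hq.1.1 hch
  refine ⟨⟨hC, _, hrun, fun C' hC' p' hp' => ?_⟩, hrun⟩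
  obtain ⟨q', h1, h2, h3⟩ := (exists_walk_le_of_isRun hb hk hC' p').1 _ hp'
  rw [walkCost_expand hC.splits]
  exact (hq.2 q' h1 h2).trans h3

end TaskGraph

/-! ## Acyclicity -/

namespace TaskGraph

variable {V E : Type*} (G : TaskGraph V E)

/-- A chain in the transitive closure is a nonempty walk, so acyclicity makes the closure
irreflexive, and finiteness makes it well-founded. -/
theorem wellFounded_succ [Finite V] :
    WellFounded fun v u => ∃ e, G.src e = u ∧ G.tgt e = v := by
  have key : ∀ u v, Relation.TransGen (fun v u => ∃ e, G.src e = u ∧ G.tgt e = v) v u →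
      ∃ p, p ≠ [] ∧ G.IsWalk u p v := by
    intro u v h
    induction h with
    | single h =>
      obtain ⟨e, rfl, rfl⟩ := h
      exact ⟨[e], by simp, rfl, rfl⟩
    | tail _ h ih =>
      obtain ⟨e, rfl, rfl⟩ := h
      obtain ⟨p, -, hp⟩ := ih
      exact ⟨e :: p, by simp, rfl, hp⟩
  have : Std.Irrefl (Relation.TransGen fun v u => ∃ e, G.src e = u ∧ G.tgt e = v) := by
    refine ⟨fun u h => ?_⟩
    obtain ⟨p, hp, hw⟩ := key u u h
    exact hp (G.acyclic u p hw)
  exact (Subrelation.wf (fun h => Relation.TransGen.single h)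
    (Finite.wellFounded_of_trans_of_irrefl
      (Relation.TransGen fun v u => ∃ e, G.src e = u ∧ G.tgt e = v)))

variable {G} [LinearOrder V]

/-- Minimize perceived cost and target lexicographically. -/
theorem exists_isFirstBest [Finite E] (b : ℝ≥0) (e : E) :
    ∃ f, G.src f = G.src e ∧ G.IsFirstBest b f := by
  obtain ⟨f, hf, hmin⟩ := Set.exists_min_image {f | G.src f = G.src e}
    (fun f => toLex (G.perceived b G.t f, G.tgt f)) (Set.toFinite _) ⟨e, rfl⟩
  refine ⟨f, hf, fun g hg => ?_⟩
  simpa [Prod.Lex.toLex_le_toLex] using hmin g (hg.trans hf)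

/-- Follow first best edges; acyclicity makes this end, and it can end only at `t`. -/
theorem exists_persuadable_walk [Finite V] [Finite E] [DecidableEq E] {b : ℝ≥0} {k : ℕ}
    (hk : 1 ≤ k) (u : V) (hu : G.dist u G.t ≠ ⊤) :
    ∃ p, G.IsWalk u p G.t ∧ ∀ e ∈ p, G.Persuadable b k e := by
  induction u using G.wellFounded_succ.induction with
  | _ u ih =>
    by_cases hut : u = G.t
    · exact ⟨[], hut, by simp⟩
    obtain ⟨p, hp⟩ := WGraph.dist_ne_top_iff.1 hu
    cases p with
    | nil => exact (hut hp).elim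
    | cons e p =>
      obtain ⟨rfl, hp⟩ := hp
      obtain ⟨f, hf, hbest⟩ := exists_isFirstBest (G := G) b e
      -- An edge that starts a walk to `t` has finite perceived cost, hence so does the best edge.
      have hfin : G.dist (G.tgt f) G.t ≠ ⊤ := by
        have h1 : G.perceived b G.t f ≤ G.perceived b G.t e := by
          rcases hbest e hf.symm with h | h
          exacts [h.le, h.1.le]
        have h2 : G.perceived b G.t e ≠ ⊤ := by
          rw [WGraph.perceived]
          exact ENNReal.add_ne_top.2 ⟨ENNReal.mul_ne_top ENNReal.coe_ne_top ENNReal.coe_ne_top,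
            WGraph.dist_ne_top_iff.2 ⟨p, hp⟩⟩
        exact (ENNReal.add_ne_top.1 (ne_top_of_le_ne_top h2 h1)).2
      obtain ⟨r, h1, h2⟩ := ih (G.tgt f) ⟨f, hf, rfl⟩ hfin
      refine ⟨f :: r, ⟨hf, h1⟩, ?_⟩
      rintro g (_ | ⟨_, hg⟩)
      exacts [persuadable_of_isFirstBest hk hbest, h2 g hg]

end TaskGraph

end Chunking

namespace Chunking

/-! ## Optimal chunkings of a single edge -/

section EdgeMath

/-- The real counterpart of `WGraph.restDist`. -/
noncomputable def restReal (Du Dv : ℝ) (l : List ℝ≥0) : ℝ :=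
  if l = [] then Dv else min ((l.sum : ℝ) + Dv) Du

/-- No chunk in `l` has a perceived cost above `β`. -/
def Feasible (b Du Dv β : ℝ) : List ℝ≥0 → Prop
  | [] => True
  | x :: l => b * x + restReal Du Dv l ≤ β ∧ Feasible b Du Dv β l

/-- The highest cost of an edge that can be split into `m` chunks with perceived costs at most
`β`. -/
noncomputable def capacity (b Du Dv β : ℝ) : ℕ → ℝ
  | 0 => 0
  | m + 1 => capacity b Du Dv β m +
      (β - if m = 0 then Dv else min (capacity b Du Dv β m + Dv) Du) / b

/-- The bottleneck with which `k` chunks reach exactly the cost `c` if the perceived costs of the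
last `j` chunks refer to the end of the edge, and those of the other chunks to leaving it. -/
noncomputable def candidate (b c Du Dv : ℝ) (k j : ℕ) : ℝ :=
  (c + Dv * (1 - (1 - 1 / b) ^ j) + ((k : ℝ) - j) / b * Du) /
    (1 - (1 - 1 / b) ^ j + ((k : ℝ) - j) / b)

variable {b c Du Dv β : ℝ}

/-- Enlarging the later chunks is never a disadvantage: `R ↦ R + (β - min (R + Dv) Du) / b` is
increasing, since the minimum grows at most as fast as `R` and `b > 1`. -/
theorem Feasible.sum_le (hb : 1 < b) {l : List ℝ≥0} (h : Feasible b Du Dv β l) :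
    (l.sum : ℝ) ≤ capacity b Du Dv β l.length := by
  have hb0 : 0 < b := by linarith
  induction l with
  | nil => simp [capacity]
  | cons x l ih =>
    obtain ⟨h1, h2⟩ := h
    have ih := ih h2
    have h3 : (x : ℝ) ≤ (β - restReal Du Dv l) / b := by
      rw [le_div_iff₀ hb0]; linarith
    rw [List.length_cons, capacity, List.sum_cons, NNReal.coe_add]
    cases l with
    | nil => simpa [restReal, capacity] using h3
    | cons y l =>
      set R := (((y :: l).sum : ℝ≥0) : ℝ)
      set F := capacity b Du Dv β (y :: l).length
      have h4 : restReal Du Dv (y :: l) = min (R + Dv) Du := by simp [restReal, R]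
      rw [h4] at h3
      rw [if_neg (by simp)]
      have h5 : min (F + Dv) Du ≤ min (R + Dv) Du + (F - R) := by
        rw [← min_add_add_right]
        exact min_le_min (by linarith) (by linarith)
      have h6 : (min (F + Dv) Du - min (R + Dv) Du) / b ≤ F - R := by
        rw [div_le_iff₀ hb0]
        nlinarith
      have h7 : (β - min (R + Dv) Du) / b =
          (β - min (F + Dv) Du) / b + (min (F + Dv) Du - min (R + Dv) Du) / b := by ring
      linarith

/-- While finishing the edge is the cheaper way on, the recursion contracts towards `β - Dv` with
factor `1 - 1 / b`. Once leaving is no more expensive, each further chunk adds the nonnegative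
amount `(β - Du) / b`, so the recursion stays in this regime. Here `j` counts the chunks before the
switch. -/
theorem exists_capacity_eq (hDu : Du ≤ β) (hb : 1 < b) (m : ℕ) :
    ∃ j, 1 ≤ j ∧ j ≤ m + 1 ∧ (j < m + 1 → Du ≤ capacity b Du Dv β (m + 1) + Dv) ∧
      capacity b Du Dv β (m + 1) =
        (β - Dv) * (1 - (1 - 1 / b) ^ j) + ((m + 1 : ℝ) - j) / b * (β - Du) := by
  have hb0 : 0 < b := by linarith
  induction m with
  | zero => exact ⟨1, le_rfl, le_rfl, by simp, by simp [capacity]; ring⟩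
  | succ m ih =>
    obtain ⟨j, h1, h2, h3, h4⟩ := ih
    rw [capacity, if_neg (Nat.succ_ne_zero m)]
    by_cases h : Du ≤ capacity b Du Dv β (m + 1) + Dv
    · rw [min_eq_right h]
      have : 0 ≤ (β - Du) / b := div_nonneg (by linarith) hb0.le
      exact ⟨j, h1, by omega, fun _ => by linarith, by rw [h4]; push_cast; ring⟩
    · have hj : j = m + 1 := by
        by_contra hne
        exact h (h3 (by omega))
      subst hj
      rw [min_eq_left (not_le.1 h).le]
      refine ⟨m + 1 + 1, by omega, le_rfl, by simp, ?_⟩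
      rw [h4, pow_succ]
      push_cast
      ring

/-- Replacing the minimum by either of its branches can only decrease the recursion, and the factor
`1 - 1 / b` is nonnegative. So every choice of a switching point gives a lower bound. -/
theorem le_capacity (hb : 1 < b) (j i : ℕ) :
    (β - Dv) * (1 - (1 - 1 / b) ^ (j + 1)) + (i : ℝ) / b * (β - Du) ≤
      capacity b Du Dv β (j + 1 + i) := by
  have hb0 : 0 < b := by linarith
  induction i with
  | zero =>
    simp only [CharP.cast_eq_zero, zero_div, zero_mul, add_zero]
    induction j with
    | zero => simp [capacity]; apply le_of_eq; ring
    | succ j ih =>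
      rw [capacity, if_neg (Nat.succ_ne_zero j)]
      set F := capacity b Du Dv β (j + 1)
      have h1 : (β - (F + Dv)) / b ≤ (β - min (F + Dv) Du) / b := by
        gcongr; exact min_le_left _ _
      have hq : 0 ≤ 1 - 1 / b := by rw [sub_nonneg, div_le_one hb0]; exact hb.le
      have h2 := mul_le_mul_of_nonneg_left ih hq
      have h3 : F + (β - (F + Dv)) / b = (1 - 1 / b) * F + (β - Dv) / b := by ring
      have h4 : (β - Dv) * (1 - (1 - 1 / b) ^ (j + 1 + 1)) = (1 - 1 / b) *
          ((β - Dv) * (1 - (1 - 1 / b) ^ (j + 1))) + (β - Dv) / b := by rw [pow_succ]; ring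
      linarith
  | succ i ih =>
    rw [← add_assoc, capacity, if_neg (by omega)]
    have h1 : (β - Du) / b ≤ (β - min (capacity b Du Dv β (j + 1 + i) + Dv) Du) / b := by
      gcongr; exact min_le_right _ _
    have h2 : ((i + 1 : ℕ) : ℝ) / b * (β - Du) = (i : ℝ) / b * (β - Du) + (β - Du) / b := by
      push_cast; ring
    linarith

theorem candidate_denom_pos (hb : 1 < b) {k j : ℕ} (hj : 1 ≤ j) (hjk : j ≤ k) :
    0 < 1 - (1 - 1 / b) ^ j + ((k : ℝ) - j) / b := by
  have hb0 : 0 < b := by linarith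
  have hq : 0 ≤ 1 - 1 / b := by rw [sub_nonneg, div_le_one hb0]; exact hb.le
  have hq1 : 1 - 1 / b < 1 := by have := one_div_pos.2 hb0; linarith
  have h1 : (1 - 1 / b) ^ j < 1 := pow_lt_one₀ hq hq1 (by omega)
  have h2 : 0 ≤ ((k : ℝ) - j) / b :=
    div_nonneg (sub_nonneg.2 (by exact_mod_cast hjk)) hb0.le
  linarith

/-- The right-hand side is affine in `β` with positive slope, namely the denominator of the
candidate. -/
theorem candidate_le_iff (hb : 1 < b) {k j : ℕ} (hj : 1 ≤ j) (hjk : j ≤ k) :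
    candidate b c Du Dv k j ≤ β ↔
      c ≤ (β - Dv) * (1 - (1 - 1 / b) ^ j) + ((k : ℝ) - j) / b * (β - Du) := by
  rw [candidate, div_le_iff₀ (candidate_denom_pos hb hj hjk)]
  constructor <;> intro h <;> linarith

/-- `best` is the least of the first `m` candidates and of the perceived cost of the whole edge. -/
def IsLeastCandidate (b c Du Dv : ℝ) (k m : ℕ) (best : ℝ) : Prop :=
  (∀ j, 1 ≤ j → j ≤ m → best ≤ candidate b c Du Dv k j) ∧
  (best = b * c + Dv ∨ ∃ j, 1 ≤ j ∧ j ≤ m ∧ best = candidate b c Du Dv k j)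

theorem IsLeastCandidate.succ {k m : ℕ} {best : ℝ} (h : IsLeastCandidate b c Du Dv k m best) :
    IsLeastCandidate b c Du Dv k (m + 1) (min (candidate b c Du Dv k (m + 1)) best) := by
  obtain ⟨h1, h2⟩ := h
  refine ⟨fun j hj hjm => ?_, ?_⟩
  · rcases hjm.lt_or_eq with hjm | rfl
    · exact (min_le_right _ _).trans (h1 j hj (by omega))
    · exact min_le_left _ _
  · rcases min_choice (candidate b c Du Dv k (m + 1)) best with h | h
    · exact .inr ⟨m + 1, by omega, le_rfl, h⟩
    · rw [h]
      exact h2.imp_right fun ⟨j, h3, h4, h5⟩ => ⟨j, h3, by omega, h5⟩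

/-- If the initial value `b * c + Dv` was never replaced, the last chunk alone can carry the whole
cost, and `Du ≤ β` makes the contribution of the others nonnegative. -/
theorem IsLeastCandidate.le_capacity (hb : 1 < b) {k : ℕ} (hk : 1 ≤ k) {best : ℝ}
    (h : IsLeastCandidate b c Du Dv k k best) (hβ : best ≤ β) (hu : Du ≤ β) :
    c ≤ capacity b Du Dv β k := by
  have hb0 : 0 < b := by linarith
  rcases h.2 with h | ⟨j, h1, h2, h3⟩
  · have h4 := Chunking.le_capacity (β := β) (Du := Du) (Dv := Dv) hb 0 (k - 1)
    rw [show 0 + 1 + (k - 1) = k by omega] at h4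
    have h5 : 0 ≤ ((k - 1 : ℕ) : ℝ) / b * (β - Du) :=
      mul_nonneg (div_nonneg (Nat.cast_nonneg _) hb0.le) (by linarith)
    have h6 : c ≤ (β - Dv) / b := by rw [le_div_iff₀ hb0]; linarith
    have h7 : (β - Dv) * (1 - (1 - 1 / b) ^ (0 + 1)) = (β - Dv) / b := by ring
    linarith
  · rw [h3, candidate_le_iff hb h1 h2] at hβ
    have h4 := Chunking.le_capacity (β := β) (Du := Du) (Dv := Dv) hb (j - 1) (k - j)
    rw [show j - 1 + 1 + (k - j) = k by omega, show j - 1 + 1 = j by omega,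
      Nat.cast_sub h2] at h4
    exact hβ.trans h4

/-- After the last chunk the agent stands at the end of the edge. -/
theorem Feasible.le_of_mem_last {l : List ℝ≥0} (hl : l ≠ []) (hb : 1 < b)
    (h : Feasible b Du Dv β l) : Dv ≤ β := by
  induction l with
  | nil => exact (hl rfl).elim
  | cons x l ih =>
    cases l with
    | nil =>
      have h1 : b * x + Dv ≤ β := by simpa [restReal] using h.1
      have : 0 ≤ b * (x : ℝ) := mul_nonneg (by linarith) x.2
      linarith
    | cons y l => exact ih (by simp) h.2

/-- The perceived cost of the first chunk is at least its true cost plus the remaining distance,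
which is at least the distance from the source. -/
theorem Feasible.le_of_sum {l : List ℝ≥0} (hl : l ≠ []) (hb : 1 < b)
    (h : Feasible b Du Dv β l) (hs : Du ≤ l.sum + Dv) : Du ≤ β := by
  cases l with
  | nil => exact (hl rfl).elim
  | cons x l =>
    have h1 := h.1
    have h2 : (x : ℝ) ≤ b * x := le_mul_of_one_le_left x.2 hb.le
    rw [List.sum_cons, NNReal.coe_add] at hs
    cases l with
    | nil =>
      simp only [List.sum_nil, NNReal.coe_zero, restReal, if_true] at hs h1
      linarith
    | cons y l =>
      have hx := x.2
      rw [restReal, if_neg (by simp)] at h1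
      rcases min_choice (((y :: l).sum : ℝ) + Dv) Du with h3 | h3 <;> rw [h3] at h1
      · linarith
      · have : 0 ≤ b * (x : ℝ) := mul_nonneg (by linarith) x.2
        linarith

/-- The lower bound for the bottleneck. -/
theorem IsLeastCandidate.le_of_feasible (hb : 1 < b) {k : ℕ} (hk : 1 ≤ k) {best : ℝ}
    (h : IsLeastCandidate b c Du Dv k k best) (hc : Du ≤ c + Dv) {l : List ℝ≥0}
    (hlen : l.length = k) (hsum : (l.sum : ℝ) = c) (hl : Feasible b Du Dv β l) :
    max (max best Du) Dv ≤ β := by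
  have hne : l ≠ [] := List.ne_nil_of_length_pos (by omega)
  have h1 := hl.le_of_mem_last hne hb
  have h2 := hl.le_of_sum hne hb (by rwa [hsum])
  refine max_le (max_le ?_ h2) h1
  obtain ⟨m, rfl⟩ : ∃ m, k = m + 1 := ⟨k - 1, by omega⟩
  -- The candidate for the actual switching point at `β` is at most `β`, and the best one is no
  -- larger.
  obtain ⟨j, h3, h4, -, h5⟩ := exists_capacity_eq (Dv := Dv) h2 hb m
  refine (h.1 j h3 h4).trans ((candidate_le_iff hb h3 h4).2 ?_)
  rw [← hsum]
  refine (hl.sum_le hb).trans_eq ?_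
  rw [hlen, h5]
  push_cast
  ring

/-- The state of the greedy choice of chunks from the last one to the first: the chunks `l` are
chosen, as large as possible. -/
def IsGreedy (b c Du Dv β : ℝ) (l : List ℝ≥0) : Prop :=
  Feasible b Du Dv β l ∧ (l.sum : ℝ) ≤ c ∧
    (c ≤ l.sum ∨ (l.sum : ℝ) = capacity b Du Dv β l.length)

theorem isGreedy_nil (hc : 0 ≤ c) : IsGreedy b c Du Dv β [] :=
  ⟨trivial, by simpa using hc, .inr (by simp [capacity])⟩

theorem restReal_le (hu : Du ≤ β) (hv : Dv ≤ β) (l : List ℝ≥0) : restReal Du Dv l ≤ β := by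
  rw [restReal]
  split_ifs
  exacts [hv, (min_le_right _ _).trans hu]

/-- The reason for raising the least candidate to `Du` and `Dv`: below these values the greedy rule
could ask for a negative chunk. -/
theorem greedy_nonneg (hb : 1 < b) (hu : Du ≤ β) (hv : Dv ≤ β) {l : List ℝ≥0}
    (h : IsGreedy b c Du Dv β l) :
    0 ≤ min (c - l.sum) ((β - restReal Du Dv l) / b) := by
  refine le_min (sub_nonneg.2 h.2.1) (div_nonneg ?_ (by linarith))
  exact sub_nonneg.2 (restReal_le hu hv l)

/-- Either the new chunk exhausts the cost, or it exhausts the bound `β`; in the latter case the sum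
follows the recursion of `capacity`. -/
theorem IsGreedy.cons (hb : 1 < b) {l : List ℝ≥0}
    (h : IsGreedy b c Du Dv β l) {x : ℝ≥0}
    (hx : (x : ℝ) = min (c - l.sum) ((β - restReal Du Dv l) / b)) :
    IsGreedy b c Du Dv β (x :: l) := by
  have hb0 : 0 < b := by linarith
  obtain ⟨h1, h2, h3⟩ := h
  have hx1 : (x : ℝ) ≤ c - l.sum := hx.trans_le (min_le_left _ _)
  have hx2 : (x : ℝ) ≤ (β - restReal Du Dv l) / b := hx.trans_le (min_le_right _ _)
  have hx0 := x.2
  refine ⟨⟨?_, h1⟩, ?_, ?_⟩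
  · rw [le_div_iff₀ hb0] at hx2; linarith
  · rw [List.sum_cons, NNReal.coe_add]; linarith
  · rw [List.sum_cons, NNReal.coe_add]
    rcases h3 with h3 | h3
    · left
      have : (0 : ℝ) ≤ x := hx0
      linarith
    · rcases min_choice (c - (l.sum : ℝ)) ((β - restReal Du Dv l) / b) with h4 | h4
      · left; linarith
      · right
        rw [hx, h4, List.length_cons, capacity, ← h3, restReal]
        simp only [List.length_eq_zero_iff]
        ring

theorem IsGreedy.sum_eq {l : List ℝ≥0} (h : IsGreedy b c Du Dv β l)
    (hc : c ≤ capacity b Du Dv β l.length) : (l.sum : ℝ) = c :=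
  le_antisymm h.2.1 (h.2.2.elim id fun h => hc.trans_eq h.symm)

end EdgeMath

/-! ## Real bottlenecks and bottlenecks in a task graph -/

namespace TaskGraph

variable {V E : Type*} {G : TaskGraph V E} {b : ℝ≥0} {e : E}

theorem dist_src_ne_top (h : G.dist (G.tgt e) G.t ≠ ⊤) : G.dist (G.src e) G.t ≠ ⊤ :=
  ne_top_of_le_ne_top (ENNReal.add_ne_top.2 ⟨ENNReal.coe_ne_top, h⟩) (WGraph.dist_src_le e)

theorem toReal_dist_src_le (h : G.dist (G.tgt e) G.t ≠ ⊤) :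
    (G.dist (G.src e) G.t).toReal ≤ G.cost e + (G.dist (G.tgt e) G.t).toReal := by
  have := ENNReal.toReal_mono (ENNReal.add_ne_top.2 ⟨ENNReal.coe_ne_top, h⟩)
    (WGraph.dist_src_le (t := G.t) e)
  rwa [ENNReal.toReal_add ENNReal.coe_ne_top h, ENNReal.coe_toReal] at this

theorem restDist_eq_ofReal (h : G.dist (G.tgt e) G.t ≠ ⊤) (l : List ℝ≥0) :
    G.restDist G.t e l = ENNReal.ofReal
      (restReal (G.dist (G.src e) G.t).toReal (G.dist (G.tgt e) G.t).toReal l) := by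
  have hu := dist_src_ne_top h
  have h1 := WGraph.exitDist_eq_dist (G := G.toWGraph) (src_ne_of_dist_ne_top h)
  cases l with
  | nil => simp [restReal, h]
  | cons x l =>
    rw [WGraph.restDist_cons, h1, restReal, if_neg (by simp), ENNReal.ofReal_min,
      ENNReal.ofReal_add (NNReal.coe_nonneg _) ENNReal.toReal_nonneg, ENNReal.ofReal_toReal h,
      ENNReal.ofReal_toReal hu, ENNReal.ofReal_coe_nnreal]

/-- Passage from extended nonnegative reals to the reals on which the machine computes. It requires
that `t` be reachable from the target. -/
theorem maxPerceived_le_ofReal_iff (h : G.dist (G.tgt e) G.t ≠ ⊤) {β : ℝ} (hβ : 0 ≤ β)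
    (l : List ℝ≥0) : G.maxPerceived b G.t e l ≤ ENNReal.ofReal β ↔
      Feasible b (G.dist (G.src e) G.t).toReal (G.dist (G.tgt e) G.t).toReal β l := by
  induction l with
  | nil => simp [WGraph.maxPerceived, Feasible]
  | cons x l ih =>
    have h0 : 0 ≤ restReal (G.dist (G.src e) G.t).toReal (G.dist (G.tgt e) G.t).toReal l := by
      rw [restReal]
      split_ifs
      · exact ENNReal.toReal_nonneg
      · exact le_min (add_nonneg (NNReal.coe_nonneg _) ENNReal.toReal_nonneg)
          ENNReal.toReal_nonneg
    rw [WGraph.maxPerceived, max_le_iff, ih, Feasible, restDist_eq_ofReal h,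
      ← ENNReal.coe_mul, ← ENNReal.ofReal_coe_nnreal, ← ENNReal.ofReal_add (NNReal.coe_nonneg _) h0,
      ENNReal.ofReal_le_ofReal_iff hβ, NNReal.coe_mul]

theorem isOptimalEdgeChunking_of_real [LinearOrder V] [DecidableEq E]
    (h : G.dist (G.tgt e) G.t ≠ ⊤) {k : ℕ} (hk : 1 ≤ k) {β : ℝ} (hβ : 0 ≤ β) {l : List ℝ≥0}
    (hlen : l.length = k) (hsum : l.sum = G.cost e)
    (hl : Feasible b (G.dist (G.src e) G.t).toReal (G.dist (G.tgt e) G.t).toReal β l)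
    (hlow : ∀ β' l', l'.length = k → l'.sum = G.cost e →
      Feasible b (G.dist (G.src e) G.t).toReal (G.dist (G.tgt e) G.t).toReal β' l' → β ≤ β') :
    G.IsOptimalEdgeChunking b k e l ∧ G.bottleneck b e l = ENNReal.ofReal β := by
  have hne : ∀ l' : List ℝ≥0, l'.length = k → l' ≠ [] :=
    fun l' h => List.ne_nil_of_length_pos (by omega)
  have low : ∀ l', l'.length = k → l'.sum = G.cost e →
      ENNReal.ofReal β ≤ G.maxPerceived b G.t e l' := by
    intro l' h1 h2
    by_cases htop : G.maxPerceived b G.t e l' = ⊤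
    · rw [htop]; exact le_top
    · rw [← ENNReal.ofReal_toReal htop]
      refine ENNReal.ofReal_le_ofReal (hlow _ l' h1 h2 ?_)
      rw [← maxPerceived_le_ofReal_iff h ENNReal.toReal_nonneg, ENNReal.ofReal_toReal htop]
  have hmax : G.maxPerceived b G.t e l ≤ ENNReal.ofReal β :=
    (maxPerceived_le_ofReal_iff h hβ l).2 hl
  refine ⟨⟨⟨hlen, hsum⟩, fun l' h1 h2 => ?_⟩, ?_⟩
  · rw [bottleneck_eq (hne l hlen) hsum, bottleneck_eq (hne l' h1) h2]
    exact hmax.trans (low l' h1 h2)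
  · rw [bottleneck_eq (hne l hlen) hsum]
    exact le_antisymm hmax (low l hlen hsum)

end TaskGraph

end Chunking

namespace Chunking

/-! ## The edge-chunking program -/

/-- A step of the search for the best candidate. The real registers 21, 22 and 23 hold
`(k - j) / b`, `(1 - 1 / b) ^ j` and the least candidate so far. -/
def candidateStep : Prog :=
  .block [
    .setReal 22 (.mul (.reg 22) (.reg 20)),
    .setReal 21 (.sub (.reg 21) (.reg 27)),
    .setReal 26 (.div
      (.add (.add (.reg 1) (.mul (.reg 3) (.sub (.lit 1) (.reg 22)))) (.mul (.reg 21) (.reg 2)))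
      (.add (.sub (.lit 1) (.reg 22)) (.reg 21))),
    .cond (.rle (.reg 26) (.reg 23)) (.setReal 23 (.reg 26)) .skip]

/-- A step of the greedy choice of the chunks. The real registers 24 and 25 hold the total cost of
the chunks chosen, and the distance to `t` after the next chunk. -/
def greedyStep : Prog :=
  .block [
    .setReal 26 (.div (.sub (.reg 23) (.reg 25)) (.reg 0)),
    .cond (.rle (.sub (.reg 1) (.reg 24)) (.reg 26))
      (.setReal 26 (.sub (.reg 1) (.reg 24))) .skip,
    .putReal 1 (.sub (.sub (.add (.reg 5) (.reg 2)) (.lit 1)) (.reg 20)) (.reg 26),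
    .setReal 24 (.add (.reg 24) (.reg 26)),
    .cond (.rle (.add (.reg 24) (.reg 3)) (.reg 2))
      (.setReal 25 (.add (.reg 24) (.reg 3))) (.setReal 25 (.reg 2))]

/-- The preparation of the search for the best candidate. -/
def edgeInit : Prog :=
  .block [
    .setReal 27 (.div (.lit 1) (.reg 0)),
    .setReal 20 (.sub (.lit 1) (.reg 27)),
    .setReal 21 (.lit 0),
    .setReal 22 (.lit 1),
    .setReal 23 (.add (.mul (.reg 0) (.reg 1)) (.reg 3)),
    .setNat 20 (.lit 0)]

/-- The preparation of the greedy choice of the chunks. -/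
def greedyInit : Prog :=
  .block [
    .cond (.rle (.reg 23) (.reg 2)) (.setReal 23 (.reg 2)) .skip,
    .cond (.rle (.reg 23) (.reg 3)) (.setReal 23 (.reg 3)) .skip,
    .setReal 24 (.lit 0),
    .setReal 25 (.reg 3),
    .setReal 4 (.reg 23),
    .setNat 20 (.lit 0)]

/-- The edge-chunking algorithm. -/
def edgeProg : Prog :=
  .seq edgeInit (.seq (.countUp 20 2 (.setReal 21 (.add (.reg 21) (.reg 27))))
    (.seq (.setNat 20 (.lit 0)) (.seq (.countUp 20 2 candidateStep)
      (.seq greedyInit (.countUp 20 2 greedyStep)))))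

/-- The real and natural registers, and the arrays, that the edge-chunking program does not
change. -/
structure EdgeFrame (σ σ' : Store) : Prop where
  natReg : ∀ x, x ≠ 20 → σ'.natReg x = σ.natReg x
  natArr : σ'.natArr = σ.natArr
  realReg : ∀ x < 4, σ'.realReg x = σ.realReg x
  realArr : ∀ a, a ≠ 1 → σ'.realArr a = σ.realArr a
  outside : ∀ j, (j < σ.natReg 5 ∨ σ.natReg 5 + σ.natReg 2 ≤ j) →
    σ'.realArr 1 j = σ.realArr 1 j

theorem EdgeFrame.of_eq {σ σ' : Store} (h1 : ∀ x, x ≠ 20 → σ'.natReg x = σ.natReg x)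
    (h2 : σ'.natArr = σ.natArr) (h3 : ∀ x < 4, σ'.realReg x = σ.realReg x)
    (h4 : σ'.realArr = σ.realArr) : EdgeFrame σ σ' :=
  ⟨h1, h2, h3, fun _ _ => by rw [h4], fun _ _ => by rw [h4]⟩

theorem EdgeFrame.trans {σ σ' σ'' : Store} (h : EdgeFrame σ σ') (h' : EdgeFrame σ' σ'') :
    EdgeFrame σ σ'' where
  natReg x hx := (h'.natReg x hx).trans (h.natReg x hx)
  natArr := h'.natArr.trans h.natArr
  realReg x hx := (h'.realReg x hx).trans (h.realReg x hx)
  realArr a ha := (h'.realArr a ha).trans (h.realArr a ha)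
  outside j hj := by
    rw [h'.outside j (by rwa [h.natReg 5 (by norm_num), h.natReg 2 (by norm_num)]),
      h.outside j hj]

theorem candidateStep_run (σ : Store) : EdgeFrame σ (candidateStep.run σ) ∧
    (candidateStep.run σ).natReg 20 = σ.natReg 20 ∧
    (candidateStep.run σ).realReg 20 = σ.realReg 20 ∧
    (candidateStep.run σ).realReg 27 = σ.realReg 27 ∧
    (candidateStep.run σ).realReg 22 = σ.realReg 22 * σ.realReg 20 ∧
    (candidateStep.run σ).realReg 21 = σ.realReg 21 - σ.realReg 27 ∧
    (candidateStep.run σ).realReg 23 = min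
      ((σ.realReg 1 + σ.realReg 3 * (1 - σ.realReg 22 * σ.realReg 20) +
        (σ.realReg 21 - σ.realReg 27) * σ.realReg 2) /
        (1 - σ.realReg 22 * σ.realReg 20 + (σ.realReg 21 - σ.realReg 27))) (σ.realReg 23) := by
  -- Inequalities with which the simplifier sees that the input registers are not overwritten.
  have frame : ∀ x < 4, x ≠ 20 ∧ x ≠ 21 ∧ x ≠ 22 ∧ x ≠ 23 ∧ x ≠ 26 := by omega
  by_cases h : (σ.realReg 1 + σ.realReg 3 * (1 - σ.realReg 22 * σ.realReg 20) +
        (σ.realReg 21 - σ.realReg 27) * σ.realReg 2) /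
        (1 - σ.realReg 22 * σ.realReg 20 + (σ.realReg 21 - σ.realReg 27)) ≤ σ.realReg 23 <;>
    refine ⟨.of_eq ?_ ?_ ?_ ?_, ?_⟩ <;>
    simp +contextual [candidateStep, Prog.block, Prog.run, frame, h, min_def]

/-- The chunks are found in reverse order, so the array is filled from the end of its block towards
the front. -/
theorem greedyStep_run (σ : Store) (j : ℕ) (x : ℝ)
    (hx : x = min (σ.realReg 1 - σ.realReg 24) ((σ.realReg 23 - σ.realReg 25) / σ.realReg 0))
    (hj : σ.natReg 5 + σ.natReg 2 - 1 - σ.natReg 20 = j) (hj1 : σ.natReg 5 ≤ j)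
    (hj2 : j < σ.natReg 5 + σ.natReg 2) : EdgeFrame σ (greedyStep.run σ) ∧
    (greedyStep.run σ).natReg 20 = σ.natReg 20 ∧
    (greedyStep.run σ).realReg 4 = σ.realReg 4 ∧
    (greedyStep.run σ).realReg 23 = σ.realReg 23 ∧
    (greedyStep.run σ).realReg 24 = σ.realReg 24 + x ∧
    (greedyStep.run σ).realReg 25 = min (σ.realReg 24 + x + σ.realReg 3) (σ.realReg 2) ∧
    (greedyStep.run σ).realArr 1 = Function.update (σ.realArr 1) j x := by
  subst hx
  have frame : ∀ x < 4, x ≠ 4 ∧ x ≠ 24 ∧ x ≠ 25 ∧ x ≠ 26 := by omega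
  have up : ∀ i v, (i < σ.natReg 5 ∨ σ.natReg 5 + σ.natReg 2 ≤ i) →
      Function.update (σ.realArr 1) j v i = σ.realArr 1 i := by
    intro i v hi
    exact Function.update_of_ne (by omega) _ _
  by_cases h1 : σ.realReg 1 - σ.realReg 24 ≤ (σ.realReg 23 - σ.realReg 25) / σ.realReg 0
  · rw [min_eq_left h1]
    by_cases h2 : σ.realReg 24 + (σ.realReg 1 - σ.realReg 24) + σ.realReg 3 ≤ σ.realReg 2 <;>
      refine ⟨⟨?_, ?_, ?_, ?_, ?_⟩, ?_⟩ <;> simp only [add_sub_cancel] at h2 ⊢ <;>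
      simp +contextual [greedyStep, Prog.block, Prog.run, frame, hj, up, h1, h2, min_def]
  · rw [min_eq_right (not_le.1 h1).le]
    by_cases h2 : σ.realReg 24 + (σ.realReg 23 - σ.realReg 25) / σ.realReg 0 + σ.realReg 3 ≤
        σ.realReg 2 <;> refine ⟨⟨?_, ?_, ?_, ?_, ?_⟩, ?_⟩ <;>
      simp +contextual [greedyStep, Prog.block, Prog.run, frame, hj, up, h1, h2, min_def]

/-- What the edge-chunking program computes. -/
theorem edgeProg_spec {S : Store → Prop} (σ : Store) {k : ℕ} (hk : 1 ≤ k)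
    (hσk : σ.natReg 2 = k) (hb : 1 < σ.realReg 0) (hc : 0 ≤ σ.realReg 1)
    (hle : σ.realReg 2 ≤ σ.realReg 1 + σ.realReg 3) :
    Spec none S edgeProg σ (200 * k) 0 0 fun σ' => EdgeFrame σ σ' ∧
      max (σ.realReg 2) (σ.realReg 3) ≤ σ'.realReg 4 ∧
      ∃ l : List ℝ≥0, l.length = k ∧ (l.sum : ℝ) = σ.realReg 1 ∧ HoldsAt σ' (σ.natReg 5) l ∧
        Feasible (σ.realReg 0) (σ.realReg 2) (σ.realReg 3) (σ'.realReg 4) l ∧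
        ∀ β (l' : List ℝ≥0), l'.length = k → (l'.sum : ℝ) = σ.realReg 1 →
          Feasible (σ.realReg 0) (σ.realReg 2) (σ.realReg 3) β l' → σ'.realReg 4 ≤ β := by
  set b := σ.realReg 0
  set c := σ.realReg 1
  set Du := σ.realReg 2
  set Dv := σ.realReg 3
  have frame : ∀ x < 4, x ≠ 4 ∧ x ≠ 20 ∧ x ≠ 21 ∧ x ≠ 22 ∧ x ≠ 23 ∧ x ≠ 24 ∧ x ≠ 25 ∧ x ≠ 26 ∧
    x ≠ 27 := by omega
  let R1 : ℕ → Store → Prop := fun i σ' => EdgeFrame σ σ' ∧ σ'.realReg 27 = 1 / b ∧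
    σ'.realReg 20 = 1 - 1 / b ∧ σ'.realReg 21 = (i : ℝ) / b ∧ σ'.realReg 22 = 1 ∧
    σ'.realReg 23 = b * c + Dv
  have s1 : Spec none S edgeInit σ edgeInit.size 0 0 fun σ' => σ'.natReg 20 = 0 ∧ R1 0 σ' := by
    refine Spec.of_run (by simp [edgeInit, Prog.block, Prog.Straight]) ⟨?_, .of_eq ?_ ?_ ?_ ?_, ?_⟩
    all_goals simp +contextual [edgeInit, Prog.block, Prog.run, frame, b, c, Dv]
  -- The machine cannot turn a natural number into a real one, so `k / b` is formed by adding `1 /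
  -- b` repeatedly.
  have s2 : ∀ σ1 : Store, σ1.natReg 20 = 0 → R1 0 σ1 →
      Spec none S (.countUp 20 2 (.setReal 21 (.add (.reg 21) (.reg 27)))) σ1
        ((4 + 9) * (k - 0) + 5) (0 * (k - 0)) (0 * (k - 0)) fun σ' => σ'.natReg 2 = k ∧ R1 k σ' := by
    intro σ1 h1 h2
    refine Spec.countUp R1 ?_ (by norm_num) (Nat.zero_le _) h1
      ((h2.1.natReg 2 (by norm_num)).trans hσk) h2
    rintro i σ' hi ⟨h3, h4, h5, h6, h7, h8⟩ h9 h10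
    refine Spec.of_run trivial ⟨by simpa [Prog.run], by simpa [Prog.run],
      h3.trans (.of_eq ?_ ?_ ?_ ?_), ?_⟩
    · simp +contextual [Prog.run]
    · simp [Prog.run]
    · simp +contextual [Prog.run, frame]
    · simp [Prog.run]
    · simp [Prog.run, h4, h5, h6, h7, h8]
      ring
  let R2 : ℕ → Store → Prop := fun i σ' => EdgeFrame σ σ' ∧ σ'.realReg 27 = 1 / b ∧
    σ'.realReg 20 = 1 - 1 / b ∧ σ'.realReg 21 = ((k : ℝ) - i) / b ∧
    σ'.realReg 22 = (1 - 1 / b) ^ i ∧ IsLeastCandidate b c Du Dv k i (σ'.realReg 23)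
  have s3 : ∀ σ2, R1 k σ2 → Spec none S (.setNat 20 (.lit 0)) σ2 2 0 0
      fun σ' => σ'.natReg 20 = 0 ∧ R2 0 σ' := by
    rintro σ2 ⟨h3, h4, h5, h6, h7, h8⟩
    refine Spec.of_run trivial ⟨by simp [Prog.run], h3.trans (.of_eq ?_ ?_ ?_ ?_), ?_⟩
    · simp +contextual [Prog.run]
    · simp [Prog.run]
    · simp [Prog.run]
    · simp [Prog.run]
    · refine ⟨h4, h5, ?_, ?_, fun j h1 h2 => by omega, .inl h8⟩ <;> simp [Prog.run, h6, h7]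
  have s4 : ∀ σ3 : Store, σ3.natReg 20 = 0 → R2 0 σ3 →
      Spec none S (.countUp 20 2 candidateStep) σ3
        ((candidateStep.size + 9) * (k - 0) + 5) (0 * (k - 0)) (0 * (k - 0))
        fun σ' => σ'.natReg 2 = k ∧ R2 k σ' := by
    intro σ1 h1 h2
    refine Spec.countUp R2 ?_ (by norm_num) (Nat.zero_le _) h1
      ((h2.1.natReg 2 (by norm_num)).trans hσk) h2
    rintro i σ' hi ⟨h3, h4, h5, h6, h7, h8⟩ h9 h10
    obtain ⟨g1, g2, g3, g4, g5, g6, g7⟩ := candidateStep_run σ'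
    have e21 : σ'.realReg 21 - σ'.realReg 27 = ((k : ℝ) - (i + 1 : ℕ)) / b := by
      rw [h6, h4]; push_cast; ring
    have e22 : σ'.realReg 22 * σ'.realReg 20 = (1 - 1 / b) ^ (i + 1) := by
      rw [h7, h5, pow_succ]
    refine Spec.of_run (by simp [candidateStep, Prog.block, Prog.Straight])
      ⟨g2.trans h9, (g1.natReg 2 (by norm_num)).trans h10,
      (h3.trans g1).trans (.of_eq ?_ ?_ ?_ ?_), ?_⟩
    · simp +contextual
    · simp
    · simp
    · simp
    · refine ⟨g4.trans h4, g3.trans h5, g6.trans e21, g5.trans e22, ?_⟩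
      have := h8.succ
      rw [candidate] at this
      rw [Store.setNat_realReg, g7, e21, e22, h3.realReg 1 (by norm_num),
        h3.realReg 2 (by norm_num), h3.realReg 3 (by norm_num)]
      exact this
  have s5 : ∀ σ4, R2 k σ4 → Spec none S greedyInit σ4 greedyInit.size 0 0 fun σ' =>
      σ'.natReg 20 = 0 ∧ EdgeFrame σ σ' ∧ σ'.realReg 23 = σ'.realReg 4 ∧ σ'.realReg 24 = 0 ∧
      σ'.realReg 25 = Dv ∧ σ'.realReg 4 = max (max (σ4.realReg 23) Du) Dv := by
    rintro σ4 ⟨h3, -⟩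
    have e2 := h3.realReg 2 (by norm_num)
    have e3 := h3.realReg 3 (by norm_num)
    refine Spec.of_run (by simp [greedyInit, Prog.block, Prog.Straight])
      ⟨?_, h3.trans (.of_eq ?_ ?_ ?_ ?_), ?_⟩
    all_goals
      by_cases q1 : σ4.realReg 23 ≤ Du
      · by_cases q2 : Du ≤ Dv <;>
          simp +contextual [greedyInit, Prog.block, Prog.run, frame, e2, e3, q1, q2, max_def, Du, Dv]
      · by_cases q2 : σ4.realReg 23 ≤ Dv <;>
          simp +contextual [greedyInit, Prog.block, Prog.run, frame, e2, e3, q1, q2, max_def, Du, Dv]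
  have hv : ∀ σ5 σ4 : Store, σ5.realReg 4 = max (max (σ4.realReg 23) Du) Dv →
      Du ≤ σ5.realReg 4 ∧ Dv ≤ σ5.realReg 4 ∧ σ4.realReg 23 ≤ σ5.realReg 4 := by
    intro σ5 σ4 h
    rw [h]
    exact ⟨(le_max_right _ _).trans (le_max_left _ _), le_max_right _ _,
      (le_max_left _ _).trans (le_max_left _ _)⟩
  -- The list grows at its head; after `i` chunks it occupies the last `i` of the `k` positions.
  let R3 : ℝ → ℕ → Store → Prop := fun β i σ' => EdgeFrame σ σ' ∧ σ'.realReg 23 = β ∧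
    σ'.realReg 4 = β ∧ ∃ l : List ℝ≥0, l.length = i ∧
      σ'.realReg 24 = l.sum ∧ σ'.realReg 25 = restReal Du Dv l ∧
      HoldsAt σ' (σ.natReg 5 + (k - i)) l ∧ IsGreedy b c Du Dv β l
  have s6 : ∀ (β : ℝ) (σ5 : Store), Du ≤ β → Dv ≤ β → σ5.natReg 20 = 0 → R3 β 0 σ5 →
      Spec none S (.countUp 20 2 greedyStep) σ5
        ((greedyStep.size + 9) * (k - 0) + 5) (0 * (k - 0)) (0 * (k - 0))
        fun σ' => σ'.natReg 2 = k ∧ R3 β k σ' := by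
    intro β σ5 hDu hDv h1 h2
    refine Spec.countUp (R3 β) ?_ (by norm_num) (Nat.zero_le _) h1
      ((h2.1.natReg 2 (by norm_num)).trans hσk) h2
    rintro i σ' hi ⟨h3, h4, h5, l, h6, h7, h8, h9, h10⟩ h11 h12
    have hx := greedy_nonneg hb hDu hDv h10
    obtain ⟨x, hxe⟩ : ∃ x : ℝ≥0, (x : ℝ) = min (c - l.sum) ((β - restReal Du Dv l) / b) :=
      ⟨⟨_, hx⟩, rfl⟩
    have e5 : σ'.natReg 5 = σ.natReg 5 := h3.natReg 5 (by norm_num)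
    obtain ⟨g1, g2, g3, g4, g5, g6, g7⟩ := greedyStep_run σ' (σ.natReg 5 + (k - (i + 1))) x
      (by rw [hxe, h7, h8, h4, h3.realReg 1 (by norm_num), h3.realReg 0 (by norm_num)])
      (by omega) (by omega) (by omega)
    refine Spec.of_run (by simp [greedyStep, Prog.block, Prog.Straight])
      ⟨g2.trans h11, (g1.natReg 2 (by norm_num)).trans h12,
      (h3.trans g1).trans (.of_eq ?_ ?_ ?_ ?_), g4.trans h4, g3.trans h5, x :: l, by simp [h6],
      ?_, ?_, ?_, h10.cons hb hxe⟩
    · simp +contextual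
    · simp
    · simp
    · simp
    · rw [Store.setNat_realReg, g5, h7, List.sum_cons, NNReal.coe_add, add_comm]
    · rw [Store.setNat_realReg, g6, h7, restReal, if_neg (by simp), List.sum_cons, NNReal.coe_add,
        h3.realReg 3 (by norm_num), h3.realReg 2 (by norm_num), add_comm (x : ℝ)]
    · intro j
      rw [Store.setNat_realArr, g7]
      refine Fin.cases ?_ (fun j => ?_) j
      · simp
      · have := h9 j
        rw [Function.update_of_ne (by simp)]
        refine Eq.trans ?_ this
        congr 1
        simp only [Fin.val_succ]
        omega
  refine (s1.seq fun σ1 h1 => (s2 σ1 h1.1 h1.2).seq fun σ2 h2 => (s3 σ2 h2.2).seq fun σ3 h3 =>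
    (s4 σ3 h3.1 h3.2).seq fun σ4 h4 => (s5 σ4 h4.2).seq fun σ5 h5 =>
    (s6 (σ5.realReg 4) σ5 (hv σ5 σ4 h5.2.2.2.2.2).1 (hv σ5 σ4 h5.2.2.2.2.2).2.1 h5.1
      ⟨h5.2.1, h5.2.2.1, rfl, [], rfl, by simpa using h5.2.2.2.1, by simpa [restReal] using
        h5.2.2.2.2.1, fun j => j.elim0, isGreedy_nil hc⟩).imp
      (Q := fun σ' => EdgeFrame σ σ' ∧ max Du Dv ≤ σ'.realReg 4 ∧
      ∃ l : List ℝ≥0, l.length = k ∧ (l.sum : ℝ) = c ∧ HoldsAt σ' (σ.natReg 5) l ∧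
        Feasible b Du Dv (σ'.realReg 4) l ∧
        ∀ β (l' : List ℝ≥0), l'.length = k → (l'.sum : ℝ) = c →
          Feasible b Du Dv β l' → σ'.realReg 4 ≤ β) ?_).mono ?_ (by omega) (by omega)
      fun _ h => h
  · rintro σ' ⟨-, g1, -, g2, l, g3, -, -, g4, g5⟩
    obtain ⟨-, -, -, -, -, hbest⟩ := h4.2
    have hβ := h5.2.2.2.2.2
    obtain ⟨v1, v2, v3⟩ := hv σ5 σ4 hβ
    rw [g2]
    refine ⟨g1, max_le v1 v2, l, g3, ?_, by simpa using g4, g5.1, fun β l' h6 h7 h8 => ?_⟩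
    · refine g5.sum_eq ?_
      rw [g3]
      exact hbest.le_capacity hb hk v3 v1
    · rw [hβ]
      exact hbest.le_of_feasible hb hk hle h6 h7 h8
  -- Three loops of length `k` and a constant amount of other work, which is absorbed because `k ≥
  -- 1`.
  · simp only [edgeInit, candidateStep, greedyInit, greedyStep, Prog.block, Prog.size, NExp.ops,
      RExp.ops, BExp.ops]
    omega

/-- The edge-chunking program is correct on the inputs given by an edge of a task graph. -/
theorem edgeProg_edgeOutput {S : Store → Prop} {V E : Type*} [LinearOrder V] [DecidableEq E]
    {G : TaskGraph V E} {b : ℝ≥0} {k : ℕ} {e : E} {σ : Store} (hb : 1 < b) (hk : 1 ≤ k)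
    (h : EdgeInput G b k e σ) :
    Spec none S edgeProg σ (200 * k) 0 0 fun σ' => EdgeFrame σ σ' ∧ EdgeOutput G b k e σ σ' := by
  obtain ⟨h0, h1, h2, h3, h4, h5⟩ := h
  refine (edgeProg_spec σ hk h1 (by rw [h2]; exact_mod_cast hb) (by rw [h3]; exact NNReal.coe_nonneg _)
    (by rw [h3, h4, h5]; exact TaskGraph.toReal_dist_src_le h0)).imp ?_
  rintro σ' ⟨g1, g2, l, g3, g4, g5, g6, g7⟩
  rw [h2, h3, h4, h5] at *
  have hβ : 0 ≤ σ'.realReg 4 := (le_max_of_le_left ENNReal.toReal_nonneg).trans g2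
  obtain ⟨g8, g9⟩ := TaskGraph.isOptimalEdgeChunking_of_real h0 hk hβ g3 (by exact_mod_cast g4) g6
    fun β' l' q1 q2 q3 => g7 β' l' q1 (by rw [q2]) q3
  exact ⟨g1, l, g8, g5, hβ, g9⟩

theorem isEdgeChunkingAlgorithm_edgeProg {A : ℕ} (hA : 200 ≤ A) :
    IsEdgeChunkingAlgorithm A edgeProg := by
  intro n m G b k e σ hb hk h
  obtain ⟨σ', κ, h1, h2, -, -, -, -, h3⟩ :=
    edgeProg_edgeOutput (S := fun _ => True) hb hk h
  exact ⟨σ', κ, h1, h2.trans (Nat.mul_le_mul_right k hA), h3⟩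

end Chunking

namespace Chunking

/-! ## Task graphs in the memory -/

/-- The memory holds the task graph `G`, the bias `b` and the local constraint `k`. -/
structure Encodes {n m : ℕ} (G : TaskGraph (Fin n) (Fin m)) (b : ℝ≥0) (k : ℕ) (σ : Store) :
    Prop where
  card_vertices : σ.natReg 0 = n
  card_edges : σ.natReg 1 = m
  constraint : σ.natReg 2 = k
  start : σ.natReg 3 = G.s
  finish : σ.natReg 4 = G.t
  bias : σ.realReg 0 = b
  src : ∀ e : Fin m, σ.natArr 0 e = G.src e
  tgt : ∀ e : Fin m, σ.natArr 1 e = G.tgt e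
  cost : ∀ e : Fin m, σ.realArr 0 e = G.cost e

theorem encodes_graphInput {n m : ℕ} (G : TaskGraph (Fin n) (Fin m)) (b : ℝ≥0) (k : ℕ) :
    Encodes G b k (graphInput G b k) := by
  constructor <;> simp [graphInput]

/-- The input registers and all arrays outside `A` and `B` are unchanged. -/
structure Keeps (A B : Finset ℕ) (σ σ' : Store) : Prop where
  natReg : ∀ x < 5, σ'.natReg x = σ.natReg x
  realReg : σ'.realReg 0 = σ.realReg 0
  natArr : ∀ a ∉ A, σ'.natArr a = σ.natArr a
  realArr : ∀ a ∉ B, σ'.realArr a = σ.realArr a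

namespace Keeps

variable {A B A' B' : Finset ℕ} {σ σ' σ'' : Store}

theorem refl (σ : Store) : Keeps A B σ σ :=
  ⟨fun _ _ => rfl, rfl, fun _ _ => rfl, fun _ _ => rfl⟩

theorem trans (h : Keeps A B σ σ') (h' : Keeps A B σ' σ'') : Keeps A B σ σ'' :=
  ⟨fun x hx => (h'.natReg x hx).trans (h.natReg x hx), h'.realReg.trans h.realReg,
    fun a ha => (h'.natArr a ha).trans (h.natArr a ha),
    fun a ha => (h'.realArr a ha).trans (h.realArr a ha)⟩

theorem mono (h : Keeps A B σ σ') (hA : A ⊆ A') (hB : B ⊆ B') : Keeps A' B' σ σ' :=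
  ⟨h.natReg, h.realReg, fun a ha => h.natArr a fun h => ha (hA h),
    fun a ha => h.realArr a fun h => ha (hB h)⟩

theorem setNat (h : Keeps A B σ σ') {x : ℕ} (hx : 5 ≤ x) (v : ℕ) :
    Keeps A B σ (σ'.setNat x v) :=
  ⟨fun y hy => by rw [Store.setNat_natReg, if_neg (by omega), h.natReg y hy], h.realReg,
    h.natArr, h.realArr⟩

end Keeps

theorem Encodes.of_keeps {n m : ℕ} {G : TaskGraph (Fin n) (Fin m)} {b : ℝ≥0} {k : ℕ}
    {σ σ' : Store} (h : Encodes G b k σ) {A B : Finset ℕ} (hk : Keeps A B σ σ')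
    (h0 : 0 ∉ A) (h1 : 1 ∉ A) (h2 : 0 ∉ B) : Encodes G b k σ' where
  card_vertices := (hk.natReg 0 (by norm_num)).trans h.card_vertices
  card_edges := (hk.natReg 1 (by norm_num)).trans h.card_edges
  constraint := (hk.natReg 2 (by norm_num)).trans h.constraint
  start := (hk.natReg 3 (by norm_num)).trans h.start
  finish := (hk.natReg 4 (by norm_num)).trans h.finish
  bias := hk.realReg.trans h.bias
  src e := by rw [hk.natArr 0 h0, h.src]
  tgt e := by rw [hk.natArr 1 h1, h.tgt]
  cost e := by rw [hk.realArr 0 h2, h.cost]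

/-! ## Shortest paths along an ordering of the edges -/

/-- The natural array 8 lists all edges, each after the edges out of its target. -/
def HoldsOrder {n m : ℕ} (G : TaskGraph (Fin n) (Fin m)) (σ : Store) : Prop :=
  ∃ o : Fin m → Fin m, Function.Surjective o ∧ (∀ i : Fin m, σ.natArr 8 i = o i) ∧
    ∀ i f, G.src f = G.tgt (o i) → ∃ j < i, o j = f

/-- Relaxation of the edge number `i` of the ordering, where `i` is in the natural register 6. The
natural arrays `F`, `X`, `B` tell which distances are finite, how the shortest paths start, and
which edges are blocked; the real array `D` holds the distances. -/
def relaxStep (F X B D : ℕ) : Prog :=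
  .block [
    .setNat 7 (.arr 8 (.reg 6)),
    .setNat 8 (.arr 0 (.reg 7)),
    .setNat 9 (.arr 1 (.reg 7)),
    .setReal 5 (.add (.arr 0 (.reg 7)) (.arr D (.reg 9))),
    .cond (.and (.nle (.arr B (.reg 7)) (.lit 0)) (.and (.not (.nle (.arr F (.reg 9)) (.lit 0)))
        (.not (.and (.not (.nle (.arr F (.reg 8)) (.lit 0))) (.rle (.arr D (.reg 8)) (.reg 5))))))
      (.block [.putNat F (.reg 8) (.lit 1), .putReal D (.reg 8) (.reg 5),
        .putNat X (.reg 8) (.reg 7)]) .skip]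

/-- Shortest paths to `t` in the graph of the edges that are not blocked. -/
def relaxProg (F X B D : ℕ) : Prog :=
  .seq (.block [.putNat F (.reg 4) (.lit 1), .setNat 6 (.lit 0)]) (.countUp 6 1 (relaxStep F X B D))

/-- The distance stored for the vertex `u`. -/
noncomputable def storedDist (σ : Store) (F D u : ℕ) : ℝ≥0∞ :=
  if σ.natArr F u = 0 then ⊤ else ENNReal.ofReal (σ.realArr D u)

theorem relaxStep_run {F X B D : ℕ} (hFX : F ≠ X) (σ : Store) {e u v : ℕ}
    (he : σ.natArr 8 (σ.natReg 6) = e) (hu : σ.natArr 0 e = u) (hv : σ.natArr 1 e = v) :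
    ((relaxStep F X B D).run σ).natReg 6 = σ.natReg 6 ∧
    Keeps {F, X} {D} σ ((relaxStep F X B D).run σ) ∧
    (((relaxStep F X B D).run σ).natArr F = σ.natArr F ∧
      ((relaxStep F X B D).run σ).natArr X = σ.natArr X ∧
      ((relaxStep F X B D).run σ).realArr D = σ.realArr D ∧
      (σ.natArr B e = 0 → σ.natArr F v ≠ 0 → σ.natArr F u ≠ 0 ∧
        σ.realArr D u ≤ σ.realArr 0 e + σ.realArr D v) ∨
    ((relaxStep F X B D).run σ).natArr F = Function.update (σ.natArr F) u 1 ∧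
      ((relaxStep F X B D).run σ).natArr X = Function.update (σ.natArr X) u e ∧
      ((relaxStep F X B D).run σ).realArr D =
        Function.update (σ.realArr D) u (σ.realArr 0 e + σ.realArr D v) ∧
      σ.natArr B e = 0 ∧ σ.natArr F v ≠ 0 ∧
      (σ.natArr F u ≠ 0 → σ.realArr 0 e + σ.realArr D v < σ.realArr D u)) := by
  have hr : ∀ x < 5, x ≠ 7 ∧ x ≠ 8 ∧ x ≠ 9 := by omega
  by_cases h : σ.natArr B e = 0 ∧ ¬ σ.natArr F v = 0 ∧ (¬ σ.natArr F u = 0 →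
      σ.realArr 0 e + σ.realArr D v < σ.realArr D u)
  · refine ⟨?_, ⟨?_, ?_, ?_, ?_⟩, .inr ⟨?_, ?_, ?_, h⟩⟩
    all_goals
      simp +contextual [relaxStep, Prog.block, Prog.run, he, hu, hv, h, hr, hFX, hFX.symm]
  · refine ⟨?_, ⟨?_, ?_, ?_, ?_⟩, .inl ⟨?_, ?_, ?_, ?_⟩⟩
    on_goal 9 =>
      intro h1 h2
      by_contra h3
      exact h ⟨h1, h2, fun h4 => not_le.1 fun h5 => h3 ⟨h4, h5⟩⟩
    all_goals
      simp +contextual [relaxStep, Prog.block, Prog.run, he, hu, hv, h, hr]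

/-- The state of the relaxation after the first `i` edges of the ordering `o`. -/
structure RelaxInv {n m : ℕ} (G : TaskGraph (Fin n) (Fin m)) (F X D : ℕ) (S : Fin m → Prop)
    (o : Fin m → Fin m) (i : ℕ) (σ : Store) : Prop where
  nonneg : ∀ u, 0 ≤ σ.realArr D u
  finish : storedDist σ F D G.t = 0
  le : ∀ j : Fin m, j < i → S (o j) →
    storedDist σ F D (G.src (o j)) ≤ G.cost (o j) + G.distOn S (G.tgt (o j)) G.t
  eq : ∀ u : Fin n, u ≠ G.t → σ.natArr F u = 0 ∨ ∃ j : Fin m, j < i ∧ S (o j) ∧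
    G.src (o j) = u ∧ σ.natArr X u = o j ∧
    storedDist σ F D u = G.cost (o j) + G.distOn S (G.tgt (o j)) G.t

/-- When all edges out of `v` have been relaxed, the two parts of the invariant are the two halves
of the Bellman equation. -/
theorem RelaxInv.storedDist_eq {n m : ℕ} {G : TaskGraph (Fin n) (Fin m)} {F X D : ℕ}
    {S : Fin m → Prop} {o : Fin m → Fin m} {i : ℕ} {σ : Store} (h : RelaxInv G F X D S o i σ)
    (v : Fin n) (hv : ∀ f, G.src f = v → ∃ j : Fin m, j < i ∧ o j = f) :
    storedDist σ F D v = G.distOn S v G.t := by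
  by_cases hvt : v = G.t
  · rw [hvt, h.finish, WGraph.distOn_self]
  · apply le_antisymm
    · refine WGraph.le_distOn hvt fun e he hs => ?_
      obtain ⟨j, hj, rfl⟩ := hv e hs
      rw [← hs]
      exact h.le j hj he
    · rcases h.eq v hvt with h1 | ⟨j, -, h2, h3, -, h4⟩
      · simp [storedDist, h1]
      · rw [h4, ← h3]
        exact WGraph.distOn_src_le h2

/-- By the choice of the ordering, all edges out of the target of `o i` came before, so its stored
distance is already final. One relaxation per edge therefore suffices. -/
theorem RelaxInv.step {n m : ℕ} {G : TaskGraph (Fin n) (Fin m)} {b : ℝ≥0} {k F X B D : ℕ}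
    (hFX : F ≠ X) {o : Fin m → Fin m} (i : Fin m) {σ : Store} (hσ : Encodes G b k σ)
    (hi : σ.natReg 6 = i) (ho : σ.natArr 8 i = o i)
    (hord : ∀ f, G.src f = G.tgt (o i) → ∃ j < i, o j = f)
    (h : RelaxInv G F X D (fun e => σ.natArr B e = 0) o i σ) :
    RelaxInv G F X D (fun e => σ.natArr B e = 0) o (i + 1) ((relaxStep F X B D).run σ) := by
  have hv := h.storedDist_eq (G.tgt (o i)) fun f hf => by
    obtain ⟨j, hj, hjf⟩ := hord f hf
    exact ⟨j, hj, hjf⟩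
  obtain ⟨-, -, hrun⟩ := relaxStep_run (B := B) (D := D) hFX σ (e := o i) (by rw [hi, ho])
    (hσ.src _) (hσ.tgt _)
  rw [hσ.cost] at hrun
  set σ' := (relaxStep F X B D).run σ
  have hadd : σ.natArr F (G.tgt (o i)) ≠ 0 → ENNReal.ofReal
      ((G.cost (o i) : ℝ) + σ.realArr D (G.tgt (o i))) = (G.cost (o i) : ℝ≥0∞) +
        G.distOn (fun e => σ.natArr B e = 0) (G.tgt (o i)) G.t := by
    intro h1
    rw [← hv, storedDist, if_neg h1, ENNReal.ofReal_add (NNReal.coe_nonneg _) (h.nonneg _),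
      ENNReal.ofReal_coe_nnreal]
  rcases hrun with ⟨h1, h2, h3, h4⟩ | ⟨h1, h2, h3, h4, h5, h6⟩
  · have hst : ∀ u, storedDist σ' F D u = storedDist σ F D u := by
      intro u; rw [storedDist, storedDist, h1, h3]
    refine ⟨fun u => h3 ▸ h.nonneg u, (hst _).trans h.finish, fun j hj hS => ?_, fun u hu => ?_⟩
    · rw [hst]
      rcases Nat.lt_succ_iff_lt_or_eq.1 hj with hj | hj
      · exact h.le j hj hS
      · obtain rfl := Fin.ext hj
        by_cases h5 : σ.natArr F (G.tgt (o j)) = 0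
        · rw [← hv, storedDist, storedDist, if_pos h5]; simp
        · obtain ⟨h6, h7⟩ := h4 hS h5
          rw [← hadd h5, storedDist, if_neg h6]
          exact ENNReal.ofReal_le_ofReal h7
    · rw [hst, h1, h2]
      exact (h.eq u hu).imp_right fun ⟨j, h5, h6⟩ => ⟨j, h5.trans (Nat.lt_succ_self _), h6⟩
  · have hu : storedDist σ' F D (G.src (o i)) = (G.cost (o i) : ℝ≥0∞) +
        G.distOn (fun e => σ.natArr B e = 0) (G.tgt (o i)) G.t := by
      rw [storedDist, h1, h3, Function.update_self, Function.update_self, if_neg one_ne_zero,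
        hadd h5]
    have hne : ∀ u : Fin n, u ≠ G.src (o i) → storedDist σ' F D u = storedDist σ F D u := by
      intro u hu
      have hu' : (u : ℕ) ≠ G.src (o i) := fun h => hu (Fin.ext h)
      rw [storedDist, storedDist, h1, h3, Function.update_of_ne hu', Function.update_of_ne hu']
    have hle : storedDist σ' F D (G.src (o i)) ≤ storedDist σ F D (G.src (o i)) := by
      rw [hu, ← hadd h5, storedDist]
      split_ifs with h7
      · exact le_top
      · exact ENNReal.ofReal_le_ofReal (h6 h7).le
    have hpos : 0 ≤ (G.cost (o i) : ℝ) + σ.realArr D (G.tgt (o i)) :=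
      add_nonneg (NNReal.coe_nonneg _) (h.nonneg _)
    -- The entry for `t` is zero and updates are strict improvements by nonnegative values, so it is
    -- never overwritten.
    have htne : G.t ≠ G.src (o i) := by
      intro ht
      have h7 := h.finish
      rw [ht, storedDist] at h7
      split_ifs at h7 with h8
      · exact ENNReal.top_ne_zero h7
      · have h9 := h6 h8
        rw [ENNReal.ofReal_eq_zero] at h7
        linarith
    refine ⟨fun u => ?_, (hne _ htne).trans h.finish, fun j hj hS => ?_, fun u hut => ?_⟩
    · rw [h3, Function.update_apply]
      split_ifs
      exacts [hpos, h.nonneg u]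
    · rcases Nat.lt_succ_iff_lt_or_eq.1 hj with hj | hj
      · refine le_trans ?_ (h.le j hj hS)
        by_cases h7 : G.src (o j) = G.src (o i)
        · rw [h7]; exact hle
        · rw [hne _ h7]
      · obtain rfl := Fin.ext hj
        exact hu.le
    · by_cases h7 : u = G.src (o i)
      · subst h7
        exact .inr ⟨i, Nat.lt_succ_self _, h4, rfl, by rw [h2, Function.update_self], hu⟩
      · have h8 : (u : ℕ) ≠ G.src (o i) := fun h => h7 (Fin.ext h)
        rw [hne u h7, h1, h2, Function.update_of_ne h8, Function.update_of_ne h8]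
        exact (h.eq u hut).imp_right fun ⟨j, h5, h6⟩ => ⟨j, h5.trans (Nat.lt_succ_self _), h6⟩

/-- The bounds on `F` and `X` protect the input arrays and the ordering in array 8; `B` differs from
both so that the set of usable edges is constant during the loop. -/
theorem relaxProg_spec {sub : Option Prog} {T : Store → Prop} {n m : ℕ}
    {G : TaskGraph (Fin n) (Fin m)} {b : ℝ≥0} {k F X B D : ℕ} (hFX : F ≠ X)
    (hF : 8 < F) (hX : 8 < X) (hBF : B ≠ F) (hBX : B ≠ X) (hD : D ≠ 0) {σ : Store}
    (hσ : Encodes G b k σ) (ho : HoldsOrder G σ) (hF0 : ∀ u, σ.natArr F u = 0)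
    (hD0 : ∀ u, σ.realArr D u = 0) :
    Spec sub T (relaxProg F X B D) σ (100 * (m + 1)) 0 0 fun σ' => Keeps {F, X} {D} σ σ' ∧
      (∀ u, 0 ≤ σ'.realArr D u) ∧ ∀ u : Fin n,
      storedDist σ' F D u = G.distOn (fun e => σ.natArr B e = 0) u G.t ∧
      (u ≠ G.t → σ'.natArr F u ≠ 0 → ∃ e : Fin m, σ'.natArr X u = e ∧ σ.natArr B e = 0 ∧
        G.src e = u ∧ G.distOn (fun e => σ.natArr B e = 0) u G.t =
          G.cost e + G.distOn (fun e => σ.natArr B e = 0) (G.tgt e) G.t) := by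
  obtain ⟨o, hsurj, ho, hord⟩ := ho
  have henc : ∀ σ', Keeps {F, X} {D} σ σ' → Encodes G b k σ' := fun σ' h =>
    hσ.of_keeps h (by simp; omega) (by simp; omega) (by simpa using hD.symm)
  have s1 : Spec sub T (.block [.putNat F (.reg 4) (.lit 1), .setNat 6 (.lit 0)]) σ 6 0 0
      fun σ' => σ'.natReg 6 = 0 ∧ Keeps {F, X} {D} σ σ' ∧
        RelaxInv G F X D (fun e => σ.natArr B e = 0) o 0 σ' := by
    refine Spec.of_run (by simp [Prog.block, Prog.Straight])
      ⟨by simp [Prog.block, Prog.run], ⟨?_, ?_, ?_, ?_⟩, ⟨?_, ?_, ?_, ?_⟩⟩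
    · simp +contextual [Prog.block, Prog.run]
      omega
    · simp [Prog.block, Prog.run]
    · simp +contextual [Prog.block, Prog.run]
    · simp +contextual [Prog.block, Prog.run]
    · simp [Prog.block, Prog.run, hD0]
    · simp [Prog.block, Prog.run, storedDist, hD0, hσ.finish]
    · simp
    · intro u hu
      have : (u : ℕ) ≠ G.t := fun h => hu (Fin.ext h)
      simp [Prog.block, Prog.run, hσ.finish, this, hF0]
  refine (s1.seq fun σ1 h1 => Spec.countUp (N := (relaxStep F X B D).size) (L := 0) (M := 0)
    (n := m) (fun i σ' => Keeps {F, X} {D} σ σ' ∧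
      RelaxInv G F X D (fun e => σ.natArr B e = 0) o i σ') ?_ (by norm_num) (Nat.zero_le _) h1.1
    ((h1.2.1.natReg 1 (by norm_num)).trans hσ.card_edges) h1.2).mono ?_ (by omega) (by omega) ?_
  · rintro i σ' hi ⟨h2, h3⟩ h4 h5
    have henc' := henc σ' h2
    have h8 : σ'.natArr 8 i = o ⟨i, hi⟩ := by
      rw [h2.natArr 8 (by simp; omega)]
      exact ho ⟨i, hi⟩
    have hB : σ'.natArr B = σ.natArr B := h2.natArr B (by simp [hBF, hBX])
    obtain ⟨g1, g2, -⟩ := relaxStep_run (B := B) (D := D) hFX σ' (e := o ⟨i, hi⟩) (by rw [h4, h8])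
      (henc'.src _) (henc'.tgt _)
    refine Spec.of_run (by simp [relaxStep, Prog.block, Prog.Straight]) ⟨g1.trans h4,
      (g2.natReg 1 (by norm_num)).trans h5, (h2.trans g2).setNat (by norm_num) _, ?_⟩
    have := RelaxInv.step (B := B) hFX ⟨i, hi⟩ henc' h4 h8 (hord _) (by rwa [hB])
    rw [hB] at this
    exact ⟨this.nonneg, this.finish, this.le, this.eq⟩
  · simp only [relaxStep, Prog.block, Prog.size, NExp.ops, RExp.ops, BExp.ops]
    omega
  · rintro σ' ⟨-, h2, h3⟩
    refine ⟨h2, h3.nonneg, fun u => ?_⟩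
    have key := h3.storedDist_eq u fun f _ => by
      obtain ⟨j, rfl⟩ := hsurj f
      exact ⟨j, j.2, rfl⟩
    refine ⟨key, fun hut hfin => ?_⟩
    rcases h3.eq u hut with h4 | ⟨j, -, h5, h6, h7, h8⟩
    · exact (hfin h4).elim
    · exact ⟨o j, h7, h5, h6, key.symm.trans h8⟩

end Chunking

namespace Chunking

/-! ## Ordering the edges -/

/-- Entering the edge in the natural register 6 into the linked list of its target, and counting it
for its source. -/
def enterEdge : Prog :=
  .block [
    .setNat 8 (.arr 0 (.reg 6)),
    .setNat 9 (.arr 1 (.reg 6)),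
    .putNat 4 (.reg 8) (.add (.arr 4 (.reg 8)) (.lit 1)),
    .putNat 6 (.reg 6) (.arr 5 (.reg 9)),
    .putNat 5 (.reg 9) (.add (.reg 6) (.lit 1))]

/-- Entering the vertex in the natural register 6 into the queue if no edge leaves it. -/
def enterSink : Prog :=
  .cond (.nle (.arr 4 (.reg 6)) (.lit 0))
    (.seq (.putNat 7 (.reg 10) (.reg 6)) (.setNat 10 (.add (.reg 10) (.lit 1)))) .skip

/-- Appending the current edge to the ordering. If all edges out of its source are in the ordering,
this source enters the queue. -/
def takeEdge : Prog :=
  .block [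
    .setNat 7 (.sub (.reg 12) (.lit 1)),
    .setNat 8 (.arr 0 (.reg 7)),
    .putNat 8 (.reg 13) (.reg 7),
    .setNat 13 (.add (.reg 13) (.lit 1)),
    .setNat 12 (.arr 6 (.reg 7)),
    .putNat 4 (.reg 8) (.sub (.arr 4 (.reg 8)) (.lit 1)),
    .cond (.nle (.arr 4 (.reg 8)) (.lit 0))
      (.seq (.putNat 7 (.reg 10) (.reg 8)) (.setNat 10 (.add (.reg 10) (.lit 1)))) .skip]

/-- Turning to the edges into the next vertex of the queue. -/
def popVertex : Prog :=
  .block [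
    .setNat 9 (.arr 7 (.reg 11)),
    .setNat 11 (.add (.reg 11) (.lit 1)),
    .setNat 12 (.arr 5 (.reg 9))]

/-- The ordering of the edges, from the sinks of the graph backwards. -/
def orderProg : Prog :=
  .seq (.countUp 6 1 enterEdge) (.seq (.setNat 6 (.lit 0)) (.seq (.countUp 6 0 enterSink)
    (.loop (.not (.and (.nle (.reg 12) (.lit 0)) (.nle (.reg 10) (.reg 11))))
      (.cond (.nle (.reg 12) (.lit 0)) popVertex takeEdge))))

/-- Starting with the entry `c`, a linked list holds the edges `l`; an edge `e` is entered as
`e + 1`, and 0 is the end of the list. -/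
def Linked {m : ℕ} (next : ℕ → ℕ) : ℕ → List (Fin m) → Prop
  | c, [] => c = 0
  | c, e :: l => c = e + 1 ∧ Linked next (next e) l

theorem Linked.congr {m : ℕ} {next next' : ℕ → ℕ} {l : List (Fin m)} {c : ℕ}
    (h : Linked next c l) (hn : ∀ e ∈ l, next' e = next e) : Linked next' c l := by
  induction l generalizing c with
  | nil => exact h
  | cons e l ih =>
    refine ⟨h.1, ?_⟩
    rw [hn e List.mem_cons_self]
    exact ih h.2 fun f hf => hn f (List.mem_cons_of_mem _ hf)

/-- The linked lists hold the edges into each vertex among the edges in `S`. -/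
def HoldsInEdges {n m : ℕ} (G : TaskGraph (Fin n) (Fin m)) (S : Fin m → Prop) (σ : Store) :
    Prop :=
  ∀ v : Fin n, ∃ l : List (Fin m), l.Nodup ∧ Linked (σ.natArr 6) (σ.natArr 5 v) l ∧
    ∀ e, e ∈ l ↔ S e ∧ G.tgt e = v

/-- The natural array 4 counts the edges in `S` out of each vertex. -/
def HoldsOutDegrees {n m : ℕ} (G : TaskGraph (Fin n) (Fin m)) (S : Fin m → Prop) (σ : Store) :
    Prop :=
  ∀ u : Fin n, σ.natArr 4 u = {e | S e ∧ G.src e = u}.ncard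

theorem takeEdge_run (σ : Store) {e u : ℕ} (he : σ.natReg 12 = e + 1) (hu : σ.natArr 0 e = u) :
    Keeps {4, 7, 8} ∅ σ (takeEdge.run σ) ∧
    (takeEdge.run σ).natReg 13 = σ.natReg 13 + 1 ∧
    (takeEdge.run σ).natReg 11 = σ.natReg 11 ∧
    (takeEdge.run σ).natReg 12 = σ.natArr 6 e ∧
    (takeEdge.run σ).natArr 8 = Function.update (σ.natArr 8) (σ.natReg 13) e ∧
    (takeEdge.run σ).natArr 4 = Function.update (σ.natArr 4) u (σ.natArr 4 u - 1) ∧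
    (σ.natArr 4 u - 1 = 0 → (takeEdge.run σ).natReg 10 = σ.natReg 10 + 1 ∧
      (takeEdge.run σ).natArr 7 = Function.update (σ.natArr 7) (σ.natReg 10) u) ∧
    (σ.natArr 4 u - 1 ≠ 0 → (takeEdge.run σ).natReg 10 = σ.natReg 10 ∧
      (takeEdge.run σ).natArr 7 = σ.natArr 7) := by
  have hr : ∀ x < 5, x ≠ 7 ∧ x ≠ 8 ∧ x ≠ 10 ∧ x ≠ 12 ∧ x ≠ 13 := by omega
  by_cases h : σ.natArr 4 u - 1 = 0
  · refine ⟨⟨?_, ?_, ?_, ?_⟩, ?_, ?_, ?_, ?_, ?_, ?_, fun h' => (h' h).elim⟩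
    all_goals simp +contextual [takeEdge, Prog.block, Prog.run, he, hu, h, hr]
  · refine ⟨⟨?_, ?_, ?_, ?_⟩, ?_, ?_, ?_, ?_, ?_, fun h' => (h h').elim, ?_⟩
    all_goals simp +contextual [takeEdge, Prog.block, Prog.run, he, hu, h, hr]

theorem popVertex_run (σ : Store) :
    Keeps {4, 7, 8} ∅ σ (popVertex.run σ) ∧
    (popVertex.run σ).natArr = σ.natArr ∧
    (popVertex.run σ).natReg 13 = σ.natReg 13 ∧
    (popVertex.run σ).natReg 10 = σ.natReg 10 ∧
    (popVertex.run σ).natReg 11 = σ.natReg 11 + 1 ∧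
    (popVertex.run σ).natReg 12 = σ.natArr 5 (σ.natArr 7 (σ.natReg 11)) := by
  have hr : ∀ x < 5, x ≠ 9 ∧ x ≠ 11 ∧ x ≠ 12 := by omega
  refine ⟨⟨?_, ?_, ?_, ?_⟩, ?_, ?_, ?_, ?_, ?_⟩
  all_goals simp +contextual [popVertex, Prog.block, Prog.run, hr]

/-- A list stored in a natural array from position 0 on. -/
def HoldsList {n : ℕ} (f : ℕ → ℕ) (l : List (Fin n)) : Prop :=
  ∀ i (h : i < l.length), f i = l[i]

theorem HoldsList.append {n : ℕ} {f : ℕ → ℕ} {l : List (Fin n)} (h : HoldsList f l) (x : Fin n) :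
    HoldsList (Function.update f l.length x) (l ++ [x]) := by
  intro i hi
  by_cases hil : i = l.length
  · subst hil; simp
  · have : i < l.length := by
      rw [List.length_append, List.length_singleton] at hi; omega
    rw [Function.update_of_ne hil, List.getElem_append_left this]
    exact h i this

/-- The state of the main loop: the edges `d` are ordered, the vertices `Qp` have left the queue,
the vertices `Qr` are in it, and the edges `r` into the last vertex taken are still to come. -/
structure OrderInv {n m : ℕ} (G : TaskGraph (Fin n) (Fin m)) (d : List (Fin m))
    (Qp Qr : List (Fin n)) (r : List (Fin m)) (σ : Store) : Prop where
  lists : HoldsInEdges G (fun _ => True) σ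
  degrees : HoldsOutDegrees G (fun e => e ∉ d) σ
  ordLength : σ.natReg 13 = d.length
  ord : HoldsList (σ.natArr 8) d
  nodup : d.Nodup
  order : ∀ i (h : i < d.length) f, G.src f = G.tgt d[i] → f ∈ d.take i
  queueLength : σ.natReg 10 = (Qp ++ Qr).length
  queue : HoldsList (σ.natArr 7) (Qp ++ Qr)
  queueNodup : (Qp ++ Qr).Nodup
  popped : σ.natReg 11 = Qp.length
  mem_queue : ∀ u, u ∈ Qp ++ Qr ↔ ∀ f, G.src f = u → f ∈ d
  linked : Linked (σ.natArr 6) (σ.natReg 12) r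
  restNodup : r.Nodup
  mem_done : ∀ e, e ∈ d ↔ G.tgt e ∈ Qp ∧ e ∉ r
  mem_rest : ∀ e ∈ r, G.tgt e ∈ Qp

/-- The target of `e` has been popped, so all edges out of it are ordered already and `e` may come
next. The source of `e` enters the queue exactly when its counter reaches zero. -/
theorem OrderInv.take {n m : ℕ} {G : TaskGraph (Fin n) (Fin m)} {b : ℝ≥0} {k : ℕ}
    {d : List (Fin m)} {Qp Qr : List (Fin n)} {e : Fin m} {r : List (Fin m)} {σ : Store}
    (hσ : Encodes G b k σ) (h : OrderInv G d Qp Qr (e :: r) σ) :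
    ∃ Qr', OrderInv G (d ++ [e]) Qp Qr' r (takeEdge.run σ) := by
  obtain ⟨hcur, hlink⟩ := h.linked
  obtain ⟨g1, g2, g3, g4, g5, g6, g7, g8⟩ := takeEdge_run σ hcur (hσ.src e)
  set σ' := takeEdge.run σ
  have hed : e ∉ d := fun hd => ((h.mem_done e).1 hd).2 List.mem_cons_self
  have her : e ∉ r := (List.nodup_cons.1 h.restNodup).1
  have hset : ∀ u, {f | f ∉ d ++ [e] ∧ G.src f = u} = {f | f ∉ d ∧ G.src f = u} \ {e} := by
    intro u
    ext f
    simp only [List.mem_append, List.mem_singleton, Set.mem_ofPred_eq, Set.mem_sdiff,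
      Set.mem_singleton_iff]
    tauto
  have hdeg : HoldsOutDegrees G (fun f => f ∉ d ++ [e]) σ' := by
    intro u
    rw [hset, g6]
    by_cases hu : G.src e = u
    · subst hu
      have he : e ∈ {f | f ∉ d ∧ G.src f = G.src e} := ⟨hed, rfl⟩
      rw [Function.update_self, h.degrees, Set.ncard_sdiff_singleton_of_mem he]
    · have hu' : (u : ℕ) ≠ G.src e := fun h => hu (Fin.ext h).symm
      rw [Function.update_of_ne hu', h.degrees, Set.sdiff_singleton_eq_self fun h => hu h.2]
  -- A zero counter means that no edge out of this vertex is still missing.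
  have hzero : σ.natArr 4 (G.src e) - 1 = 0 ↔ ∀ f, G.src f = G.src e → f ∈ d ++ [e] := by
    have h1 := hdeg (G.src e)
    rw [g6, Function.update_self] at h1
    rw [h1, Set.ncard_eq_zero, Set.eq_empty_iff_forall_notMem]
    refine forall_congr' fun f => ?_
    simp only [Set.mem_ofPred_eq, not_and]
    tauto
  have hsrc : G.src e ∉ Qp ++ Qr := fun h1 => hed ((h.mem_queue _).1 h1 e rfl)
  have hother : ∀ u, u ≠ G.src e →
      (u ∈ Qp ++ Qr ↔ ∀ f, G.src f = u → f ∈ d ++ [e]) := by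
    intro u hu
    rw [h.mem_queue]
    refine forall_congr' fun f => imp_congr_right fun hf => ?_
    rw [List.mem_append, List.mem_singleton]
    exact ⟨.inl, fun h1 => h1.resolve_right fun h2 => hu (by rw [← hf, h2])⟩
  have base : ∀ Qr' : List (Fin n), σ'.natReg 10 = (Qp ++ Qr').length →
      HoldsList (σ'.natArr 7) (Qp ++ Qr') → (Qp ++ Qr').Nodup →
      (∀ u, u ∈ Qp ++ Qr' ↔ ∀ f, G.src f = u → f ∈ d ++ [e]) →
      OrderInv G (d ++ [e]) Qp Qr' r σ' := by
    intro Qr' q1 q2 q3 q4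
    have a5 : σ'.natArr 5 = σ.natArr 5 := g1.natArr 5 (by simp)
    have a6 : σ'.natArr 6 = σ.natArr 6 := g1.natArr 6 (by simp)
    refine ⟨?_, hdeg, by simp [g2, h.ordLength], ?_, ?_, ?_, q1, q2, q3, g3.trans h.popped, q4,
      ?_, (List.nodup_cons.1 h.restNodup).2, ?_, fun f hf => h.mem_rest f (List.mem_cons_of_mem _ hf)⟩
    · intro v
      rw [a5, a6]
      exact h.lists v
    · rw [g5, h.ordLength]
      exact h.ord.append e
    · exact h.nodup.append (by simp) (by simpa using hed)
    · intro i hi f hf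
      by_cases hid : i < d.length
      · rw [List.getElem_append_left hid] at hf
        rw [List.take_append_of_le_length hid.le]
        exact h.order i hid f hf
      · obtain rfl : i = d.length := by
          rw [List.length_append, List.length_singleton] at hi; omega
        rw [List.take_left']
        · rw [List.getElem_concat_length rfl] at hf
          have h1 := h.mem_rest e List.mem_cons_self
          exact (h.mem_queue _).1 (List.mem_append_left _ h1) f hf
        · rfl
    · rw [a6, g4]
      exact hlink
    · intro f
      rw [List.mem_append, List.mem_singleton, h.mem_done, List.mem_cons]
      constructor
      · rintro (⟨h1, h2⟩ | rfl)
        · exact ⟨h1, fun h3 => h2 (.inr h3)⟩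
        · exact ⟨h.mem_rest f List.mem_cons_self, her⟩
      · rintro ⟨h1, h2⟩
        by_cases hfe : f = e
        · exact .inr hfe
        · exact .inl ⟨h1, fun h3 => h3.elim hfe h2⟩
  by_cases h0 : σ.natArr 4 (G.src e) - 1 = 0
  · obtain ⟨q1, q2⟩ := g7 h0
    refine ⟨Qr ++ [G.src e], base _ ?_ ?_ ?_ ?_⟩ <;> rw [← List.append_assoc]
    · rw [q1, h.queueLength]
      simp only [List.length_append, List.length_singleton]
    · rw [q2, h.queueLength]
      exact h.queue.append _
    · exact h.queueNodup.append (by simp) (by simpa using hsrc)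
    · intro u
      by_cases hu : u = G.src e
      · subst hu
        simpa using hzero.1 h0
      · rw [← hother u hu, List.mem_append (s := Qp ++ Qr), List.mem_singleton]
        exact or_iff_left hu
  · obtain ⟨q1, q2⟩ := g8 h0
    refine ⟨Qr, base _ ?_ ?_ h.queueNodup ?_⟩
    · rw [q1, h.queueLength]
    · rw [q2]; exact h.queue
    · intro u
      by_cases hu : u = G.src e
      · subst hu
        exact iff_of_false hsrc fun h1 => h0 (hzero.2 h1)
      · exact hother u hu

/-- No edge into `v` is ordered before `v` is popped, so the whole linked list of `v` becomes the
new rest. -/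
theorem OrderInv.pop {n m : ℕ} {G : TaskGraph (Fin n) (Fin m)} {d : List (Fin m)}
    {Qp Qr : List (Fin n)} {v : Fin n} {σ : Store} (h : OrderInv G d Qp (v :: Qr) [] σ) :
    ∃ r, OrderInv G d (Qp ++ [v]) Qr r (popVertex.run σ) := by
  obtain ⟨g1, g2, g3, g4, g5, g6⟩ := popVertex_run σ
  set σ' := popVertex.run σ
  obtain ⟨l, hl1, hl2, hl3⟩ := h.lists v
  have hv : σ.natArr 7 (σ.natReg 11) = v := by
    rw [h.popped, h.queue Qp.length (by simp)]
    simp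
  have hQ : Qp ++ [v] ++ Qr = Qp ++ v :: Qr := by simp
  have hvQ : v ∉ Qp := fun h1 => (List.nodup_append.1 h.queueNodup).2.2 v h1 v
    List.mem_cons_self rfl
  refine ⟨l, ?_, ?_, g3.trans h.ordLength, ?_, h.nodup, h.order, ?_, ?_, ?_, ?_, ?_, ?_, hl1, ?_, ?_⟩
  · intro u; rw [g2]; exact h.lists u
  · intro u; rw [g2]; exact h.degrees u
  · rw [g2]; exact h.ord
  · rw [hQ, g4, h.queueLength]
  · rw [hQ, g2]; exact h.queue
  · rw [hQ]; exact h.queueNodup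
  · rw [g5, h.popped]; simp
  · rw [hQ]; exact h.mem_queue
  · rw [g2, g6, hv]; exact hl2
  · intro e
    rw [h.mem_done, hl3, List.mem_append, List.mem_singleton]
    constructor
    · rintro ⟨h1, -⟩
      exact ⟨.inl h1, fun h2 => hvQ (h2.2 ▸ h1)⟩
    · rintro ⟨h1 | h1, h2⟩
      · exact ⟨h1, by simp⟩
      · exact (h2 ⟨trivial, h1⟩).elim
  · intro e he
    rw [((hl3 e).1 he).2]
    simp

/-- When the queue is exhausted, all edges are ordered. -/
theorem OrderInv.holdsOrder {n m : ℕ} {G : TaskGraph (Fin n) (Fin m)} {d : List (Fin m)}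
    {Qp : List (Fin n)} {σ : Store} (h : OrderInv G d Qp [] [] σ) : HoldsOrder G σ := by
  -- Induction from the sinks backwards: if all successors of `u` have been popped, all edges out of
  -- `u` are ordered, so `u` has been in the queue.
  have hall : ∀ u, u ∈ Qp := by
    intro u
    induction u using G.wellFounded_succ.induction with
    | _ u ih =>
      have := h.mem_queue u
      rw [List.append_nil] at this
      refine this.2 fun f hf => (h.mem_done f).2 ⟨ih _ ⟨f, hf, rfl⟩, by simp⟩
  have hmem : ∀ e, e ∈ d := fun e => (h.mem_done e).2 ⟨hall _, by simp⟩
  -- The list has no repetitions and contains every edge, so it can be read as a surjection from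
  -- `Fin m`.
  have hlen : d.length = m := by
    rw [← List.toFinset_card_of_nodup h.nodup, (Finset.eq_univ_iff_forall (s := d.toFinset)).2
      (by simpa using hmem), Finset.card_univ, Fintype.card_fin]
  refine ⟨fun i => d[i], fun e => ?_, fun i => h.ord i _, fun i f hf => ?_⟩
  · obtain ⟨i, hi, rfl⟩ := List.mem_iff_getElem.1 (hmem e)
    exact ⟨⟨i, hlen ▸ hi⟩, rfl⟩
  · obtain ⟨j, hj, hjf⟩ := List.mem_take_iff_getElem.1 (h.order i (hlen.symm ▸ i.2) f hf)
    exact ⟨⟨j, by omega⟩, Fin.lt_def.2 (by simp only; omega), hjf⟩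

/-! ### Building the linked lists, the out-degrees and the initial queue -/

theorem enterEdge_run (σ : Store) {e u v : ℕ} (he : σ.natReg 6 = e) (hu : σ.natArr 0 e = u)
    (hv : σ.natArr 1 e = v) :
    Keeps {4, 5, 6, 7, 8} ∅ σ (enterEdge.run σ) ∧
    (enterEdge.run σ).natArr 4 = Function.update (σ.natArr 4) u (σ.natArr 4 u + 1) ∧
    (enterEdge.run σ).natArr 6 = Function.update (σ.natArr 6) e (σ.natArr 5 v) ∧
    (enterEdge.run σ).natArr 5 = Function.update (σ.natArr 5) v (e + 1) ∧
    ∀ x, x ≠ 8 → x ≠ 9 → (enterEdge.run σ).natReg x = σ.natReg x := by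
  have hr : ∀ x < 5, x ≠ 8 ∧ x ≠ 9 := by omega
  refine ⟨⟨?_, ?_, ?_, ?_⟩, ?_, ?_, ?_, ?_⟩
  all_goals simp +contextual [enterEdge, Prog.block, Prog.run, hr, he, hu, hv]

theorem HoldsOutDegrees.enterEdge {n m : ℕ} {G : TaskGraph (Fin n) (Fin m)} {b : ℝ≥0} {k : ℕ}
    {σ : Store} (hσ : Encodes G b k σ) {i : Fin m} (hi : σ.natReg 6 = i)
    (h : HoldsOutDegrees G (fun e => (e : ℕ) < i) σ) :
    HoldsOutDegrees G (fun e => (e : ℕ) < i + 1) (enterEdge.run σ) := by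
  obtain ⟨-, g, -⟩ := enterEdge_run σ hi (hσ.src i) (hσ.tgt i)
  intro u
  rw [g]
  by_cases hu : G.src i = u
  · subst hu
    have : {e : Fin m | (e : ℕ) < i + 1 ∧ G.src e = G.src i} =
        insert i {e : Fin m | (e : ℕ) < i ∧ G.src e = G.src i} := by
      ext e
      simp only [Set.mem_ofPred_eq, Set.mem_insert_iff, Nat.lt_succ_iff_lt_or_eq, ← Fin.ext_iff]
      constructor
      · tauto
      · rintro (rfl | h1)
        exacts [⟨.inr rfl, rfl⟩, ⟨.inl h1.1, h1.2⟩]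
    rw [Function.update_self, h, this,
      Set.ncard_insert_of_notMem fun h => lt_irrefl _ (h.1 : (i : ℕ) < i)]
  · have hu' : (u : ℕ) ≠ G.src i := fun h => hu (Fin.ext h).symm
    rw [Function.update_of_ne hu', h]
    congr 1
    ext e
    simp only [Set.mem_ofPred_eq, Nat.lt_succ_iff_lt_or_eq, ← Fin.ext_iff]
    constructor
    · tauto
    · rintro ⟨h1 | rfl, h2⟩
      exacts [⟨h1, h2⟩, (hu h2).elim]

theorem HoldsInEdges.enterEdge {n m : ℕ} {G : TaskGraph (Fin n) (Fin m)} {b : ℝ≥0} {k : ℕ}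
    {σ : Store} (hσ : Encodes G b k σ) {i : Fin m} (hi : σ.natReg 6 = i)
    (h : HoldsInEdges G (fun e => (e : ℕ) < i) σ) :
    HoldsInEdges G (fun e => (e : ℕ) < i + 1) (enterEdge.run σ) := by
  obtain ⟨-, -, g6, g5, -⟩ := enterEdge_run σ hi (hσ.src i) (hσ.tgt i)
  intro v
  obtain ⟨l, h1, h2, h3⟩ := h v
  rw [g6, g5]
  have hil : i ∉ l := fun hil => lt_irrefl _ ((h3 i).1 hil).1
  have h2' : Linked (Function.update (σ.natArr 6) i (σ.natArr 5 (G.tgt i))) (σ.natArr 5 v) l := by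
    refine h2.congr fun e he => Function.update_of_ne (fun h => hil ?_) _ _
    rwa [← Fin.ext h]
  by_cases hv : G.tgt i = v
  · subst hv
    refine ⟨i :: l, List.nodup_cons.2 ⟨hil, h1⟩, ⟨Function.update_self .., ?_⟩, fun e => ?_⟩
    · rw [Function.update_self]
      exact h2'
    · simp only [List.mem_cons, h3, Nat.lt_succ_iff_lt_or_eq, ← Fin.ext_iff]
      constructor
      · rintro (rfl | h4)
        exacts [⟨.inr rfl, rfl⟩, ⟨.inl h4.1, h4.2⟩]
      · tauto
  · have hv' : (v : ℕ) ≠ G.tgt i := fun h => hv (Fin.ext h).symm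
    refine ⟨l, h1, by rwa [Function.update_of_ne hv'], fun e => ?_⟩
    simp only [h3, Nat.lt_succ_iff_lt_or_eq, ← Fin.ext_iff]
    constructor
    · tauto
    · rintro ⟨h1 | rfl, h2⟩
      exacts [⟨h1, h2⟩, (hv h2).elim]

theorem enterSink_run (σ : Store) {v : ℕ} (hv : σ.natReg 6 = v) :
    Keeps {4, 5, 6, 7, 8} ∅ σ (enterSink.run σ) ∧
    (∀ a, a ≠ 7 → (enterSink.run σ).natArr a = σ.natArr a) ∧
    (∀ x, x ≠ 10 → (enterSink.run σ).natReg x = σ.natReg x) ∧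
    (σ.natArr 4 v = 0 → (enterSink.run σ).natReg 10 = σ.natReg 10 + 1 ∧
      (enterSink.run σ).natArr 7 = Function.update (σ.natArr 7) (σ.natReg 10) v) ∧
    (σ.natArr 4 v ≠ 0 → (enterSink.run σ).natReg 10 = σ.natReg 10 ∧
      (enterSink.run σ).natArr 7 = σ.natArr 7) := by
  have hr : ∀ x < 5, x ≠ 10 := by omega
  by_cases h : σ.natArr 4 v = 0
  · refine ⟨⟨?_, ?_, ?_, ?_⟩, ?_, ?_, ?_, fun h' => (h' h).elim⟩
    all_goals simp +contextual [enterSink, Prog.run, hv, h, hr]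
  · refine ⟨⟨?_, ?_, ?_, ?_⟩, ?_, ?_, fun h' => (h h').elim, ?_⟩
    all_goals simp +contextual [enterSink, Prog.run, hv, h]

/-- The first `i` vertices that no edge leaves are in the queue. -/
def HoldsSinks {n m : ℕ} (G : TaskGraph (Fin n) (Fin m)) (i : ℕ) (σ : Store) : Prop :=
  ∃ Q : List (Fin n), σ.natReg 10 = Q.length ∧ HoldsList (σ.natArr 7) Q ∧ Q.Nodup ∧
    ∀ u : Fin n, u ∈ Q ↔ (u : ℕ) < i ∧ ∀ f, G.src f ≠ u

theorem HoldsSinks.enterSink {n m : ℕ} {G : TaskGraph (Fin n) (Fin m)} {σ : Store} {i : Fin n}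
    (hi : σ.natReg 6 = i) (hd : HoldsOutDegrees G (fun _ => True) σ) (h : HoldsSinks G i σ) :
    HoldsSinks G (i + 1) (enterSink.run σ) := by
  obtain ⟨-, -, -, g1, g2⟩ := enterSink_run σ hi
  obtain ⟨Q, h1, h2, h3, h4⟩ := h
  have hzero : σ.natArr 4 i = 0 ↔ ∀ f, G.src f ≠ i := by
    rw [hd, Set.ncard_eq_zero, Set.eq_empty_iff_forall_notMem]
    simp
  by_cases h0 : σ.natArr 4 i = 0
  · obtain ⟨g1, g2⟩ := g1 h0
    refine ⟨Q ++ [i], by rw [g1, h1]; simp, ?_, ?_, fun u => ?_⟩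
    · rw [g2, h1]; exact h2.append i
    · exact h3.append (by simp) (by simp [h4])
    · rw [List.mem_append, List.mem_singleton, h4, Nat.lt_succ_iff_lt_or_eq, ← Fin.ext_iff]
      constructor
      · rintro (h5 | rfl)
        exacts [⟨.inl h5.1, h5.2⟩, ⟨.inr rfl, hzero.1 h0⟩]
      · tauto
  · obtain ⟨g1, g2⟩ := g2 h0
    refine ⟨Q, g1.trans h1, by rwa [g2], h3, fun u => ?_⟩
    rw [h4, Nat.lt_succ_iff_lt_or_eq, ← Fin.ext_iff]
    constructor
    · tauto
    · rintro ⟨h5 | rfl, h6⟩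
      exacts [⟨h5, h6⟩, (h0 (hzero.2 h6)).elim]

/-- Each iteration either orders a further edge or pops a further vertex. Both happen without
repetition, so there are at most `m + n` iterations. -/
theorem orderLoop_spec {sub : Option Prog} {T : Store → Prop} {n m : ℕ}
    {G : TaskGraph (Fin n) (Fin m)} {b : ℝ≥0} {k : ℕ} {σ : Store} (hσ : Encodes G b k σ)
    {Q : List (Fin n)} (h : OrderInv G [] [] Q [] σ) :
    Spec sub T (.loop (.not (.and (.nle (.reg 12) (.lit 0)) (.nle (.reg 10) (.reg 11))))
      (.cond (.nle (.reg 12) (.lit 0)) popVertex takeEdge)) σ (100 * (m + n + 1)) 0 0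
      fun σ' => Keeps {4, 5, 6, 7, 8} ∅ σ σ' ∧ HoldsOrder G σ' := by
  refine (Spec.loop (N := 60) (L := 0) (M := 0) (fun j σ' => Keeps {4, 5, 6, 7, 8} ∅ σ σ' ∧
    ∃ d Qp Qr r, OrderInv G d Qp Qr r σ' ∧ j = (m - d.length) + (n - Qp.length)) ?_ (m + n)
    ⟨.refl σ, [], [], Q, [], h, rfl⟩).mono ?_ (by omega) (by omega) ?_
  · rintro j σ' ⟨h1, d, Qp, Qr, r, h2, rfl⟩ hq
    have henc := hσ.of_keeps h1 (by simp) (by simp) (by simp)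
    have hQlen : (Qp ++ Qr).length ≤ n := by
      simpa using h2.queueNodup.length_le_card
    rw [List.length_append] at hQlen
    simp only [BExp.holds, NExp.eval, not_and] at hq
    refine (Spec.cond (N := 50) (L := 0) (M := 0) (fun hc => ?_) (fun hc => ?_)).mono
      (by simp [BExp.ops, NExp.ops]) le_rfl le_rfl fun _ h => h
    · have hr : r = [] := by
        cases r with
        | nil => rfl
        | cons e r =>
          have := h2.linked.1
          simp only [BExp.holds, NExp.eval] at hc
          omega
      subst hr
      have hlt := hq hc
      rw [h2.queueLength, h2.popped, List.length_append] at hlt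
      cases Qr with
      | nil => simp at hlt
      | cons v Qr =>
        obtain ⟨r, hr⟩ := h2.pop
        refine (Spec.of_run (by simp [popVertex, Prog.block, Prog.Straight]) ⟨_, ?_,
          h1.trans ((popVertex_run σ').1.mono (by decide) (by simp)), d, Qp ++ [v], Qr, r, hr,
          rfl⟩).mono (by simp [popVertex, Prog.block, Prog.size, NExp.ops]) le_rfl le_rfl
          fun _ h => h
        simp only [List.length_append, List.length_cons] at hQlen ⊢
        omega
    · cases r with
      | nil =>
        have := h2.linked
        simp only [BExp.holds, NExp.eval] at hc
        simp only [Linked] at this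
        omega
      | cons e r =>
        obtain ⟨Qr', hr⟩ := h2.take henc
        have hdlen : (d ++ [e]).length ≤ m := by
          simpa using hr.nodup.length_le_card
        refine (Spec.of_run (by simp [takeEdge, Prog.block, Prog.Straight]) ⟨_, ?_,
          h1.trans ((takeEdge_run σ' h2.linked.1 (henc.src e)).1.mono (by decide) (by simp)),
          d ++ [e], Qp, Qr', r, hr, rfl⟩).mono
          (by simp [takeEdge, Prog.block, Prog.size, NExp.ops, BExp.ops]) le_rfl le_rfl fun _ h => h
        simp only [List.length_append, List.length_singleton] at hdlen ⊢
        omega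
  · simp only [BExp.ops, NExp.ops]
    omega
  · rintro σ' ⟨hq, j, h1, d, Qp, Qr, r, h2, -⟩
    simp only [BExp.holds, NExp.eval, not_not] at hq
    refine ⟨h1, ?_⟩
    have hr : r = [] := by
      cases r with
      | nil => rfl
      | cons e r =>
        have := h2.linked.1
        omega
    have hQ : Qr = [] := by
      have := hq.2
      rw [h2.queueLength, h2.popped, List.length_append] at this
      exact List.length_eq_zero_iff.1 (by omega)
    subst hr hQ
    exact h2.holdsOrder

/-- The counter, the ends of the queue, the list cursor and the length of the ordering are used
without initialization, which is why the memory has to start with zeros. -/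
theorem orderProg_spec {sub : Option Prog} {T : Store → Prop} {n m : ℕ}
    {G : TaskGraph (Fin n) (Fin m)} {b : ℝ≥0} {k : ℕ} {σ : Store} (hσ : Encodes G b k σ)
    (hreg : ∀ x, 5 < x → σ.natReg x = 0) (h4 : ∀ i, σ.natArr 4 i = 0)
    (h5 : ∀ i, σ.natArr 5 i = 0) :
    Spec sub T orderProg σ (200 * (m + n + 1)) 0 0
      fun σ' => Keeps {4, 5, 6, 7, 8} ∅ σ σ' ∧ HoldsOrder G σ' := by
  let R : Store → Prop := fun σ' => Keeps {4, 5, 6, 7, 8} ∅ σ σ' ∧ ∀ x, 10 < x → σ'.natReg x = 0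
  have henc : ∀ σ', Keeps {4, 5, 6, 7, 8} ∅ σ σ' → Encodes G b k σ' :=
    fun σ' h => hσ.of_keeps h (by simp) (by simp) (by simp)
  have s1 : Spec sub T (.countUp 6 1 enterEdge) σ ((enterEdge.size + 9) * (m - 0) + 5)
      (0 * (m - 0)) (0 * (m - 0)) fun σ' => σ'.natReg 1 = m ∧ R σ' ∧ σ'.natReg 10 = 0 ∧
        HoldsOutDegrees G (fun e => (e : ℕ) < m) σ' ∧ HoldsInEdges G (fun e => (e : ℕ) < m) σ' := by
    refine Spec.countUp (fun i σ' => R σ' ∧ σ'.natReg 10 = 0 ∧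
      HoldsOutDegrees G (fun e => (e : ℕ) < i) σ' ∧ HoldsInEdges G (fun e => (e : ℕ) < i) σ')
      ?_ (by norm_num) (Nat.zero_le _) (hreg 6 (by norm_num)) hσ.card_edges
      ⟨⟨.refl σ, fun x hx => hreg x (by omega)⟩, hreg 10 (by norm_num), fun u => by simp [h4],
        fun v => ⟨[], by simp, h5 v, by simp⟩⟩
    rintro i σ' hi ⟨⟨q1, q2⟩, q3, q4, q5⟩ q6 q7
    have he := henc σ' q1
    obtain ⟨g1, -, -, -, g2⟩ := enterEdge_run σ' q6 (he.src ⟨i, hi⟩) (he.tgt ⟨i, hi⟩)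
    refine Spec.of_run (by simp [enterEdge, Prog.block, Prog.Straight])
      ⟨(g2 6 (by norm_num) (by norm_num)).trans q6, (g2 1 (by norm_num) (by norm_num)).trans q7,
      ⟨(q1.trans g1).setNat (by norm_num) _, fun x hx => ?_⟩, ?_,
      q4.enterEdge (i := ⟨i, hi⟩) he q6, q5.enterEdge (i := ⟨i, hi⟩) he q6⟩
    · rw [Store.setNat_natReg, if_neg (by omega), g2 x (by omega) (by omega), q2 x hx]
    · rw [Store.setNat_natReg, if_neg (by norm_num), g2 10 (by norm_num) (by norm_num), q3]
  have s2 : ∀ σ1 : Store, R σ1 → σ1.natReg 6 = 0 → σ1.natReg 10 = 0 →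
      HoldsOutDegrees G (fun _ => True) σ1 → HoldsInEdges G (fun _ => True) σ1 →
      Spec sub T (.countUp 6 0 enterSink) σ1 ((enterSink.size + 9) * (n - 0) + 5)
        (0 * (n - 0)) (0 * (n - 0)) fun σ' => σ'.natReg 0 = n ∧ R σ' ∧
        HoldsOutDegrees G (fun _ => True) σ' ∧ HoldsInEdges G (fun _ => True) σ' ∧
        HoldsSinks G n σ' := by
    intro σ1 q1 q2 q3 q4 q5
    refine Spec.countUp (fun i σ' => R σ' ∧
      HoldsOutDegrees G (fun _ => True) σ' ∧ HoldsInEdges G (fun _ => True) σ' ∧ HoldsSinks G i σ')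
      ?_ (by norm_num) (Nat.zero_le _) q2 (henc σ1 q1.1).card_vertices
      ⟨q1, q4, q5, [], by simpa using q3, fun i hi => by simp at hi, by simp, by simp⟩
    rintro i σ' hi ⟨⟨q1, q2⟩, q3, q4, q5⟩ q6 q7
    obtain ⟨g1, g2, g3, -⟩ := enterSink_run σ' q6
    refine Spec.of_run (by simp [enterSink, Prog.Straight])
      ⟨(g3 6 (by norm_num)).trans q6, (g3 0 (by norm_num)).trans q7,
      ⟨(q1.trans g1).setNat (by norm_num) _, fun x hx => ?_⟩, ?_, ?_,
      HoldsSinks.enterSink (i := ⟨i, hi⟩) q6 q3 q5⟩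
    · rw [Store.setNat_natReg, if_neg (by omega), g3 x (by omega), q2 x hx]
    · intro u
      rw [Store.setNat_natArr, g2 4 (by norm_num)]
      exact q3 u
    · intro v
      rw [Store.setNat_natArr, g2 5 (by norm_num), g2 6 (by norm_num)]
      exact q4 v
  refine (s1.seq fun σ1 h1 => Spec.seq (c := .setNat 6 (.lit 0))
    (R := fun σ' => σ' = σ1.setNat 6 0) (N := 2) (L := 0)
    (M := 0) (Spec.of_run trivial rfl) fun σ2 h2 => (s2 σ2 ?_ ?_ ?_ ?_ ?_).seq fun σ3 h3 =>
    (orderLoop_spec (Q := h3.2.2.2.2.choose) (henc σ3 h3.2.1.1) ?_).imp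
      (Q := fun σ' => Keeps {4, 5, 6, 7, 8} ∅ σ σ' ∧ HoldsOrder G σ')
      fun σ' h => ⟨h3.2.1.1.trans h.1, h.2⟩).mono ?_ (by omega) (by omega) fun _ h => h
  · obtain ⟨-, q1, -⟩ := h1
    subst h2
    refine ⟨q1.1.setNat (by norm_num) _, fun x hx => ?_⟩
    rw [Store.setNat_natReg, if_neg (by omega), q1.2 x hx]
  · simp [h2]
  · simp [h2, h1.2.2.1]
  · subst h2
    intro u
    have := h1.2.2.2.1 u
    simpa using this
  · subst h2
    intro v
    have := h1.2.2.2.2 v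
    simpa using this
  · obtain ⟨-, q1, q2, q3, q4⟩ := h3
    obtain ⟨r1, r2, r3, r4⟩ := q4.choose_spec
    refine ⟨q3, by simpa [HoldsOutDegrees] using q2, q1.2 13 (by norm_num), fun i hi => by simp at hi, by simp,
      fun i hi => by simp at hi, r1, r2, r3, q1.2 11 (by norm_num), fun u => ?_,
      q1.2 12 (by norm_num), by simp, by simp, by simp⟩
    rw [List.nil_append, r4]
    simp [u.2]
  · simp only [enterEdge, enterSink, Prog.block, Prog.size, NExp.ops, BExp.ops]
    omega

end Chunking

namespace Chunking

/-! ## The best edge out of each vertex -/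

/-- The natural array 9 and the real array 2 hold the distances to `t`. -/
def HoldsDist {n m : ℕ} (G : TaskGraph (Fin n) (Fin m)) (σ : Store) : Prop :=
  (∀ u, 0 ≤ σ.realArr 2 u) ∧ ∀ u : Fin n, storedDist σ 9 2 u = G.dist u G.t

namespace HoldsDist

variable {n m : ℕ} {G : TaskGraph (Fin n) (Fin m)} {σ σ' : Store}

theorem congr (h : HoldsDist G σ) (h1 : σ'.natArr 9 = σ.natArr 9)
    (h2 : σ'.realArr 2 = σ.realArr 2) : HoldsDist G σ' := by
  refine ⟨fun u => h2 ▸ h.1 u, fun u => ?_⟩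
  rw [← h.2, storedDist, storedDist, h1, h2]

theorem flag_iff (h : HoldsDist G σ) (u : Fin n) : σ.natArr 9 u = 0 ↔ G.dist u G.t = ⊤ := by
  rw [← h.2, storedDist]
  split_ifs with h1 <;> simp [h1]

theorem value (h : HoldsDist G σ) {u : Fin n} (hu : G.dist u G.t ≠ ⊤) :
    σ.realArr 2 u = (G.dist u G.t).toReal := by
  rw [← h.2, storedDist, if_neg (mt (h.flag_iff u).1 hu), ENNReal.toReal_ofReal (h.1 _)]

end HoldsDist

/-- Comparing the edge in the natural register 6 with the best edge out of its source so far. -/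
def bestStep : Prog :=
  .block [
    .setNat 8 (.arr 0 (.reg 6)),
    .setNat 9 (.arr 1 (.reg 6)),
    .setNat 7 (.sub (.arr 12 (.reg 8)) (.lit 1)),
    .setReal 5 (.add (.mul (.reg 0) (.arr 0 (.reg 6))) (.arr 2 (.reg 9))),
    .setReal 6 (.add (.mul (.reg 0) (.arr 0 (.reg 7))) (.arr 2 (.arr 1 (.reg 7)))),
    .cond (.and (.not (.nle (.arr 9 (.reg 9)) (.lit 0)))
        (.not (.and (.not (.nle (.arr 12 (.reg 8)) (.lit 0))) (.and (.rle (.reg 6) (.reg 5))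
          (.not (.and (.rle (.reg 5) (.reg 6)) (.not (.nle (.arr 1 (.reg 7)) (.reg 9)))))))))
      (.putNat 12 (.reg 8) (.add (.reg 6) (.lit 1))) .skip]

/-- Finding the best edge out of each vertex. -/
def bestProg : Prog := .seq (.setNat 6 (.lit 0)) (.countUp 6 1 bestStep)

/-- An entry 0 means that there is no best edge yet. Truncated subtraction then makes `f` equal to
0, so everything said about `y` is guarded by the entry being nonzero. -/
theorem bestStep_run (σ : Store) {e u v f : ℕ} (he : σ.natReg 6 = e) (hu : σ.natArr 0 e = u)
    (hv : σ.natArr 1 e = v) (hf : σ.natArr 12 u - 1 = f) {x y : ℝ}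
    (hx : σ.realReg 0 * σ.realArr 0 e + σ.realArr 2 v = x)
    (hy : σ.realReg 0 * σ.realArr 0 f + σ.realArr 2 (σ.natArr 1 f) = y) :
    (bestStep.run σ).natReg 6 = σ.natReg 6 ∧ Keeps {12} ∅ σ (bestStep.run σ) ∧
    ((bestStep.run σ).natArr 12 = Function.update (σ.natArr 12) u (e + 1) ∧ σ.natArr 9 v ≠ 0 ∧
      (σ.natArr 12 u ≠ 0 → x < y ∨ x = y ∧ v ≤ σ.natArr 1 f) ∨
    (bestStep.run σ).natArr 12 = σ.natArr 12 ∧ (σ.natArr 9 v ≠ 0 → σ.natArr 12 u ≠ 0 ∧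
      (y < x ∨ y = x ∧ σ.natArr 1 f ≤ v))) := by
  have hr : ∀ x < 5, x ≠ 7 ∧ x ≠ 8 ∧ x ≠ 9 := by omega
  by_cases h : ¬ σ.natArr 9 v = 0 ∧ (¬ σ.natArr 12 u = 0 → y ≤ x →
      x ≤ y ∧ v < σ.natArr 1 f)
  · refine ⟨?_, ⟨?_, ?_, ?_, ?_⟩, .inl ⟨?_, h.1, fun h1 => ?_⟩⟩
    on_goal 7 =>
      rcases lt_or_ge x y with h2 | h2
      · exact .inl h2
      · obtain ⟨h3, h4⟩ := h.2 h1 h2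
        exact .inr ⟨le_antisymm h3 h2, h4.le⟩
    all_goals simp +contextual [bestStep, Prog.block, Prog.run, he, hu, hv, hf, hx, hy, h, hr]
  · refine ⟨?_, ⟨?_, ?_, ?_, ?_⟩, .inr ⟨?_, fun h1 => ?_⟩⟩
    on_goal 7 =>
      have h2 : ¬ (¬ σ.natArr 12 u = 0 → y ≤ x → x ≤ y ∧ v < σ.natArr 1 f) := fun h2 => h ⟨h1, h2⟩
      push Not at h2
      obtain ⟨h3, h4, h5⟩ := h2
      exact ⟨h3, h4.lt_or_eq.imp_right fun h6 => ⟨h6, h5 h6.ge⟩⟩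
    all_goals simp +contextual [bestStep, Prog.block, Prog.run, he, hu, hv, hf, hx, hy, h, hr]

/-- The natural array 12 holds the best among the first `i` edges out of each vertex, where only
edges count from whose target `t` can be reached; the edge `e` is entered as `e + 1`. -/
def HoldsBest {n m : ℕ} (G : TaskGraph (Fin n) (Fin m)) (b : ℝ≥0) (i : ℕ) (σ : Store) : Prop :=
  ∀ u : Fin n,
    (σ.natArr 12 u = 0 ∧ ∀ f : Fin m, (f : ℕ) < i → G.src f = u → G.dist (G.tgt f) G.t = ⊤) ∨
    ∃ e : Fin m, σ.natArr 12 u = e + 1 ∧ G.src e = u ∧ G.dist (G.tgt e) G.t ≠ ⊤ ∧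
      ∀ f : Fin m, (f : ℕ) < i → G.src f = u → G.dist (G.tgt f) G.t ≠ ⊤ →
        toLex (b * G.cost e + (G.dist (G.tgt e) G.t).toReal, G.tgt e) ≤
          toLex (b * G.cost f + (G.dist (G.tgt f) G.t).toReal, G.tgt f)

theorem HoldsBest.step {n m : ℕ} {G : TaskGraph (Fin n) (Fin m)} {b : ℝ≥0} {k : ℕ} {σ : Store}
    (hσ : Encodes G b k σ) (hd : HoldsDist G σ) {i : Fin m} (hi : σ.natReg 6 = i)
    (h : HoldsBest G b i σ) : HoldsBest G b (i + 1) (bestStep.run σ) := by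
  obtain ⟨-, -, hrun⟩ := bestStep_run σ hi (hσ.src i) (hσ.tgt i) rfl rfl rfl
  rw [hσ.bias, hσ.cost] at hrun
  set σ' := bestStep.run σ
  intro u
  by_cases hu : G.src i = u
  · subst hu
    by_cases htop : G.dist (G.tgt i) G.t = ⊤
    · have h12 : σ'.natArr 12 = σ.natArr 12 := by
        rcases hrun with ⟨-, h1, -⟩ | ⟨h1, -⟩
        exacts [(h1 ((hd.flag_iff _).2 htop)).elim, h1]
      rw [h12]
      refine (h (G.src i)).imp (fun ⟨h1, h2⟩ => ⟨h1, fun f hf hs => ?_⟩)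
        fun ⟨e, h1, h2, h3, h4⟩ => ⟨e, h1, h2, h3, fun f hf hs hfin => ?_⟩
      · rcases Nat.lt_succ_iff_lt_or_eq.1 hf with hf | hf
        · exact h2 f hf hs
        · rwa [Fin.ext hf]
      · rcases Nat.lt_succ_iff_lt_or_eq.1 hf with hf | hf
        · exact h4 f hf hs hfin
        · rw [Fin.ext hf] at hfin
          exact (hfin htop).elim
    · right
      rw [hd.value htop] at hrun
      have hflag : σ.natArr 9 (G.tgt i) ≠ 0 := mt (hd.flag_iff _).1 htop
      rcases h (G.src i) with ⟨h1, h2⟩ | ⟨e, h1, h2, h3, h4⟩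
      · rcases hrun with ⟨g1, -, -⟩ | ⟨-, g1⟩
        · refine ⟨i, by rw [g1, Function.update_self], rfl, htop, fun f hf hs hfin => ?_⟩
          rcases Nat.lt_succ_iff_lt_or_eq.1 hf with hf | hf
          · exact (hfin (h2 f hf hs)).elim
          · rw [Fin.ext hf]
        · exact ((g1 hflag).1 h1).elim
      · rw [h1, Nat.add_sub_cancel, hσ.cost, hσ.tgt, hd.value h3, ← Fin.le_def,
          ← Fin.le_def] at hrun
        rcases hrun with ⟨g1, -, g2⟩ | ⟨g1, g2⟩
        · have hle : toLex ((b : ℝ) * G.cost i + (G.dist (G.tgt i) G.t).toReal, G.tgt i) ≤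
              toLex ((b : ℝ) * G.cost e + (G.dist (G.tgt e) G.t).toReal, G.tgt e) :=
            Prod.Lex.toLex_le_toLex.2 (g2 (Nat.succ_ne_zero _))
          refine ⟨i, by rw [g1, Function.update_self], rfl, htop, fun f hf hs hfin => ?_⟩
          rcases Nat.lt_succ_iff_lt_or_eq.1 hf with hf | hf
          · exact hle.trans (h4 f hf hs hfin)
          · rw [Fin.ext hf]
        · refine ⟨e, by rw [g1, h1], h2, h3, fun f hf hs hfin => ?_⟩
          rcases Nat.lt_succ_iff_lt_or_eq.1 hf with hf | hf
          · exact h4 f hf hs hfin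
          · rw [Fin.ext hf]
            exact Prod.Lex.toLex_le_toLex.2 (g2 hflag).2
  · have h12 : σ'.natArr 12 u = σ.natArr 12 u := by
      have hu' : (u : ℕ) ≠ G.src i := fun h => hu (Fin.ext h).symm
      rcases hrun with ⟨h1, -⟩ | ⟨h1, -⟩
      exacts [by rw [h1, Function.update_of_ne hu'], by rw [h1]]
    rw [h12]
    have hlt : ∀ f : Fin m, (f : ℕ) < i + 1 → G.src f = u → (f : ℕ) < i := by
      intro f hf hs
      rcases Nat.lt_succ_iff_lt_or_eq.1 hf with hf | hf
      · exact hf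
      · rw [Fin.ext hf] at hs
        exact (hu hs).elim
    exact (h u).imp (fun ⟨h1, h2⟩ => ⟨h1, fun f hf hs => h2 f (hlt f hf hs) hs⟩)
      fun ⟨e, h1, h2, h3, h4⟩ => ⟨e, h1, h2, h3, fun f hf hs => h4 f (hlt f hf hs) hs⟩

theorem perceived_eq_ofReal {V E : Type*} {G : TaskGraph V E} {b : ℝ≥0} {e : E}
    (h : G.dist (G.tgt e) G.t ≠ ⊤) : G.perceived b G.t e =
      ENNReal.ofReal (b * G.cost e + (G.dist (G.tgt e) G.t).toReal) := by
  rw [WGraph.perceived, ENNReal.ofReal_add (by positivity) ENNReal.toReal_nonneg,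
    ENNReal.ofReal_toReal h, ← NNReal.coe_mul, ENNReal.ofReal_coe_nnreal, ENNReal.coe_mul]

/-- The entry for the source of `f` in the natural array 12 is a best edge. -/
theorem HoldsBest.exists_isFirstBest {n m : ℕ} {G : TaskGraph (Fin n) (Fin m)} {b : ℝ≥0}
    {σ : Store} (h : HoldsBest G b m σ) {f : Fin m} (hf : G.dist (G.tgt f) G.t ≠ ⊤) :
    ∃ e : Fin m, σ.natArr 12 (G.src f) = e + 1 ∧ G.src e = G.src f ∧
      G.dist (G.tgt e) G.t ≠ ⊤ ∧ G.IsFirstBest b e := by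
  rcases h (G.src f) with ⟨-, h1⟩ | ⟨e, h1, h2, h3, h4⟩
  · exact (hf (h1 f f.2 rfl)).elim
  · refine ⟨e, h1, h2, h3, fun g hg => ?_⟩
    by_cases hfin : G.dist (G.tgt g) G.t = ⊤
    · left
      rw [perceived_eq_ofReal h3, WGraph.perceived, hfin, add_top]
      exact ENNReal.ofReal_lt_top
    · rw [perceived_eq_ofReal h3, perceived_eq_ofReal hfin]
      have hpos : 0 ≤ (b * G.cost e + (G.dist (G.tgt e) G.t).toReal : ℝ) := by positivity
      rcases Prod.Lex.toLex_le_toLex.1 (h4 g g.2 (hg.trans h2) hfin) with h5 | ⟨h5, h6⟩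
      · exact .inl ((ENNReal.ofReal_lt_ofReal_iff_of_nonneg hpos).2 h5)
      · exact .inr ⟨congrArg ENNReal.ofReal h5, h6⟩

theorem bestProg_spec {sub : Option Prog} {T : Store → Prop} {n m : ℕ}
    {G : TaskGraph (Fin n) (Fin m)} {b : ℝ≥0} {k : ℕ} {σ : Store} (hσ : Encodes G b k σ)
    (hd : HoldsDist G σ) (h0 : ∀ u, σ.natArr 12 u = 0) :
    Spec sub T bestProg σ (100 * (m + 1)) 0 0
      fun σ' => Keeps {12} ∅ σ σ' ∧ HoldsBest G b m σ' := by
  refine (Spec.seq (c := .setNat 6 (.lit 0)) (R := fun σ' => σ' = σ.setNat 6 0) (N := 2) (L := 0)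
    (M := 0) (Spec.of_run trivial rfl) fun σ1 h1 => Spec.countUp (N := bestStep.size) (L := 0)
    (M := 0) (n := m) (i := 0) (fun i σ' => Keeps {12} ∅ σ σ' ∧ HoldsBest G b i σ') ?_
    (by norm_num) (Nat.zero_le _) ?_ ?_ ?_).mono ?_ (by omega) (by omega) fun _ h => h.2
  · rintro i σ' hi ⟨h2, h3⟩ h4 h5
    have henc := hσ.of_keeps h2 (by simp) (by simp) (by simp)
    obtain ⟨g1, g2, -⟩ := bestStep_run σ' h4 (henc.src ⟨i, hi⟩) (henc.tgt ⟨i, hi⟩) rfl rfl rfl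
    exact Spec.of_run (by simp [bestStep, Prog.block, Prog.Straight]) ⟨g1.trans h4,
      (g2.natReg 1 (by norm_num)).trans h5, (h2.trans g2).setNat (by norm_num) _,
      HoldsBest.step henc (hd.congr (h2.natArr 9 (by simp)) (h2.realArr 2 (by simp)))
        (i := ⟨i, hi⟩) h4 h3⟩
  · simp [h1]
  · simp [h1, hσ.card_edges]
  · subst h1
    exact ⟨(Keeps.refl σ).setNat (by norm_num) _, fun u => .inl ⟨h0 u, fun f hf => by omega⟩⟩
  · simp only [bestStep, Prog.block, Prog.size, NExp.ops, RExp.ops, BExp.ops]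
    omega

/-! ## Splitting the edges -/

/-- Preparation of a call of the edge-chunking program for the edge in the natural register 6. -/
def loadEdge : Prog :=
  .block [
    .setReal 1 (.arr 0 (.reg 6)),
    .setReal 2 (.arr 2 (.arr 0 (.reg 6))),
    .setReal 3 (.arr 2 (.arr 1 (.reg 6)))]

/-- Blocking the edge in the natural register 6 if it turns out not to be persuadable. -/
def judgeEdge : Prog :=
  .block [
    .setNat 7 (.sub (.arr 12 (.arr 0 (.reg 6))) (.lit 1)),
    .cond (.nle (.reg 2) (.lit 1))
      (.cond (.and (.nle (.reg 7) (.reg 6)) (.nle (.reg 6) (.reg 7))) .skip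
        (.putNat 11 (.reg 6) (.lit 1)))
      (.cond (.rle (.reg 4)
          (.add (.mul (.reg 0) (.arr 0 (.reg 7))) (.arr 2 (.arr 1 (.reg 7))))) .skip
        (.putNat 11 (.reg 6) (.lit 1)))]

/-- Splitting the edge in the natural register 6. -/
def chunkStep : Prog :=
  .seq (.putNat 3 (.reg 6) (.reg 5)) (.seq
    (.cond (.nle (.arr 9 (.arr 1 (.reg 6))) (.lit 0)) (.putNat 11 (.reg 6) (.lit 1))
      (.seq loadEdge (.seq .call judgeEdge)))
    (.setNat 5 (.add (.reg 5) (.reg 2))))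

/-- Splitting all edges. -/
def chunkProg : Prog :=
  .seq (.seq (.setNat 5 (.lit 0)) (.setNat 6 (.lit 0))) (.countUp 6 1 chunkStep)

theorem Spec.call {T : Store → Prop} {P : Prog} {σ : Store} {N : ℕ} {Q : Store → Prop}
    (h : Spec none T P σ N 0 0 Q) (hσ : T σ) : Spec (some P) T .call σ 1 N 1 Q := by
  obtain ⟨σ', κ, h1, h2, -, -, -, h3⟩ := h
  exact ⟨σ', _, .call h1, le_rfl, h2, le_rfl, by simpa using hσ, h3⟩

theorem loadEdge_run (σ : Store) {e u v : ℕ} (he : σ.natReg 6 = e) (hu : σ.natArr 0 e = u)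
    (hv : σ.natArr 1 e = v) : (loadEdge.run σ).natReg = σ.natReg ∧
    (loadEdge.run σ).natArr = σ.natArr ∧ (loadEdge.run σ).realArr = σ.realArr ∧
    (loadEdge.run σ).realReg 0 = σ.realReg 0 ∧ (loadEdge.run σ).realReg 1 = σ.realArr 0 e ∧
    (loadEdge.run σ).realReg 2 = σ.realArr 2 u ∧ (loadEdge.run σ).realReg 3 = σ.realArr 2 v := by
  refine ⟨?_, ?_, ?_, ?_, ?_, ?_, ?_⟩
  all_goals simp [loadEdge, Prog.block, Prog.run, he, hu, hv]

theorem judgeEdge_run (σ : Store) {e u f : ℕ} (he : σ.natReg 6 = e) (hu : σ.natArr 0 e = u)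
    (hf : σ.natArr 12 u = f + 1) : (∀ x, x ≠ 7 → (judgeEdge.run σ).natReg x = σ.natReg x) ∧
    Keeps {11} ∅ σ (judgeEdge.run σ) ∧
    (judgeEdge.run σ).natArr 11 = if (σ.natReg 2 ≤ 1 ∧ f = e ∨ 1 < σ.natReg 2 ∧
        σ.realReg 4 ≤ σ.realReg 0 * σ.realArr 0 f + σ.realArr 2 (σ.natArr 1 f)) then σ.natArr 11
      else Function.update (σ.natArr 11) e 1 := by
  have hr : ∀ x < 5, x ≠ 7 := by omega
  have hef : f ≤ e ∧ e ≤ f ↔ f = e := by omega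
  by_cases h2 : σ.natReg 2 ≤ 1
  · by_cases h3 : f = e <;> refine ⟨?_, ⟨?_, ?_, ?_, ?_⟩, ?_⟩ <;>
      simp +contextual [judgeEdge, Prog.block, Prog.run, he, hu, hf, h2, h3, hr, not_lt.2 h2, hef]
  · by_cases h3 : σ.realReg 4 ≤ σ.realReg 0 * σ.realArr 0 f + σ.realArr 2 (σ.natArr 1 f) <;>
      refine ⟨?_, ⟨?_, ?_, ?_, ?_⟩, ?_⟩ <;>
      simp +contextual [judgeEdge, Prog.block, Prog.run, he, hu, hf, h2, h3, hr, not_le.1 h2]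

end Chunking

namespace Chunking

/-! ### Deciding persuadability and storing the chunks -/

theorem HoldsAt.congr {σ σ' : Store} {p : ℕ} {l : List ℝ≥0} (h : HoldsAt σ p l)
    (hσ : ∀ j < l.length, σ'.realArr 1 (p + j) = σ.realArr 1 (p + j)) : HoldsAt σ' p l :=
  fun i => (hσ i i.2).trans (h i)

/-- What is stored for the edge `e` after it was split. -/
structure EdgeDone {n m : ℕ} (G : TaskGraph (Fin n) (Fin m)) (b : ℝ≥0) (k : ℕ) (e : Fin m)
    (σ : Store) : Prop where
  position : σ.natArr 3 e = e * k
  blocked : σ.natArr 11 e = 0 ↔ G.dist (G.tgt e) G.t ≠ ⊤ ∧ G.Persuadable b k e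
  chunks : G.dist (G.tgt e) G.t ≠ ⊤ →
    ∃ l, G.IsOptimalEdgeChunking b k e l ∧ HoldsAt σ (e * k) l

/-- The test of the program decides whether the edge is persuadable. -/
theorem persuadable_iff_test {n m : ℕ} {G : TaskGraph (Fin n) (Fin m)} {b : ℝ≥0} {k : ℕ}
    (hb : 1 < b) (hk : 1 ≤ k) {e f : Fin m} (hs : G.src f = G.src e)
    (hf : G.dist (G.tgt f) G.t ≠ ⊤) (hbest : G.IsFirstBest b f) {l : List ℝ≥0} {β : ℝ}
    (hl : G.IsOptimalEdgeChunking b k e l) (hβ : G.bottleneck b e l = ENNReal.ofReal β) :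
    G.Persuadable b k e ↔ k ≤ 1 ∧ (f : ℕ) = e ∨
      1 < k ∧ β ≤ b * G.cost f + (G.dist (G.tgt f) G.t).toReal := by
  rcases hk.lt_or_eq with hk2 | rfl
  · have hne : l ≠ [] := by
      have := hl.1.1
      exact List.ne_nil_of_length_pos (by omega)
    rw [TaskGraph.bottleneck_eq hne hl.1.2] at hβ
    rw [TaskGraph.persuadable_iff_of_two_le hb.le hk2 hl, hβ]
    have h1 : ENNReal.ofReal β ≤ G.perceived b G.t f ↔
        β ≤ b * G.cost f + (G.dist (G.tgt f) G.t).toReal := by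
      rw [perceived_eq_ofReal hf, ENNReal.ofReal_le_ofReal_iff (by positivity)]
    constructor
    · intro h
      exact .inr ⟨hk2, h1.1 (h f hs)⟩
    · rintro (⟨h2, -⟩ | ⟨-, h2⟩) g hg
      · omega
      · refine (h1.2 h2).trans ?_
        rcases hbest g (hg.trans hs.symm) with h3 | h3
        exacts [h3.le, h3.1.le]
  · rw [TaskGraph.persuadable_one_iff]
    constructor
    · intro h
      refine .inl ⟨le_rfl, ?_⟩
      rw [← Fin.ext_iff]
      -- If both edges are first best, they agree in perceived cost and target; as there are no
      -- parallel edges, they coincide.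
      refine G.simple _ _ hs ?_
      rcases hbest e hs.symm with h1 | ⟨h1, h2⟩ <;> rcases h f hs with h3 | ⟨h3, h4⟩
      · exact (lt_asymm h1 h3).elim
      · exact (h1.ne h3.symm).elim
      · exact (h3.ne h1.symm).elim
      · exact le_antisymm h2 h4
    · rintro (⟨-, h⟩ | ⟨h, -⟩)
      · rwa [← Fin.ext h]
      · omega

/-- Each edge owns a block of `k` array entries. The edge-chunking program writes only inside its
block, so earlier results survive; an edge from whose target `t` is unreachable is blocked without a
call. -/
theorem chunkStep_spec {n m : ℕ} {G : TaskGraph (Fin n) (Fin m)} {b : ℝ≥0} {k : ℕ} (hb : 1 < b)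
    (hk : 1 ≤ k) {σ : Store} (hσ : Encodes G b k σ) (hd : HoldsDist G σ) (hbest : HoldsBest G b m σ)
    {i : Fin m} (hi : σ.natReg 6 = i) (hpos : σ.natReg 5 = i * k) (h11 : σ.natArr 11 i = 0) :
    Spec (some edgeProg) (fun τ => ∃ e, EdgeInput G b k e τ) chunkStep σ 100 (200 * k) 1 fun σ' =>
      Keeps {3, 11} {1} σ σ' ∧ σ'.natReg 6 = i ∧ σ'.natReg 5 = (i + 1) * k ∧
      EdgeDone G b k i σ' ∧ (∀ j, j ≠ (i : ℕ) → σ'.natArr 3 j = σ.natArr 3 j ∧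
        σ'.natArr 11 j = σ.natArr 11 j) ∧
      ∀ j, j < i * k → σ'.realArr 1 j = σ.realArr 1 j := by
  let R : Store → Prop := fun σ' => Keeps {3, 11} {1} σ σ' ∧ σ'.natReg 6 = i ∧
    σ'.natReg 5 = i * k ∧ EdgeDone G b k i σ' ∧ (∀ j, j ≠ (i : ℕ) →
      σ'.natArr 3 j = σ.natArr 3 j ∧ σ'.natArr 11 j = σ.natArr 11 j) ∧
      ∀ j, j < i * k → σ'.realArr 1 j = σ.realArr 1 j
  have h1 : Keeps {3, 11} {1} σ (σ.putNat 3 i (i * k)) :=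
    ⟨fun _ _ => rfl, rfl, fun a ha => by simp at ha; simp [ha], fun _ _ => rfl⟩
  have henc := hσ.of_keeps h1 (by simp) (by simp) (by simp)
  have main : Spec (some edgeProg) (fun τ => ∃ e, EdgeInput G b k e τ)
      (.cond (.nle (.arr 9 (.arr 1 (.reg 6))) (.lit 0)) (.putNat 11 (.reg 6) (.lit 1))
        (.seq loadEdge (.seq .call judgeEdge))) (σ.putNat 3 i (i * k)) 80 (200 * k) 1 R := by
    set σ1 := σ.putNat 3 i (i * k)
    have hi1 : σ1.natReg 6 = i := hi
    have hd1 : HoldsDist G σ1 := hd.congr (by simp [σ1]) rfl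
    refine (Spec.cond (N := 70) (fun hc => ?_) fun hc => ?_).mono
      (by simp [BExp.ops, NExp.ops]) le_rfl le_rfl fun _ h => h
    · simp only [BExp.holds, NExp.eval, hi1, henc.tgt, Nat.le_zero, hd1.flag_iff] at hc
      refine (Spec.of_run (c := .putNat 11 (.reg 6) (.lit 1)) trivial ⟨⟨h1.natReg, h1.realReg, fun a ha => ?_, h1.realArr⟩, hi1,
        hpos, ⟨?_, ?_, fun h => (h hc).elim⟩, fun j hj => ?_, fun j _ => rfl⟩).mono
        (by simp [Prog.size, NExp.ops]) (Nat.zero_le _) (Nat.zero_le _) fun _ h => h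
      · simp at ha
        simp [Prog.run, σ1, ha]
      · simp [Prog.run, σ1]
      · simp [Prog.run, hi1, hc]
      · simp [Prog.run, σ1, hi, hj]
    · simp only [BExp.holds, NExp.eval, hi1, henc.tgt, Nat.le_zero, hd1.flag_iff] at hc
      have hu := TaskGraph.dist_src_ne_top hc
      obtain ⟨g1, g2, g3, g4, g5, g6, g7⟩ := loadEdge_run σ1 hi1 (henc.src i) (henc.tgt i)
      have hin : EdgeInput G b k i (loadEdge.run σ1) :=
        ⟨hc, by rw [g1, henc.constraint], by rw [g4, henc.bias], by rw [g5, henc.cost],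
          by rw [g6, hd1.value hu], by rw [g7, hd1.value hc]⟩
      refine (Spec.seq (R := fun σ' => σ' = loadEdge.run σ1) (Spec.of_run
        (by simp [loadEdge, Prog.block, Prog.Straight]) rfl) fun σ2 h2 =>
        Spec.seq (N := 1) (L := 200 * k) (M := 1) (R := fun σ' => EdgeFrame (loadEdge.run σ1) σ' ∧
          EdgeOutput G b k i (loadEdge.run σ1) σ')
        (by
          subst h2
          exact Spec.call (T := fun τ => ∃ e, EdgeInput G b k e τ)
            (edgeProg_edgeOutput hb hk hin) ⟨i, hin⟩) fun σ3 h3 => Spec.of_run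
        (by simp [judgeEdge, Prog.block, Prog.Straight]) ?_).mono
        (by simp [loadEdge, judgeEdge, Prog.block, Prog.size, NExp.ops, RExp.ops, BExp.ops])
        (by omega) (by omega) fun _ h => h
      obtain ⟨hfr, l, hl, hat, hnn, hβ⟩ := h3
      have hp2 : (loadEdge.run σ1).natReg 5 = i * k := by rw [g1]; exact hpos
      have hk2 : (loadEdge.run σ1).natReg 2 = k := by rw [g1, henc.constraint]
      have h13 : Keeps {3, 11} {1} σ1 σ3 := by
        refine ⟨fun x hx => by rw [hfr.natReg x (by omega), g1], by rw [hfr.realReg 0 (by norm_num), g4],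
          fun a _ => by rw [hfr.natArr, g2], fun a ha => by rw [hfr.realArr a (by simpa using ha), g3]⟩
      have henc3 := henc.of_keeps h13 (by simp) (by simp) (by simp)
      have hd3 : HoldsDist G σ3 := hd1.congr (h13.natArr 9 (by simp)) (h13.realArr 2 (by simp))
      have hi3 : σ3.natReg 6 = i := by rw [hfr.natReg 6 (by norm_num), g1, hi1]
      -- The edge `i` itself leads to `t`, so its source does have an entry for the best edge.
      obtain ⟨f, q1, q2, q3, q4⟩ := hbest.exists_isFirstBest hc
      have h12 : σ3.natArr 12 (G.src i) = f + 1 := by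
        rw [hfr.natArr, g2, ← q1]
        simp [σ1]
      obtain ⟨r1, r2, r3⟩ := judgeEdge_run σ3 hi3 (henc3.src i) h12
      rw [henc3.constraint, henc3.bias, henc3.cost, henc3.tgt, hd3.value q3] at r3
      have hiff := persuadable_iff_test hb hk q2 q3 q4 hl hβ
      have hn3 : σ3.natArr = σ1.natArr := by rw [hfr.natArr, g2]
      have a3 : (judgeEdge.run σ3).natArr 3 = Function.update (σ.natArr 3) i (i * k) := by
        rw [r2.natArr 3 (by simp), hn3]
        simp [σ1]
      have a11 : σ3.natArr 11 = σ.natArr 11 := by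
        rw [hn3]
        simp [σ1]
      have a1 : (judgeEdge.run σ3).realArr 1 = σ3.realArr 1 := r2.realArr 1 (by simp)
      refine ⟨(h1.trans h13).trans (r2.mono (by simp) (by simp)), (r1 6 (by norm_num)).trans hi3,
        ?_, ⟨?_, ?_, fun _ => ⟨l, hl, ?_⟩⟩, fun j hj => ⟨?_, ?_⟩, fun j hj => ?_⟩
      · rw [r1 5 (by norm_num), hfr.natReg 5 (by norm_num), hp2]
      · rw [a3, Function.update_self]
      · rw [r3, a11]
        split_ifs with hper
        · simp [h11, hc, hiff.2 hper]
        · simp [mt hiff.1 hper]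
      · rw [hp2] at hat
        exact hat.congr fun j _ => by rw [a1]
      · rw [a3, Function.update_of_ne hj]
      · rw [r3, a11]
        split_ifs
        · rfl
        · rw [Function.update_of_ne hj]
      · rw [a1, hfr.outside j (.inl (by rwa [hp2])), g3]
        rfl
  refine (Spec.seq (R := fun σ' => σ' = σ.putNat 3 i (i * k)) (N := 3) (L := 0) (M := 0)
    (Spec.of_run (c := .putNat 3 (.reg 6) (.reg 5)) trivial (by simp [Prog.run, hi, hpos]))
    fun σ1 h1 => Spec.seq (R := R) (h1 ▸ main) fun σ2 h2 =>
    Spec.of_run (c := .setNat 5 (.add (.reg 5) (.reg 2))) trivial ?_).mono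
    (by simp [Prog.size, NExp.ops]) (by omega) (by omega) fun _ h => h
  obtain ⟨q1, q2, q3, q4, q5, q6⟩ := h2
  have hc := (hσ.of_keeps q1 (by simp) (by simp) (by simp)).constraint
  refine ⟨q1.setNat (by norm_num) _, ?_, ?_,
    ⟨q4.position, q4.blocked, q4.chunks⟩, q5, q6⟩
  · simp [Prog.run, q2]
  · simp [Prog.run, q3, hc]
    ring

theorem chunkProg_spec {n m : ℕ} {G : TaskGraph (Fin n) (Fin m)} {b : ℝ≥0} {k : ℕ} (hb : 1 < b)
    (hk : 1 ≤ k) {σ : Store} (hσ : Encodes G b k σ) (hd : HoldsDist G σ) (hbest : HoldsBest G b m σ)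
    (h11 : ∀ i, σ.natArr 11 i = 0) :
    Spec (some edgeProg) (fun τ => ∃ e, EdgeInput G b k e τ) chunkProg σ (200 * (m + 1))
      (200 * k * m) m fun σ' => Keeps {3, 11} {1} σ σ' ∧ ∀ e, EdgeDone G b k e σ' := by
  refine (Spec.seq (R := fun σ' => σ' = (σ.setNat 5 0).setNat 6 0) (N := 4) (L := 0)
    (M := 0) (Spec.of_run (c := .seq (.setNat 5 (.lit 0)) (.setNat 6 (.lit 0)))
    (by simp [Prog.Straight]) rfl) fun σ1 h1 => Spec.countUp (N := 100) (L := 200 * k)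
    (M := 1) (n := m) (i := 0) (fun i σ' => Keeps {3, 11} {1} σ σ' ∧ σ'.natReg 5 = i * k ∧
      (∀ e : Fin m, (e : ℕ) < i → EdgeDone G b k e σ') ∧ ∀ j, i ≤ j → σ'.natArr 11 j = 0) ?_
    (by norm_num) (Nat.zero_le _) ?_ ?_ ?_).mono ?_ ?_ ?_ fun _ h => ⟨h.2.1, fun e => h.2.2.2.1 e e.2⟩
  · rintro i σ' hi ⟨h2, h3, h4, h5⟩ h6 h7
    have henc := hσ.of_keeps h2 (by simp) (by simp) (by simp)
    have hd' := hd.congr (h2.natArr 9 (by simp)) (h2.realArr 2 (by simp))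
    have hbest' : HoldsBest G b m σ' := by
      intro u
      rw [h2.natArr 12 (by simp)]
      exact hbest u
    refine (chunkStep_spec hb hk henc hd' hbest' (i := ⟨i, hi⟩) h6 h3 (h5 i le_rfl)).imp ?_
    rintro σ'' ⟨q1, q2, q3, q4, q5, q6⟩
    refine ⟨q2, (q1.natReg 1 (by norm_num)).trans h7, (h2.trans q1).setNat (by norm_num) _,
      by simpa using q3, fun e he => ?_, fun j hj => ?_⟩
    · rcases Nat.lt_succ_iff_lt_or_eq.1 he with he | he
      · obtain ⟨r1, r2, r3⟩ := h4 e he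
        obtain ⟨r4, r5⟩ := q5 e he.ne
        refine ⟨r4.trans r1, by rw [← r2, ← r5]; rfl, fun hfin => ?_⟩
        obtain ⟨l, hl, hat⟩ := r3 hfin
        refine ⟨l, hl, hat.congr fun j hj => q6 _ ?_⟩
        rw [hl.1.1] at hj
        calc (e : ℕ) * k + j < e * k + k := by omega
          _ = (e + 1) * k := by ring
          _ ≤ i * k := Nat.mul_le_mul_right k he
      · obtain rfl : e = ⟨i, hi⟩ := Fin.ext he
        exact ⟨q4.position, q4.blocked, q4.chunks⟩
    · rw [Store.setNat_natArr, (q5 j (by simp only; omega)).2]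
      exact h5 j (by omega)
  · simp [h1]
  · simp [h1, hσ.card_edges]
  · subst h1
    exact ⟨((Keeps.refl σ).setNat le_rfl _).setNat (by norm_num) _, by simp,
      fun e he => by omega, fun j _ => h11 j⟩
  · omega
  · simp
  · simp

end Chunking

namespace Chunking

/-! ## Following the cheapest path -/

/-- Moving the natural register 9 along the stored shortest path, marking the edge. -/
def walkStep : Prog :=
  .block [
    .setNat 7 (.arr 14 (.reg 9)),
    .putNat 15 (.reg 7) (.lit 1),
    .setNat 9 (.arr 1 (.reg 7))]

/-- Marking the edges of the stored shortest path from `s` to `t`. -/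
def walkProg : Prog :=
  .seq (.setNat 9 (.reg 3))
    (.loop (.not (.and (.nle (.reg 9) (.reg 4)) (.nle (.reg 4) (.reg 9)))) walkStep)

theorem walkStep_run (σ : Store) {v w e : ℕ} (hv : σ.natReg 9 = v) (he : σ.natArr 14 v = e)
    (hw : σ.natArr 1 e = w) : (walkStep.run σ).natReg 9 = w ∧ Keeps {15} ∅ σ (walkStep.run σ) ∧
    (walkStep.run σ).natArr 15 = Function.update (σ.natArr 15) e 1 := by
  have hr : ∀ x < 5, x ≠ 7 ∧ x ≠ 9 := by omega
  refine ⟨?_, ⟨?_, ?_, ?_, ?_⟩, ?_⟩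
  all_goals simp +contextual [walkStep, Prog.block, Prog.run, hv, he, hw, hr]

/-- Along the way, the cost so far plus the distance from the current vertex equals the distance
from `s`. -/
theorem walkProg_spec {sub : Option Prog} {T : Store → Prop} {n m : ℕ}
    {G : TaskGraph (Fin n) (Fin m)} {b : ℝ≥0} {k : ℕ} {σ : Store} (hσ : Encodes G b k σ)
    {S : Fin m → Prop} (hS : G.distOn S G.s G.t ≠ ⊤)
    (hd : ∀ u : Fin n, storedDist σ 13 3 u = G.distOn S u G.t)
    (hx : ∀ u : Fin n, u ≠ G.t → σ.natArr 13 u ≠ 0 → ∃ e : Fin m, σ.natArr 14 u = e ∧ S e ∧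
      G.src e = u ∧ G.distOn S u G.t = G.cost e + G.distOn S (G.tgt e) G.t)
    (h15 : ∀ i, σ.natArr 15 i = 0) :
    Spec sub T walkProg σ (100 * (m + 1)) 0 0 fun σ' => Keeps {15} ∅ σ σ' ∧
      ∃ q, G.IsWalk G.s q G.t ∧ (∀ e ∈ q, S e) ∧ (G.walkCost q : ℝ≥0∞) = G.distOn S G.s G.t ∧
        ∀ e : Fin m, σ'.natArr 15 e ≠ 0 ↔ e ∈ q := by
  refine (Spec.seq (c := .setNat 9 (.reg 3)) (R := fun σ' => σ' = σ.setNat 9 (σ.natReg 3)) (N := 2)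
    (L := 0) (M := 0) (Spec.of_run trivial rfl) fun σ1 h1 => Spec.loop (N := walkStep.size)
    (L := 0) (M := 0) (fun j σ' => Keeps {15} ∅ σ σ' ∧ ∃ q v, j = m - q.length ∧
      σ'.natReg 9 = (v : Fin n) ∧ G.IsWalk G.s q v ∧ (∀ e ∈ q, S e) ∧
      (G.walkCost q : ℝ≥0∞) + G.distOn S v G.t = G.distOn S G.s G.t ∧
      ∀ e : Fin m, σ'.natArr 15 e ≠ 0 ↔ e ∈ q) ?_ m ?_).mono ?_ (by omega) (by omega) ?_
  · rintro j σ' ⟨hk, q, v, rfl, hv, hq, hqS, hcost, hmark⟩ hne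
    have henc := hσ.of_keeps hk (by simp) (by simp) (by simp)
    have hvt : v ≠ G.t := by
      rintro rfl
      simp [hv, henc.finish] at hne
    have hfin : G.distOn S v G.t ≠ ⊤ := by
      intro h
      rw [h, add_top] at hcost
      exact hS hcost.symm
    have hflag : σ.natArr 13 v ≠ 0 := by
      intro h
      rw [← hd, storedDist, if_pos h] at hfin
      exact hfin rfl
    obtain ⟨e, he, heS, rfl, hdist⟩ := hx v hvt hflag
    have he' : σ'.natArr 14 (G.src e) = e := by rw [hk.natArr 14 (by simp), he]
    obtain ⟨g1, g2, g3⟩ := walkStep_run σ' hv he' (henc.tgt e)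
    have hwalk : G.IsWalk G.s (q ++ [e]) (G.tgt e) :=
      (WGraph.isWalk_append _).2 ⟨_, hq, rfl, rfl⟩
    -- A walk does not repeat an edge, which bounds the number of iterations by `m`.
    have hlen := (TaskGraph.nodup_of_walk hwalk).length_le_card
    simp only [List.length_append, List.length_singleton, Fintype.card_fin] at hlen
    refine Spec.of_run (by simp [walkStep, Prog.block, Prog.Straight]) ⟨m - (q ++ [e]).length,
      by simp only [List.length_append, List.length_singleton]; omega, hk.trans g2, q ++ [e],
      G.tgt e, rfl, g1, hwalk, ?_, ?_, ?_⟩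
    · simpa [or_imp, forall_and, heS] using hqS
    · rw [← hcost, hdist]
      simp [add_assoc]
    · intro f
      rw [g3]
      by_cases hf : f = e
      · simp [hf]
      · rw [Function.update_of_ne (by simpa [Fin.ext_iff] using hf), hmark]
        simp [hf]
  · subst h1
    exact ⟨(Keeps.refl σ).setNat (by norm_num) _, [], G.s, by simp, by simp [hσ.start], rfl,
      by simp, by simp, by simp [h15]⟩
  · simp only [walkStep, Prog.block, Prog.size, NExp.ops, BExp.ops]
    omega
  · rintro σ' ⟨hq, -, hk, q, v, -, hv, hwalk, hqS, hcost, hmark⟩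
    have henc := hσ.of_keeps hk (by simp) (by simp) (by simp)
    simp only [BExp.holds, NExp.eval, not_not, hv, henc.finish] at hq
    obtain rfl : v = G.t := Fin.ext (le_antisymm hq.1 hq.2)
    rw [WGraph.distOn_self, add_zero] at hcost
    exact ⟨hk, q, hwalk, hqS, hcost, hmark⟩

/-! ## The output -/

/-- Writing the number of chunks of the edge in the natural register 6, and its cost if it is not
split. -/
def outputStep : Prog :=
  .cond (.nle (.arr 15 (.reg 6)) (.lit 0))
    (.seq (.putNat 2 (.reg 6) (.lit 1)) (.putReal 1 (.arr 3 (.reg 6)) (.arr 0 (.reg 6))))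
    (.putNat 2 (.reg 6) (.reg 2))

/-- Writing the output. -/
def outputProg : Prog := .seq (.setNat 6 (.lit 0)) (.countUp 6 1 outputStep)

theorem outputStep_run (σ : Store) {e p : ℕ} (he : σ.natReg 6 = e) (hp : σ.natArr 3 e = p) :
    (outputStep.run σ).natReg = σ.natReg ∧ Keeps {2} {1} σ (outputStep.run σ) ∧
    (outputStep.run σ).natArr 2 =
      Function.update (σ.natArr 2) e (if σ.natArr 15 e = 0 then 1 else σ.natReg 2) ∧
    (outputStep.run σ).realArr 1 = if σ.natArr 15 e = 0 then
      Function.update (σ.realArr 1) p (σ.realArr 0 e) else σ.realArr 1 := by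
  by_cases h : σ.natArr 15 e = 0 <;> refine ⟨?_, ⟨?_, ?_, ?_, ?_⟩, ?_, ?_⟩
  all_goals simp +contextual [outputStep, Prog.run, he, hp, h]

theorem outputProg_spec {sub : Option Prog} {T : Store → Prop} {n m : ℕ}
    {G : TaskGraph (Fin n) (Fin m)} {b : ℝ≥0} {k : ℕ} (hk : 1 ≤ k) {σ : Store}
    (hσ : Encodes G b k σ) {C : Fin m → List ℝ≥0} (h3 : ∀ e : Fin m, σ.natArr 3 e = e * k)
    (h0 : ∀ e : Fin m, σ.natArr 15 e = 0 → C e = [G.cost e])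
    (h1 : ∀ e : Fin m, σ.natArr 15 e ≠ 0 → (C e).length = k ∧ HoldsAt σ (e * k) (C e)) :
    Spec sub T outputProg σ (100 * (m + 1)) 0 0 (GraphOutput C) := by
  have hlen : ∀ e, (C e).length ≤ k := by
    intro e
    by_cases h : σ.natArr 15 e = 0
    · simpa [h0 e h] using hk
    · exact (h1 e h).1.le
  -- An unsplit edge overwrites the first entry of its own block, and this must not touch the chunks
  -- of other edges.
  have hdisj : ∀ e i : Fin m, e ≠ i → ∀ j < (C e).length, (e : ℕ) * k + j ≠ i * k := by
    intro e i hei j hj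
    have := hlen e
    rcases lt_or_gt_of_ne fun h => hei (Fin.ext h) with h | h
    · have : ((e : ℕ) + 1) * k ≤ i * k := Nat.mul_le_mul_right k h
      rw [add_mul] at this
      omega
    · have : ((i : ℕ) + 1) * k ≤ e * k := Nat.mul_le_mul_right k h
      rw [add_mul] at this
      omega
  refine (Spec.seq (c := .setNat 6 (.lit 0)) (R := fun σ' => σ' = σ.setNat 6 0) (N := 2) (L := 0)
    (M := 0) (Spec.of_run trivial rfl) fun σ1 hσ1 => Spec.countUp (N := outputStep.size) (L := 0)
    (M := 0) (n := m) (i := 0) (fun i σ' => Keeps {2} {1} σ σ' ∧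
      (∀ e : Fin m, (e : ℕ) < i → σ'.natArr 2 e = (C e).length) ∧
      ∀ e : Fin m, (e : ℕ) < i ∨ σ.natArr 15 e ≠ 0 → HoldsAt σ' (e * k) (C e)) ?_
    (by norm_num) (Nat.zero_le _) ?_ ?_ ?_).mono ?_ (by omega) (by omega) ?_
  · rintro i σ' hi ⟨hkeep, hnum, hat⟩ h6 h7
    have henc := hσ.of_keeps hkeep (by simp) (by simp) (by simp)
    have hp : σ'.natArr 3 i = i * k := by
      rw [hkeep.natArr 3 (by simp)]
      exact h3 ⟨i, hi⟩
    obtain ⟨g1, g2, g3, g4⟩ := outputStep_run σ' h6 hp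
    rw [hkeep.natArr 15 (by simp)] at g3 g4
    rw [henc.constraint] at g3
    have hcost : σ'.realArr 0 i = G.cost ⟨i, hi⟩ := henc.cost ⟨i, hi⟩
    refine Spec.of_run (by simp [outputStep, Prog.Straight]) ⟨by rw [g1, h6], by rw [g1, h7],
      (hkeep.trans g2).setNat (by norm_num) _, fun e he => ?_, fun e he => ?_⟩
    · rw [Store.setNat_natArr, g3]
      by_cases hei : e = ⟨i, hi⟩
      · subst hei
        rw [Function.update_self]
        split_ifs with h
        · simp [h0 ⟨i, hi⟩ h]
        · rw [(h1 ⟨i, hi⟩ h).1]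
      · have hne : (e : ℕ) ≠ i := fun h => hei (Fin.ext h)
        rw [Function.update_of_ne hne]
        exact hnum e (by omega)
    · by_cases hei : e = ⟨i, hi⟩
      · subst hei
        by_cases h : σ.natArr 15 i = 0
        · rw [h0 ⟨i, hi⟩ h]
          rintro ⟨j, hj⟩
          obtain rfl : j = 0 := by simpa using hj
          simp [g4, h, hcost]
        · rw [if_neg h] at g4
          exact (hat ⟨i, hi⟩ (.inr h)).congr fun j _ => by rw [Store.setNat_realArr, g4]
      · have hne : (e : ℕ) ≠ i := fun h => hei (Fin.ext h)
        refine (hat e (he.imp_left fun he => by omega)).congr fun j hj => ?_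
        rw [Store.setNat_realArr, g4]
        split_ifs with h
        · rw [Function.update_of_ne (hdisj e ⟨i, hi⟩ hei j hj)]
        · rfl
  · simp [hσ1]
  · simp [hσ1, hσ.card_edges]
  · subst hσ1
    exact ⟨(Keeps.refl σ).setNat (by norm_num) _, fun e he => by omega,
      fun e he => (h1 e (he.resolve_left (by omega))).2⟩
  · simp only [outputStep, Prog.size, NExp.ops, RExp.ops, BExp.ops]
    omega
  · rintro σ' ⟨-, hkeep, hnum, hat⟩ e
    refine ⟨hnum e e.2, ?_⟩
    rw [hkeep.natArr 3 (by simp), h3]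
    exact hat e (.inl e.2)

/-! ## The chunking algorithm -/

theorem HoldsOrder.congr {n m : ℕ} {G : TaskGraph (Fin n) (Fin m)} {σ σ' : Store}
    (h : HoldsOrder G σ) (h8 : σ'.natArr 8 = σ.natArr 8) : HoldsOrder G σ' := by
  rw [HoldsOrder, h8]
  exact h

/-- The algorithm that computes an optimal chunking of a task graph. -/
def mainProg : Prog :=
  .seq orderProg (.seq (relaxProg 9 10 11 2) (.seq bestProg (.seq chunkProg
    (.seq (relaxProg 13 14 11 3) (.seq walkProg outputProg)))))

/-- The constants 700, 600, 500, 300, 200 and 100 are the step budgets left for the programs still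
to be run. -/
theorem mainProg_spec {n m : ℕ} (G : TaskGraph (Fin n) (Fin m)) {b : ℝ≥0} {k : ℕ} (hb : 1 < b)
    (hk : 1 ≤ k) : Spec (some edgeProg) (fun τ => ∃ e, EdgeInput G b k e τ) mainProg
      (graphInput G b k) (2000 * (m + n)) (200 * k * m) m fun σ =>
      ∃ C : Fin m → List ℝ≥0, GraphOutput C σ ∧ ∃ q, G.IsCheapestPersuadable b k q ∧
        (∀ e ∈ q, G.IsOptimalEdgeChunking b k e (C e)) ∧ ∀ e, e ∉ q → C e = [G.cost e] := by
  -- Since `s` exists, additive constants are absorbed by `n`.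
  have hn : 0 < n := Fin.pos G.s
  set σ0 := graphInput G b k
  have hσ0 : Encodes G b k σ0 := encodes_graphInput G b k
  have hz : ∀ a, 1 < a → ∀ i, σ0.natArr a i = 0 := by
    intro a ha i
    simp only [σ0, graphInput]
    split_ifs <;> first | rfl | omega
  have hzr : ∀ a, 0 < a → ∀ i, σ0.realArr a i = 0 := by
    intro a ha i
    simp [σ0, graphInput, ha.ne']
  have hreg : ∀ x, 5 < x → σ0.natReg x = 0 := by
    intro x hx
    simp only [σ0, graphInput]
    split_ifs <;> first | rfl | omega
  refine (Spec.seq (N' := 700 * (m + 1)) (L' := 200 * k * m) (M' := m)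
    (orderProg_spec hσ0 hreg (hz 4 (by norm_num)) (hz 5 (by norm_num))) ?_).mono (by omega)
    (by omega) (by omega) fun _ h => h
  rintro σ1 ⟨k1, ho1⟩
  have henc1 := hσ0.of_keeps k1 (by simp) (by simp) (by simp)
  refine (Spec.seq (N' := 600 * (m + 1)) (L' := 200 * k * m) (M' := m)
    (relaxProg_spec (F := 9) (X := 10) (B := 11) (D := 2) (by norm_num) (by norm_num) (by norm_num)
      (by norm_num) (by norm_num) (by norm_num) henc1 ho1
      (fun u => by rw [k1.natArr 9 (by simp), hz 9 (by norm_num)])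
      (fun u => by rw [k1.realArr 2 (by simp), hzr 2 (by norm_num)])) ?_).mono (by omega)
    (by omega) (by omega) fun _ h => h
  rintro σ2 ⟨k2, hnn2, hd2⟩
  have henc2 := henc1.of_keeps k2 (by simp) (by simp) (by simp)
  have ho2 : HoldsOrder G σ2 := ho1.congr (k2.natArr 8 (by simp))
  have hdist2 : HoldsDist G σ2 := by
    refine ⟨hnn2, fun u => ?_⟩
    rw [(hd2 u).1, k1.natArr 11 (by simp)]
    simp only [hz 11 (by norm_num), WGraph.distOn_true]
  replace k2 := (k1.mono (A' := {4, 5, 6, 7, 8, 9, 10}) (B' := {2}) (by decide) (by simp)).trans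
    (k2.mono (by decide) (by simp))
  refine (Spec.seq (N' := 500 * (m + 1)) (L' := 200 * k * m) (M' := m)
    (bestProg_spec henc2 hdist2 fun u => by rw [k2.natArr 12 (by decide), hz 12 (by norm_num)])
      ?_).mono (by omega) (by omega) (by omega) fun _ h => h
  rintro σ3 ⟨k3, hbest3⟩
  have henc3 := henc2.of_keeps k3 (by simp) (by simp) (by simp)
  refine (Spec.seq (N' := 300 * (m + 1)) (L' := 0) (M' := 0)
    (chunkProg_spec hb hk henc3 (hdist2.congr (k3.natArr 9 (by simp)) (k3.realArr 2 (by simp)))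
      hbest3 fun i => by rw [k3.natArr 11 (by simp), k2.natArr 11 (by decide), hz 11 (by norm_num)])
      ?_).mono (by omega) (by omega) (by omega) fun _ h => h
  rintro σ4 ⟨k4, hdone⟩
  have henc4 := henc3.of_keeps k4 (by simp) (by simp) (by simp)
  have ho4 : HoldsOrder G σ4 := ho2.congr
    ((k4.natArr 8 (by simp)).trans (k3.natArr 8 (by simp)))
  replace k4 := (k2.mono (A' := {3, 4, 5, 6, 7, 8, 9, 10, 11, 12}) (B' := {1, 2}) (by decide)
    (by simp)).trans ((k3.mono (by decide) (by simp)).trans (k4.mono (by decide) (by simp)))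
  refine (Spec.seq (N' := 200 * (m + 1)) (L' := 0) (M' := 0)
    (relaxProg_spec (F := 13) (X := 14) (B := 11) (D := 3) (by norm_num) (by norm_num) (by norm_num)
      (by norm_num) (by norm_num) (by norm_num) henc4 ho4
      (fun u => by rw [k4.natArr 13 (by decide), hz 13 (by norm_num)])
      (fun u => by rw [k4.realArr 3 (by decide), hzr 3 (by norm_num)])) ?_).mono (by omega)
    (by omega) (by omega) fun _ h => h
  rintro σ5 ⟨k5, -, hd5⟩
  have henc5 := henc4.of_keeps k5 (by simp) (by simp) (by simp)
  -- An edge may also be blocked because `t` cannot be reached from its target; on walks to `t` this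
  -- does not occur, so there the blocked edges are exactly those that are not persuadable.
  have hS : ∀ {e p}, G.IsWalk (G.tgt e) p G.t →
      (σ4.natArr 11 e = 0 ↔ G.Persuadable b k e) := fun h => by
    rw [(hdone _).blocked, and_iff_right (WGraph.dist_ne_top_iff.2 ⟨_, h⟩)]
  have hSwalk : ∀ {u q}, G.IsWalk u q G.t →
      ((∀ e ∈ q, σ4.natArr 11 e = 0) ↔ ∀ e ∈ q, G.Persuadable b k e) := fun h =>
    forall₂_congr fun e he => by
      obtain ⟨q₁, q₂, rfl⟩ := List.append_of_mem he
      obtain ⟨v, -, -, h2⟩ := (WGraph.isWalk_append _).1 h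
      exact hS h2
  obtain ⟨p, hp, hpS⟩ := G.exists_persuadable_walk (b := b) hk G.s TaskGraph.dist_s_ne_top
  refine (Spec.seq (N' := 100 * (m + 1)) (L' := 0) (M' := 0)
    (walkProg_spec henc5 (S := fun e => σ4.natArr 11 e = 0)
      (WGraph.distOn_ne_top_iff.2 ⟨p, hp, (hSwalk hp).2 hpS⟩) (fun u => (hd5 u).1)
      (fun u => (hd5 u).2) fun i => by
        rw [k5.natArr 15 (by simp), k4.natArr 15 (by decide), hz 15 (by norm_num)]) ?_).mono
    (by omega) (by omega) (by omega) fun _ h => h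
  rintro σ6 ⟨k6, q, hq, hqS, hcost, hmark⟩
  have henc6 := henc5.of_keeps k6 (by simp) (by simp) (by simp)
  have hcheap : G.IsCheapestPersuadable b k q := by
    refine ⟨⟨hq, (hSwalk hq).1 hqS⟩, fun q' hq' hS' => ?_⟩
    rw [← ENNReal.coe_le_coe, hcost]
    exact WGraph.distOn_le hq' ((hSwalk hq').2 hS')
  have hchunks : ∀ e ∈ q, ∃ l, G.IsOptimalEdgeChunking b k e l ∧ HoldsAt σ4 (e * k) l :=
    fun e he => (hdone e).chunks ((hdone e).blocked.1 (hqS e he)).1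
  choose! L hL hat using hchunks
  let C : Fin m → List ℝ≥0 := fun e => if e ∈ q then L e else [G.cost e]
  have hCq : ∀ e ∈ q, C e = L e := fun e he => if_pos he
  have hCno : ∀ e, e ∉ q → C e = [G.cost e] := fun e he => if_neg he
  refine (outputProg_spec hk henc6 (C := C) (fun e => ?_) (fun e he => hCno e ?_)
    fun e he => ?_).imp fun σ' h => ⟨C, h, q, hcheap, fun e he => hCq e he ▸ hL e he, hCno⟩
  · rw [k6.natArr 3 (by simp), k5.natArr 3 (by simp), (hdone e).position]
  · rw [← hmark]
    exact not_not.2 he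
  · have he := (hmark e).1 he
    rw [hCq e he]
    refine ⟨(hL e he).1.1, (hat e he).congr fun j _ => ?_⟩
    rw [k6.realArr 1 (by simp), k5.realArr 1 (by simp)]

end Chunking

theorem mainTheorem3 :
    ∃ (P main : Prog) (A : ℕ),
      IsEdgeChunkingAlgorithm A P ∧
      ∀ (n m : ℕ) (G : TaskGraph (Fin n) (Fin m)) (b : ℝ≥0) (k : ℕ), 1 < b → 1 ≤ k →
        ∃ (σ : Store) (κ : Cost) (C : Fin m → List ℝ≥0),
          Exec (some P) main (graphInput G b k) σ κ ∧
          -- at most `|E|` calls of the edge-chunking algorithm, each for an edge of `G`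
          κ.calls.length ≤ m ∧
          (∀ τ ∈ κ.calls, ∃ e : Fin m, EdgeInput G b k e τ) ∧
          -- running time without and with the calls
          κ.own ≤ A * (m + n) ∧
          κ.own + κ.inner ≤ A * (m * k + n) ∧
          -- the output is an optimal chunking
          GraphOutput C σ ∧
          G.IsOptimalChunking b k C ∧
          -- it splits the edges of a cheapest path of persuadable edges, which the agent follows
          ∃ q : List (Fin m),
            G.IsCheapestPersuadable b k q ∧
            (∀ e ∈ q, G.IsOptimalEdgeChunking b k e (C e)) ∧
            (∀ e, e ∉ q → C e = [G.cost e]) ∧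
            G.AgentRun b C (G.expand C q) := by
  -- The constant adds 2000 for the steps outside the calls to 200 per chunk inside them.
  refine ⟨edgeProg, mainProg, 2200, isEdgeChunkingAlgorithm_edgeProg (by norm_num), ?_⟩
  intro n m G b k hb hk
  obtain ⟨σ, κ, h, hown, hinner, hlen, hcalls, C, hout, q, hq, hopt, hno⟩ :=
    mainProg_spec G hb hk
  have hmk : m ≤ m * k := Nat.le_mul_of_pos_right m hk
  obtain ⟨h1, h2⟩ := TaskGraph.isOptimalChunking_of_path hb.le hk hq hopt hno
  refine ⟨σ, κ, C, h, hlen, hcalls, by omega, ?_, hout, h1, q, hq, hopt, hno, h2⟩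
  have : 200 * k * m = 200 * (m * k) := by ring
  omega
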